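/- Let $M$ be a smooth finite-dimensional manifold and let $\mathcal TM\to M$ be an extended tangent bundle, i.e. an exact Courant algebroid: a smooth real vector bundle with a nondegenerate symmetric pairing $\langle\cdot,\cdot\rangle$, a vector bundle homomorphism $a:\mathcal TM\to TM$ (the anchor) and an $\mathbb R$-bilinear bracket $*$ on $\Gamma(\mathcal TM)$ (the Loday or Dorfman bracket) such that for all sections $$\mathfrak X*(\mathfrak Y*\mathfrak Z)=(\mathfrak X*\mathfrak Y)*\mathfrak Z+\mathfrak Y*(\mathfrak X*\mathfrak Z),$$ $$a(\mathfrak X)\langle\mathfrak Y,\mathfrak Z\rangle=\langle\mathfrak X,\mathfrak Y*\mathfrak Z+\mathfrak Z*\mathfrak Y\rangle=\langle\mathfrak X*\mathfrak Y,\mathfrak Z\rangle+\langle\mathfrak Y,\mathfrak X*\mathfrak Z\rangle,$$ and such that $0\to T^*M\xrightarrow{a^*}\mathcal TM\xrightarrow{a}TM\to0$ is exact, where $2\langle a^*\xi,\mathfrak X\rangle=\xi(a(\mathfrak X))$. One-forms are regarded as sections of $\mathcal TM$ through $a^*$. Let $\mathcal I(M)$ be the set of isotropic splittings $s:TM\to\mathcal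 TM$ of $a$, on which $B\in\Omega^2(M)$ acts by $(B\circ s)(X)=s(X)+\iota_XB$. The twisting form of $s$ is the $3$-form $H(X,Y,Z)=2\langle s(X),s(Y)*s(Z)\rangle$. The space of abstract spinors is $\mathcal S^\bullet(M)=\mathcal I(M)\times_{\Omega^2(M)}\Omega^\bullet(M)$, the set of classes $[s,\rho]$ of pairs under $[B\circ s,\rho]=[s,e^{-B}\wedge\rho]$, $B\in\Omega^2(M)$. For every $s\in\mathcal I(M)$ the map $\rho\mapsto[s,\rho]$ is a bijection $\Omega^\bullet(M)\to\mathcal S^\bullet(M)$, and the vector space structure of $\mathcal S^\bullet(M)$ and the multiplication of spinors by smooth functions are those of $\Omega^\bullet(M)$, which do not depend on $s$. For $\mathfrak X=s(X)+\xi\in\Gamma(\mathcal TM)$, with $X=a(\mathfrak X)$ and $\xi=\mathfrak X-s(X)$, define operators on $\mathcal S^\bullet(M)$ by $$d_{\mathcal T}[s,\rho]=[s,\,d\rho-H\wedge\rho],\qquad \iota_{\mathfrak X}[s,\rho]=[s,\,\iota_X\rho+\xi\wedge\rho],\qquad \mathcal L^{\mathcal T}_{\mathfrak X}[s,\rho]=[s,\,\mathcal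 L_X\rho+(d\xi-\iota_XH)\wedge\rho].$$ **Theorem.** The operators $d_{\mathcal T}$, $\iota_{\mathfrak X}$ and $\mathcal L^{\mathcal T}_{\mathfrak X}$ on $\mathcal S^\bullet(M)$ are well defined, that is, independent of the choice of the isotropic splitting $s$, and for all $\mathfrak X,\mathfrak Y\in\Gamma(\mathcal TM)$ and $\rho\in\mathcal S^\bullet(M)$ \begin{align*} \mathcal L^{\mathcal T}_{\mathfrak X}\rho&=(d_{\mathcal T}\iota_{\mathfrak X}+\iota_{\mathfrak X}d_{\mathcal T})\rho,\\ [\mathcal L^{\mathcal T}_{\mathfrak X},\mathcal L^{\mathcal T}_{\mathfrak Y}]\rho&=\mathcal L^{\mathcal T}_{\mathfrak X*\mathfrak Y}\rho,\\ (\iota_{\mathfrak X}\iota_{\mathfrak Y}+\iota_{\mathfrak Y}\iota_{\mathfrak X})\rho&=2\langle\mathfrak X,\mathfrak Y\rangle\rho,\\ (\mathcal L^{\mathcal T}_{\mathfrak X}\iota_{\mathfrak Y}-\iota_{\mathfrak Y}\mathcal L^{\mathcal T}_{\mathfrak X})\rho&=\iota_{\mathfrak X*\mathfrak Y}\rho,\\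 (d_{\mathcal T}\mathcal L^{\mathcal T}_{\mathfrak X}-\mathcal L^{\mathcal T}_{\mathfrak X}d_{\mathcal T})\rho&=0,\\ d_{\mathcal T}^2\rho&=0. \end{align*} -/

import Mathlib

open Bundle Set Function
open scoped Manifold ContDiff Topology

set_option linter.unusedSectionVars false

noncomputable section

namespace ExtendedManifold

section Basics

variable {E : Type*} [NormedAddCommGroup E] [NormedSpace ℝ E]
  {M : Type*} [TopologicalSpace M] [ChartedSpace E M]
  {F : Type*} [NormedAddCommGroup F] [NormedSpace ℝ F]
  {V : M → Type*} [TopologicalSpace (TotalSpace F V)] [∀ x, TopologicalSpace (V x)]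
  [FiberBundle F V] [∀ x, AddCommGroup (V x)] [∀ x, Module ℝ (V x)] [VectorBundle ℝ F V]

/-- The product `f σ` of a smooth function and a smooth section of a vector bundle. -/
def funSMul (f : C^∞⟮𝓘(ℝ, E), M; ℝ⟯) (σ : Cₛ^∞⟮𝓘(ℝ, E); F, V⟯) : Cₛ^∞⟮𝓘(ℝ, E); F, V⟯ :=
  ⟨fun x => f x • σ x, f.contMDiff.smul_section σ.contMDiff⟩

theorem funSMul_apply (f : C^∞⟮𝓘(ℝ, E), M; ℝ⟯) (σ : Cₛ^∞⟮𝓘(ℝ, E); F, V⟯) (x : M) :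
    funSMul f σ x = f x • σ x := rfl

/-- Every vector of a vector bundle extends to a smooth global section. -/
theorem exists_section_eq [FiniteDimensional ℝ E] [IsManifold 𝓘(ℝ, E) ∞ M] [T2Space M]
    [ContMDiffVectorBundle ∞ F V 𝓘(ℝ, E)] (x : M) (v : V x) :
    ∃ σ : Cₛ^∞⟮𝓘(ℝ, E); F, V⟯, σ x = v := by
  obtain ⟨s, hs, hσ⟩ := FiberBundle.exists_contMDiffOn_extend (k := ∞) 𝓘(ℝ, E) F v
  obtain ⟨χ, -, hχ⟩ := (SmoothBumpFunction.nhds_basis_tsupport (I := 𝓘(ℝ, E)) x).mem_iff.1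
    (interior_mem_nhds.2 hs)
  refine ⟨⟨fun y => χ y • FiberBundle.extend F v y, ?_⟩, ?_⟩
  · exact ContMDiffOn.smul_section_of_tsupport χ.contMDiff.contMDiffOn isOpen_interior hχ
      (hσ.mono interior_subset)
  · simp

/-- A smooth section that vanishes at `x` is a combination of smooth sections with smooth
coefficients that vanish at `x`. -/
theorem exists_sum_of_apply_eq_zero [FiniteDimensional ℝ E] [IsManifold 𝓘(ℝ, E) ∞ M] [T2Space M]
    [FiniteDimensional ℝ F] [ContMDiffVectorBundle ∞ F V 𝓘(ℝ, E)] (x : M)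
    (σ : Cₛ^∞⟮𝓘(ℝ, E); F, V⟯) (hσ : σ x = 0) :
    ∃ (n : ℕ) (g : C^∞⟮𝓘(ℝ, E), M; ℝ⟯) (f : Fin n → C^∞⟮𝓘(ℝ, E), M; ℝ⟯)
      (τ : Fin n → Cₛ^∞⟮𝓘(ℝ, E); F, V⟯),
      g x = 0 ∧ (∀ i, f i x = 0) ∧ σ = funSMul g σ + ∑ i, funSMul (f i) (τ i) := by
  classical
  have : ContMDiffVectorBundle 1 F V 𝓘(ℝ, E) :=
    ContMDiffVectorBundle.of_le (n := ∞) (by exact_mod_cast le_top)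
  set e := trivializationAt F V x
  have hx : x ∈ e.baseSet := FiberBundle.mem_baseSet_trivializationAt F V x
  let b := Module.finBasis ℝ F
  obtain ⟨χ, -, hχ⟩ := (SmoothBumpFunction.nhds_basis_tsupport (I := 𝓘(ℝ, E)) x).mem_iff.1
    (e.open_baseSet.mem_nhds hx)
  have hχs : ∀ y, y ∉ e.baseSet → χ y = 0 := fun y hy =>
    image_eq_zero_of_notMem_tsupport fun h => hy (hχ h)
  -- the frame and the coefficients, cut off by the bump function
  let τ : Fin (Module.finrank ℝ F) → Cₛ^∞⟮𝓘(ℝ, E); F, V⟯ := fun i =>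
    ⟨fun y => χ y • e.localFrame b i y,
      ContMDiffOn.smul_section_of_tsupport χ.contMDiff.contMDiffOn e.open_baseSet hχ
        (e.contMDiffOn_localFrame_baseSet (I := 𝓘(ℝ, E)) ∞ b i)⟩
  let f : Fin (Module.finrank ℝ F) → C^∞⟮𝓘(ℝ, E), M; ℝ⟯ := fun i =>
    ⟨fun y => χ y * e.localFrameCoeff 𝓘(ℝ, E) b i y (σ y), by
      refine contMDiff_of_tsupport fun y hy => ?_
      have hy' : y ∈ e.baseSet := hχ (closure_mono (support_mul_subset_left _ _) hy)
      exact χ.contMDiff.contMDiffAt.mul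
        (contMDiffAt_localFrameCoeff (V := V) b hy' σ.contMDiff.contMDiffAt i)⟩
  let g : C^∞⟮𝓘(ℝ, E), M; ℝ⟯ := ⟨fun y => 1 - χ y ^ 2,
    contMDiff_const.sub (χ.contMDiff.pow 2)⟩
  have hfa : ∀ i y, f i y = χ y * e.localFrameCoeff 𝓘(ℝ, E) b i y (σ y) := fun _ _ => rfl
  have hga : ∀ y, g y = 1 - χ y ^ 2 := fun _ => rfl
  refine ⟨Module.finrank ℝ F, g, f, τ, by simp [hga], by simp [hfa, hσ], ?_⟩
  ext y
  have hsum : (∑ i, funSMul (f i) (τ i)) y = ∑ i, (f i y) • (τ i y) := by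
    have := congrFun (map_sum (ContMDiffSection.coeAddHom 𝓘(ℝ, E) F ∞ V)
      (fun i => funSMul (f i) (τ i)) Finset.univ) y
    rw [Finset.sum_apply] at this
    exact this
  have hadd : (funSMul g σ + ∑ i, funSMul (f i) (τ i)) y
      = g y • σ y + ∑ i, (f i y) • (τ i y) := by rw [← hsum]; rfl
  rw [hadd]
  have hτ : ∀ i, f i y • τ i y
      = χ y ^ 2 • (e.localFrameCoeff 𝓘(ℝ, E) b i y (σ y) • e.localFrame b i y) := by
    intro i
    change (χ y * e.localFrameCoeff 𝓘(ℝ, E) b i y (σ y)) • (χ y • e.localFrame b i y) = _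
    rw [smul_smul, smul_smul]
    congr 1
    ring
  by_cases hy : y ∈ e.baseSet
  · have h := e.eq_sum_localFrameCoeff_smul (I := 𝓘(ℝ, E)) (b := b) (s := fun z => σ z) hy
    rw [Finset.sum_congr rfl fun i _ => hτ i, ← Finset.smul_sum, ← h, hga, ← add_smul]
    simp
  · rw [Finset.sum_congr rfl fun i _ => hτ i]
    simp [hga, hχs y hy]

end Basics

section Forms

variable (E : Type*) [NormedAddCommGroup E] [NormedSpace ℝ E]
  (M : Type*) [TopologicalSpace M] [ChartedSpace E M] [IsManifold 𝓘(ℝ, E) ∞ M]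

/-- Smooth vector fields on `M`. -/
abbrev VectorField : Type _ :=
  Cₛ^∞⟮𝓘(ℝ, E); E, (TangentSpace 𝓘(ℝ, E) : M → Type _)⟯

/-- Smooth differential `k`-forms on `M`: families of alternating `k`-linear forms on the tangent
spaces whose value on any `k` smooth vector fields is a smooth function. -/
def DiffForm (k : ℕ) : Submodule ℝ (∀ x : M, TangentSpace 𝓘(ℝ, E) x [⋀^Fin k]→ₗ[ℝ] ℝ) where
  carrier := {α | ∀ V : Fin k → VectorField E M,
    ContMDiff 𝓘(ℝ, E) 𝓘(ℝ, ℝ) ∞ fun x => α x fun i => V i x}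
  add_mem' := fun ha hb V => (ha V).add (hb V)
  zero_mem' := fun _ => contMDiff_const
  smul_mem' := fun _ _ ha V => contMDiff_const.mul (ha V)

variable {E M}

/-- The Lie bracket of smooth vector fields. -/
def lieBracketField [FiniteDimensional ℝ E] (X Y : VectorField E M) : VectorField E M :=
  ⟨VectorField.mlieBracket 𝓘(ℝ, E) X Y, by
    have : CompleteSpace E := FiniteDimensional.complete ℝ E
    have : IsManifold 𝓘(ℝ, E) (((⊤ : ℕ∞) : WithTop ℕ∞) + 1) M := ‹IsManifold 𝓘(ℝ, E) ∞ M›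
    have : IsManifold 𝓘(ℝ, E) (minSmoothness ℝ 2) M :=
      IsManifold.of_le (n := ∞) (by
        rw [minSmoothness_of_isRCLikeNormedField]
        exact WithTop.coe_le_coe.2 (le_top : (2 : ℕ∞) ≤ ⊤))
    exact ContDiff.mlieBracket_vectorField (m := ⊤) (n := ⊤) X.contMDiff Y.contMDiff (by simp)⟩

/-- The derivative `X f` of a smooth function along a vector field. -/
def dirDeriv (X : VectorField E M) (f : C^∞⟮𝓘(ℝ, E), M; ℝ⟯) : C^∞⟮𝓘(ℝ, E), M; ℝ⟯ :=
  ⟨fun x => mvfderiv 𝓘(ℝ, E) f x (X x), by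
    have h := (f.contMDiff.contMDiff_tangentMap (m := ∞) (n := ∞) (by simp)).comp X.contMDiff
    exact (contMDiff_snd_tangentBundle_modelSpace ℝ 𝓘(ℝ, ℝ)).comp h⟩

/-- The value of a `k`-form on `k` vector fields. -/
def evalFields {k : ℕ} (α : DiffForm E M k) :
    VectorField E M [⋀^Fin k]→ₗ[ℝ] C^∞⟮𝓘(ℝ, E), M; ℝ⟯ where
  toFun V := ⟨fun x => α.1 x fun i => V i x, α.2 V⟩
  map_update_add' := by
    intro _ V i X Y
    ext x
    have h : ∀ Z : VectorField E M, (fun j => update V i Z j x) = update (fun j => V j x) i (Z x) :=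
      fun Z => by ext j; by_cases hj : j = i <;> [(subst hj; simp); simp [hj]]
    change α.1 x (fun j => update V i (X + Y) j x)
      = α.1 x (fun j => update V i X j x) + α.1 x (fun j => update V i Y j x)
    rw [h, h, h]
    exact (α.1 x).map_update_add _ _ _ _
  map_update_smul' := by
    intro _ V i c X
    ext x
    have h : ∀ Z : VectorField E M, (fun j => update V i Z j x) = update (fun j => V j x) i (Z x) :=
      fun Z => by ext j; by_cases hj : j = i <;> [(subst hj; simp); simp [hj]]
    change α.1 x (fun j => update V i (c • X) j x) = c • α.1 x (fun j => update V i X j x)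
    rw [h, h]
    exact (α.1 x).map_update_smul _ _ _ _
  map_eq_zero_of_eq' := by
    intro V i j hV hij
    ext x
    exact (α.1 x).map_eq_zero_of_eq (fun i => V i x) (by simp [hV]) hij

@[simp]
theorem evalFields_apply {k : ℕ} (α : DiffForm E M k) (V : Fin k → VectorField E M) (x : M) :
    evalFields α V x = α.1 x fun i => V i x := rfl

/-- Evaluation of vector fields at a point. -/
def evalAt (x : M) : VectorField E M →ₗ[ℝ] TangentSpace 𝓘(ℝ, E) x where
  toFun X := X x
  map_add' _ _ := rfl
  map_smul' _ _ := rfl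

variable [FiniteDimensional ℝ E] [T2Space M]

theorem evalAt_surjective (x : M) : Surjective (evalAt (E := E) x) :=
  fun v => exists_section_eq (V := (TangentSpace 𝓘(ℝ, E) : M → Type _)) x v

theorem DiffForm.ext_fields {k : ℕ} {α β : DiffForm E M k}
    (h : ∀ V x, evalFields α V x = evalFields β V x) : α = β := by
  refine Subtype.ext (funext fun x => AlternatingMap.ext fun v => ?_)
  choose V hV using fun i => evalAt_surjective (E := E) x (v i)
  have := h V x
  simp only [evalFields_apply] at this
  have hv : (fun i => V i x) = v := funext hV
  rwa [hv] at this

section OfTensor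

variable {k : ℕ} (Φ : VectorField E M [⋀^Fin k]→ₗ[ℝ] C^∞⟮𝓘(ℝ, E), M; ℝ⟯)

theorem tensor_eq_zero
    (hΦ : ∀ (f : C^∞⟮𝓘(ℝ, E), M; ℝ⟯) (V : Fin k → VectorField E M) (i : Fin k),
      Φ (update V i (funSMul f (V i))) = f * Φ V)
    (x : M) (V : Fin k → VectorField E M) (i : Fin k) (h : V i x = 0) :
    Φ V x = 0 := by
  obtain ⟨n, g, f, τ, hg, hf, hV⟩ := exists_sum_of_apply_eq_zero x (V i) h
  have key : ∀ (f : C^∞⟮𝓘(ℝ, E), M; ℝ⟯) (σ : VectorField E M), f x = 0 →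
      Φ (update V i (funSMul f σ)) x = 0 := by
    intro f σ hf
    have := hΦ f (update V i σ) i
    rw [update_self, update_idem] at this
    rw [this]
    simp [hf]
  have h1 : Φ V = Φ (update V i (funSMul g (V i) + ∑ j, funSMul (f j) (τ j))) := by
    rw [← hV, update_eq_self]
  rw [h1, Φ.map_update_add, Φ.map_update_sum, ContMDiffMap.coe_add, Pi.add_apply, key _ _ hg,
    zero_add]
  have h2 := map_sum (ContMDiffMap.evalRingHom (I := 𝓘(ℝ, E)) (n := ∞) (R := ℝ) x)
    (fun j => Φ (update V i (funSMul (f j) (τ j)))) Finset.univ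
  refine h2.trans (Finset.sum_eq_zero fun j _ => key _ _ (hf j))

/-- A family of values only depends on the values of the vector fields at the point. -/
theorem tensor_congr
    (hΦ : ∀ (f : C^∞⟮𝓘(ℝ, E), M; ℝ⟯) (V : Fin k → VectorField E M) (i : Fin k),
      Φ (update V i (funSMul f (V i))) = f * Φ V)
    (x : M) (V W : Fin k → VectorField E M) (h : ∀ i, V i x = W i x) :
    Φ V x = Φ W x := by
  classical
  have key : ∀ s : Finset (Fin k), Φ (s.piecewise V W) x = Φ W x := by
    intro s
    induction s using Finset.induction_on with
    | empty => simp
    | insert i s hi ih =>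
      rw [Finset.piecewise_insert, ← ih]
      have h1 : Φ (s.piecewise V W) = Φ (update (s.piecewise V W) i (W i)) := by
        congr 1
        rw [eq_update_iff]
        simp [hi]
      have h2 : Φ (update (s.piecewise V W) i (V i)) - Φ (update (s.piecewise V W) i (W i))
          = Φ (update (s.piecewise V W) i (V i - W i)) := (Φ.map_update_sub _ _ _ _).symm
      have h3 := tensor_eq_zero Φ hΦ x (update (s.piecewise V W) i (V i - W i)) i
        (by simp [h i])
      rw [← h2, ContMDiffMap.coe_sub, Pi.sub_apply, sub_eq_zero] at h3
      rw [h1, h3]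
  simpa using key Finset.univ

/-- The differential form with prescribed values on vector fields, provided that these values are
multilinear over the smooth functions. -/
def ofTensor
    (hΦ : ∀ (f : C^∞⟮𝓘(ℝ, E), M; ℝ⟯) (V : Fin k → VectorField E M) (i : Fin k),
      Φ (update V i (funSMul f (V i))) = f * Φ V) :
    DiffForm E M k :=
  ⟨fun x => ((LinearMap.proj x ∘ₗ ContMDiffMap.coeFnLinearMap).compAlternatingMap Φ).compLinearMap
      (Classical.choose ((evalAt (E := E) x).exists_rightInverse_of_surjective
        (LinearMap.range_eq_top.2 (evalAt_surjective x)))), fun V => by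
    refine (Φ V).contMDiff.congr fun x => ?_
    have h := Classical.choose_spec ((evalAt (E := E) x).exists_rightInverse_of_surjective
        (LinearMap.range_eq_top.2 (evalAt_surjective x)))
    exact tensor_congr Φ hΦ x _ V fun i => LinearMap.congr_fun h (V i x)⟩

theorem evalFields_ofTensor
    (hΦ : ∀ (f : C^∞⟮𝓘(ℝ, E), M; ℝ⟯) (V : Fin k → VectorField E M) (i : Fin k),
      Φ (update V i (funSMul f (V i))) = f * Φ V) :
    evalFields (ofTensor Φ hΦ) = Φ := by
  ext V x
  have h := Classical.choose_spec ((evalAt (E := E) x).exists_rightInverse_of_surjective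
        (LinearMap.range_eq_top.2 (evalAt_surjective x)))
  exact tensor_congr Φ hΦ x _ V fun i => LinearMap.congr_fun h (V i x)

end OfTensor

section Calculus

theorem mdifferentiableAt_fun (f : C^∞⟮𝓘(ℝ, E), M; ℝ⟯) (x : M) :
    MDifferentiableAt 𝓘(ℝ, E) 𝓘(ℝ, ℝ) f x :=
  f.contMDiff.mdifferentiableAt (by simp)

theorem mdifferentiableAt_field (X : VectorField E M) (x : M) :
    MDifferentiableAt 𝓘(ℝ, E) 𝓘(ℝ, E).tangent
      (fun y => (⟨y, X y⟩ : TangentBundle 𝓘(ℝ, E) M)) x :=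
  X.contMDiff.mdifferentiableAt (by simp)

/-- `dirDeriv` as a bilinear map. -/
def dirDerivLin : VectorField E M →ₗ[ℝ] C^∞⟮𝓘(ℝ, E), M; ℝ⟯ →ₗ[ℝ] C^∞⟮𝓘(ℝ, E), M; ℝ⟯ :=
  LinearMap.mk₂ ℝ dirDeriv
    (fun X Y f => by ext x; exact map_add (mvfderiv 𝓘(ℝ, E) f x) (X x) (Y x))
    (fun c X f => by ext x; exact map_smul (mvfderiv 𝓘(ℝ, E) f x) c (X x))
    (fun X f g => by
      ext x
      exact congrArg (fun l => l (X x))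
        (mvfderiv_add (mdifferentiableAt_fun f x) (mdifferentiableAt_fun g x)))
    (fun c X f => by
      ext x
      have h := congrArg (fun l => l (X x)) (mvfderiv_smul (x := x) (I := 𝓘(ℝ, E)) (a := fun _ => c)
        mdifferentiableAt_const (mdifferentiableAt_fun f x))
      simp [mvfderiv_const] at h
      exact h)

theorem dirDeriv_mul (X : VectorField E M) (f g : C^∞⟮𝓘(ℝ, E), M; ℝ⟯) :
    dirDeriv X (f * g) = f * dirDeriv X g + dirDeriv X f * g := by
  ext x
  have h := congrArg (fun l => l (X x))
    (mvfderiv_mul (mdifferentiableAt_fun f x) (mdifferentiableAt_fun g x))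
  simp at h
  refine Eq.trans ?_ (h.trans ?_)
  · rfl
  · change _ = f x * _ + _ * g x
    rw [mul_comm _ (g x)]
    rfl

theorem dirDeriv_funSMul (f : C^∞⟮𝓘(ℝ, E), M; ℝ⟯) (X : VectorField E M)
    (g : C^∞⟮𝓘(ℝ, E), M; ℝ⟯) : dirDeriv (funSMul f X) g = f * dirDeriv X g := by
  ext x
  exact map_smul (mvfderiv 𝓘(ℝ, E) g x) (f x) (X x)

theorem lieBracketField_swap (X Y : VectorField E M) :
    lieBracketField X Y = -lieBracketField Y X := by
  ext x
  exact congrFun (VectorField.mlieBracket_swap (V := X) (W := Y)) x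

/-- `lieBracketField` as a bilinear map. -/
def lieBracketLin : VectorField E M →ₗ[ℝ] VectorField E M →ₗ[ℝ] VectorField E M :=
  have : CompleteSpace E := FiniteDimensional.complete ℝ E
  LinearMap.mk₂ ℝ lieBracketField
    (fun X Y Z => by
      ext x
      exact VectorField.mlieBracket_add_left (mdifferentiableAt_field X x)
        (mdifferentiableAt_field Y x))
    (fun c X Z => by
      ext x
      exact VectorField.mlieBracket_const_smul_left (mdifferentiableAt_field X x))
    (fun X Y Z => by
      ext x
      exact VectorField.mlieBracket_add_right (mdifferentiableAt_field Y x)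
        (mdifferentiableAt_field Z x))
    (fun c X Z => by
      ext x
      exact VectorField.mlieBracket_const_smul_right (mdifferentiableAt_field Z x))

theorem lieBracketField_funSMul_right (f : C^∞⟮𝓘(ℝ, E), M; ℝ⟯) (X Y : VectorField E M) :
    lieBracketField X (funSMul f Y)
      = funSMul (dirDeriv X f) Y + funSMul f (lieBracketField X Y) := by
  have : CompleteSpace E := FiniteDimensional.complete ℝ E
  ext x
  exact VectorField.mlieBracket_smul_right (mdifferentiableAt_fun f x) (mdifferentiableAt_field Y x)

theorem lieBracketField_funSMul_left (f : C^∞⟮𝓘(ℝ, E), M; ℝ⟯) (X Y : VectorField E M) :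
    lieBracketField (funSMul f X) Y
      = -funSMul (dirDeriv Y f) X + funSMul f (lieBracketField X Y) := by
  rw [lieBracketField_swap, lieBracketField_funSMul_right, lieBracketField_swap Y X]
  ext x
  simp only [ContMDiffSection.coe_add, ContMDiffSection.coe_neg, Pi.add_apply, Pi.neg_apply,
    funSMul_apply, neg_add, smul_neg, neg_neg]

end Calculus

section Operations

variable {k : ℕ}

theorem evalFields_update_funSMul (α : DiffForm E M k) (f : C^∞⟮𝓘(ℝ, E), M; ℝ⟯)
    (V : Fin k → VectorField E M) (i : Fin k) (X : VectorField E M) :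
    evalFields α (update V i (funSMul f X)) = f * evalFields α (update V i X) := by
  ext x
  have h : ∀ Z : VectorField E M, (fun j => update V i Z j x) = update (fun j => V j x) i (Z x) :=
    fun Z => by ext j; by_cases hj : j = i <;> [(subst hj; simp); simp [hj]]
  change α.1 x (fun j => update V i (funSMul f X) j x) = f x * α.1 x (fun j => update V i X j x)
  rw [h, h]
  exact (α.1 x).map_update_smul _ _ _ _

/-- Multiplication of forms by a smooth function. -/
def mulFun (f : C^∞⟮𝓘(ℝ, E), M; ℝ⟯) : DiffForm E M k →ₗ[ℝ] DiffForm E M k where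
  toFun α := ⟨fun x => f x • α.1 x, fun V => f.contMDiff.mul (α.2 V)⟩
  map_add' _ _ := Subtype.ext (funext fun _ => smul_add _ _ _)
  map_smul' c α := Subtype.ext (funext fun x => smul_comm (f x) c (α.1 x))

/-- The contraction `ι_X α` of a form of positive degree with a vector field. -/
def contract (X : VectorField E M) : DiffForm E M (k + 1) →ₗ[ℝ] DiffForm E M k where
  toFun α := ⟨fun x => (α.1 x).curryLeft (X x), fun V => by
    refine (α.2 (Fin.cons X V)).congr fun x => ?_
    refine congrArg (α.1 x) (funext fun i => ?_)
    refine Fin.cases ?_ (fun i => ?_) i <;> simp⟩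
  map_add' _ _ := rfl
  map_smul' _ _ := rfl

/-- The wedge product of alternating forms on a vector space, normalised so that
`(a ∧ b) (v₁, …, v_{p+q}) = ∑ sgn(σ) a(v_{σ 1}, …, v_{σ p}) b(v_{σ(p+1)}, …, v_{σ(p+q)})`,
the sum running over the `(p, q)`-shuffles `σ`. -/
def wedgeAt {T : Type*} [AddCommGroup T] [Module ℝ T] {p q : ℕ}
    (a : T [⋀^Fin p]→ₗ[ℝ] ℝ) (b : T [⋀^Fin q]→ₗ[ℝ] ℝ) : T [⋀^Fin (p + q)]→ₗ[ℝ] ℝ :=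
  ((LinearMap.mul' ℝ ℝ).compAlternatingMap (a.domCoprod b)).domDomCongr finSumFinEquiv

theorem wedgeAt_apply {T : Type*} [AddCommGroup T] [Module ℝ T] {p q : ℕ}
    (a : T [⋀^Fin p]→ₗ[ℝ] ℝ) (b : T [⋀^Fin q]→ₗ[ℝ] ℝ) (v : Fin (p + q) → T) :
    wedgeAt a b v
      = ∑ σ : Equiv.Perm.ModSumCongr (Fin p) (Fin q), ((Equiv.Perm.sign σ.out : ℤ) : ℝ) *
        (a (fun i => v (finSumFinEquiv (σ.out (Sum.inl i)))) *
          b (fun j => v (finSumFinEquiv (σ.out (Sum.inr j))))) := by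
  simp only [wedgeAt, AlternatingMap.domDomCongr_apply, LinearMap.compAlternatingMap_apply,
    AlternatingMap.domCoprod_apply, sum_apply, map_sum]
  refine Finset.sum_congr rfl fun σ _ => ?_
  conv_lhs => rw [← Quotient.out_eq' σ, AlternatingMap.domCoprod.summand_mk'']
  rw [Units.smul_def, ← Int.cast_smul_eq_zsmul ℝ]
  simp only [smul_apply, map_smul, smul_eq_mul]
  rfl

/-- The wedge product of differential forms. -/
def wedge {p q : ℕ} (α : DiffForm E M p) : DiffForm E M q →ₗ[ℝ] DiffForm E M (p + q) where
  toFun β := ⟨fun x => wedgeAt (α.1 x) (β.1 x), fun V => by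
    simp only [wedgeAt_apply]
    exact contMDiff_finsetSum fun σ _ => contMDiff_const.mul
      (ContMDiff.mul (α.2 fun i => V (finSumFinEquiv (σ.out (Sum.inl i))))
        (β.2 fun j => V (finSumFinEquiv (σ.out (Sum.inr j)))))⟩
  map_add' β γ := by
    refine Subtype.ext (funext fun x => AlternatingMap.ext fun v => ?_)
    change _ = wedgeAt (α.1 x) (β.1 x) v + wedgeAt (α.1 x) (γ.1 x) v
    simp only [wedgeAt_apply, ← Finset.sum_add_distrib, ← mul_add]
    rfl
  map_smul' c β := by
    refine Subtype.ext (funext fun x => AlternatingMap.ext fun v => ?_)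
    change _ = c • wedgeAt (α.1 x) (β.1 x) v
    simp only [wedgeAt_apply, Finset.smul_sum]
    refine Finset.sum_congr rfl fun σ _ => ?_
    rw [smul_eq_mul, mul_left_comm c, mul_left_comm c]
    rfl

theorem alternating_swap_aux {X : VectorField E M} (f : VectorField E M [⋀^Fin k]→ₗ[ℝ]
    C^∞⟮𝓘(ℝ, E), M; ℝ⟯) (V : Fin k → VectorField E M) (i j : Fin k) (hV : V i = V j)
    (hij : i ≠ j) : ∑ l, f (update V l (lieBracketField X (V l))) = 0 := by
  rw [Finset.sum_eq_add_of_mem i j (Finset.mem_univ _) (Finset.mem_univ _) hij]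
  · have h : update V j (lieBracketField X (V j))
        = update V i (lieBracketField X (V i)) ∘ Equiv.swap i j := by
      ext1 l
      rcases eq_or_ne l i with rfl | hi
      · simp [hij, hij.symm, hV]
      · rcases eq_or_ne l j with rfl | hj
        · simp [hV]
        · simp [Equiv.swap_apply_of_ne_of_ne hi hj, hi, hj]
    rw [h, f.map_swap _ hij]
    simp
  · intro l _ hl
    exact f.map_eq_zero_of_eq _ (i := i) (j := j) (by simp [hl.1.symm, hl.2.symm, hV]) hij

theorem lieDerivTensor_aux (X : VectorField E M) (α : DiffForm E M k)
    (V : Fin k → VectorField E M) :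
    ((dirDerivLin X).compMultilinearMap (evalFields α).toMultilinearMap -
      ∑ i, (evalFields α).toMultilinearMap.compLinearMap
        (update (fun _ => LinearMap.id) i (lieBracketLin X))) V
      = dirDeriv X (evalFields α V) -
        ∑ i, evalFields α (update V i (lieBracketField X (V i))) := by
  rw [sub_apply, sum_apply]
  refine congrArg₂ _ rfl (Finset.sum_congr rfl fun i _ => ?_)
  refine congrArg (evalFields α) (funext fun j => ?_)
  rcases eq_or_ne j i with rfl | h
  · simp; rfl
  · simp [h]

theorem evalFields_add (α β : DiffForm E M k) :
    evalFields (α + β) = evalFields α + evalFields β := rfl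

theorem evalFields_smul (c : ℝ) (α : DiffForm E M k) :
    evalFields (c • α) = c • evalFields α := rfl

/-- The values of the Lie derivative of a form on vector fields. -/
def lieDerivTensor (X : VectorField E M) (α : DiffForm E M k) :
    VectorField E M [⋀^Fin k]→ₗ[ℝ] C^∞⟮𝓘(ℝ, E), M; ℝ⟯ where
  toMultilinearMap := (dirDerivLin X).compMultilinearMap (evalFields α).toMultilinearMap -
    ∑ i, (evalFields α).toMultilinearMap.compLinearMap
      (update (fun _ => LinearMap.id) i (lieBracketLin X))
  map_eq_zero_of_eq' V i j hV hij := by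
    have h := alternating_swap_aux (X := X) (evalFields α) V i j hV hij
    have h' := lieDerivTensor_aux X α V
    refine h'.trans ?_
    rw [h, (evalFields α).map_eq_zero_of_eq V hV hij, sub_zero]
    exact map_zero (dirDerivLin X)

theorem lieDerivTensor_apply (X : VectorField E M) (α : DiffForm E M k)
    (V : Fin k → VectorField E M) :
    lieDerivTensor X α V = dirDeriv X (evalFields α V) -
      ∑ i, evalFields α (update V i (lieBracketField X (V i))) :=
  lieDerivTensor_aux X α V

theorem lieDerivTensor_funSMul (X : VectorField E M) (α : DiffForm E M k)
    (f : C^∞⟮𝓘(ℝ, E), M; ℝ⟯) (V : Fin k → VectorField E M) (i : Fin k) :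
    lieDerivTensor X α (update V i (funSMul f (V i))) = f * lieDerivTensor X α V := by
  have hsum : ∑ l, evalFields α (update (update V i (funSMul f (V i))) l
        (lieBracketField X (update V i (funSMul f (V i)) l)))
      = dirDeriv X f * evalFields α V
        + f * ∑ l, evalFields α (update V l (lieBracketField X (V l))) := by
    have hterm : ∀ l, evalFields α (update (update V i (funSMul f (V i))) l
        (lieBracketField X (update V i (funSMul f (V i)) l)))
        = (if l = i then dirDeriv X f * evalFields α V else 0)
          + f * evalFields α (update V l (lieBracketField X (V l))) := by
      intro l
      split_ifs with hl
      · subst hl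
        rw [update_self, update_idem, lieBracketField_funSMul_right, AlternatingMap.map_update_add,
          evalFields_update_funSMul, evalFields_update_funSMul, update_eq_self]
      · rw [update_of_ne hl, update_comm (Ne.symm hl), evalFields_update_funSMul, zero_add,
          update_comm hl]
        congr 3
        rw [update_eq_self_iff]
    rw [Finset.sum_congr rfl fun l _ => hterm l, Finset.sum_add_distrib, Finset.mul_sum]
    simp
  rw [lieDerivTensor_apply, lieDerivTensor_apply, hsum, evalFields_update_funSMul, update_eq_self,
    dirDeriv_mul]
  ring

/-- The Lie derivative of forms,
`(L_X α)(V₁, …, V_k) = X (α(V₁, …, V_k)) - ∑ i, α(V₁, …, [X, V_i], …, V_k)`. -/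
def lieDeriv (X : VectorField E M) : DiffForm E M k →ₗ[ℝ] DiffForm E M k where
  toFun α := ofTensor (lieDerivTensor X α) (lieDerivTensor_funSMul X α)
  map_add' α β := by
    refine DiffForm.ext_fields fun V x => ?_
    rw [evalFields_add, evalFields_ofTensor, evalFields_ofTensor, evalFields_ofTensor]
    refine congrArg (fun f : C^∞⟮𝓘(ℝ, E), M; ℝ⟯ => f x) ?_
    rw [AlternatingMap.add_apply, lieDerivTensor_apply, lieDerivTensor_apply, lieDerivTensor_apply,
      evalFields_add, AlternatingMap.add_apply]
    simp only [AlternatingMap.add_apply, Finset.sum_add_distrib]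
    rw [show dirDeriv X (evalFields α V + evalFields β V) = _ from map_add (dirDerivLin X) _ _]
    exact add_sub_add_comm _ _ _ _
  map_smul' c α := by
    refine DiffForm.ext_fields fun V x => ?_
    rw [RingHom.id_apply, evalFields_smul, evalFields_ofTensor, evalFields_ofTensor]
    refine congrArg (fun f : C^∞⟮𝓘(ℝ, E), M; ℝ⟯ => f x) ?_
    rw [AlternatingMap.smul_apply, lieDerivTensor_apply, lieDerivTensor_apply,
      evalFields_smul, AlternatingMap.smul_apply]
    simp only [AlternatingMap.smul_apply]
    rw [show dirDeriv X (c • evalFields α V) = _ from map_smul (dirDerivLin X) _ _,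
      ← Finset.smul_sum]
    exact (smul_sub _ _ _).symm

theorem funSMul_linear_of_zero (Φ : VectorField E M [⋀^Fin (k + 1)]→ₗ[ℝ] C^∞⟮𝓘(ℝ, E), M; ℝ⟯)
    (h : ∀ (f : C^∞⟮𝓘(ℝ, E), M; ℝ⟯) (X : VectorField E M) (W : Fin k → VectorField E M),
      Φ (Matrix.vecCons (funSMul f X) W) = f * Φ (Matrix.vecCons X W))
    (f : C^∞⟮𝓘(ℝ, E), M; ℝ⟯) (V : Fin (k + 1) → VectorField E M) (i : Fin (k + 1)) :
    Φ (update V i (funSMul f (V i))) = f * Φ V := by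
  have h1 := Φ.map_insertNth i (funSMul f (V i)) (i.removeNth V)
  have h2 := Φ.map_insertNth i (V i) (i.removeNth V)
  rw [Fin.insertNth_removeNth] at h1 h2
  rw [update_eq_self] at h2
  rw [h1, h2, h, mul_smul_comm]

/-- The sum `∑ i, (-1) ^ i V_i (α (V_0, …, V_k without V_i))`. -/
def derivPart (α : DiffForm E M k) :
    VectorField E M [⋀^Fin (k + 1)]→ₗ[ℝ] C^∞⟮𝓘(ℝ, E), M; ℝ⟯ :=
  AlternatingMap.alternatizeUncurryFin
    { toFun := fun X => (dirDerivLin X).compAlternatingMap (evalFields α)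
      map_add' := fun X Y => by ext V x; rw [map_add]; rfl
      map_smul' := fun c X => by ext V x; rw [map_smul]; rfl }

theorem derivPart_apply (α : DiffForm E M k) (V : Fin (k + 1) → VectorField E M) :
    derivPart α V
      = ∑ i : Fin (k + 1), (-1 : ℤ) ^ (i : ℕ) • dirDeriv (V i) (evalFields α (i.removeNth V)) :=
  AlternatingMap.alternatizeUncurryFin_apply _ _

/-- The sum `∑ i < j, (-1) ^ (i + j) α ([V_i, V_j], V_0, …, V_{k+1} without V_i, V_j)`. -/
def bracketPart (α : DiffForm E M (k + 1)) :
    VectorField E M [⋀^Fin (k + 2)]→ₗ[ℝ] C^∞⟮𝓘(ℝ, E), M; ℝ⟯ :=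
  (-1 / 2 : ℝ) • AlternatingMap.alternatizeUncurryFin (AlternatingMap.alternatizeUncurryFinLM ∘ₗ
    lieBracketLin.compr₂ (evalFields α).curryLeft)

theorem bracketPart_apply (α : DiffForm E M (k + 1)) (V : Fin (k + 2) → VectorField E M) :
    bracketPart α V = -∑ i : Fin (k + 1), ∑ j ≥ i, (-1 : ℤ) ^ (i + j : ℕ) •
      evalFields α (Matrix.vecCons (lieBracketField (V i.castSucc) (V j.succ))
        (j.removeNth (i.castSucc.removeNth V))) := by
  rw [bracketPart, AlternatingMap.smul_apply,
    AlternatingMap.alternatizeUncurryFin_alternatizeUncurryFinLM_comp_apply, Finset.smul_sum,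
    ← Finset.sum_neg_distrib]
  refine Finset.sum_congr rfl fun i _ => ?_
  rw [Finset.smul_sum, ← Finset.sum_neg_distrib]
  refine Finset.sum_congr rfl fun j _ => ?_
  have h : ∀ X Y : VectorField E M, lieBracketLin.compr₂ (evalFields α).curryLeft X Y
      (j.removeNth (i.castSucc.removeNth V)) = evalFields α (Matrix.vecCons (lieBracketField X Y)
        (j.removeNth (i.castSucc.removeNth V))) := fun X Y => rfl
  rw [h, h, lieBracketField_swap (V j.succ), ← neg_one_smul ℝ (lieBracketField _ _)]
  rw [show ∀ Z W, evalFields α (Matrix.vecCons ((-1 : ℝ) • Z) W)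
    = (-1 : ℝ) • evalFields α (Matrix.vecCons Z W) from fun Z W =>
      (evalFields α).map_vecCons_smul W (-1) Z]
  rw [smul_comm, ← smul_neg]
  congr 1
  module

theorem removeNth_succ_vecCons (i : Fin (k + 1)) (X : VectorField E M)
    (W : Fin (k + 1) → VectorField E M) :
    i.succ.removeNth (Matrix.vecCons X W : Fin (k + 2) → VectorField E M)
      = Matrix.vecCons X (i.removeNth W) := by
  ext1 j
  refine Fin.cases ?_ (fun j => ?_) j <;> simp [Fin.removeNth_apply]

theorem vecCons_funSMul (α : DiffForm E M (k + 1)) (f : C^∞⟮𝓘(ℝ, E), M; ℝ⟯) (X : VectorField E M)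
    (W : Fin k → VectorField E M) : evalFields α (Matrix.vecCons (funSMul f X) W)
      = f * evalFields α (Matrix.vecCons X W) := by
  have h := evalFields_update_funSMul α f (Fin.cons X W : Fin (k + 1) → VectorField E M) 0 X
  rwa [Fin.update_cons_zero, Fin.update_cons_zero] at h

theorem vecCons_vecCons_funSMul (α : DiffForm E M (k + 2)) (f : C^∞⟮𝓘(ℝ, E), M; ℝ⟯)
    (Y X : VectorField E M) (W : Fin k → VectorField E M) :
    evalFields α (Matrix.vecCons Y (Matrix.vecCons (funSMul f X) W))
      = f * evalFields α (Matrix.vecCons Y (Matrix.vecCons X W)) := by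
  have h := evalFields_update_funSMul α f
    (Fin.cons Y (Fin.cons X W) : Fin (k + 2) → VectorField E M) (Fin.succ 0) X
  rwa [← Fin.cons_update, ← Fin.cons_update, Fin.update_cons_zero, Fin.update_cons_zero] at h

theorem derivPart_vecCons (α : DiffForm E M (k + 1)) (X : VectorField E M)
    (W : Fin (k + 1) → VectorField E M) :
    derivPart α (Matrix.vecCons X W) = dirDeriv X (evalFields α W)
      - ∑ j : Fin (k + 1), (-1 : ℤ) ^ (j : ℕ) •
          dirDeriv (W j) (evalFields α (Matrix.vecCons X (j.removeNth W))) := by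
  rw [derivPart_apply, Fin.sum_univ_succ, sub_eq_add_neg, ← Finset.sum_neg_distrib]
  refine congrArg₂ _ ?_ (Finset.sum_congr rfl fun j _ => ?_)
  · simp
  · rw [removeNth_succ_vecCons, Matrix.cons_val_succ, Fin.val_succ, pow_succ, mul_neg_one, neg_smul]

theorem bracketPart_vecCons_aux (α : DiffForm E M (k + 1)) (X : VectorField E M)
    (W : Fin (k + 1) → VectorField E M) :
    bracketPart α (Matrix.vecCons X W) =
      -(∑ j : Fin (k + 1), (-1 : ℤ) ^ (j : ℕ) •
        evalFields α (Matrix.vecCons (lieBracketField X (W j)) (j.removeNth W)) +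
      ∑ i : Fin k, ∑ j ≥ i.succ, (-1 : ℤ) ^ (i.succ + j : ℕ) •
        evalFields α (Matrix.vecCons (lieBracketField (W i.castSucc) (W j))
        (j.removeNth (i.castSucc.succ.removeNth
          (Matrix.vecCons X W : Fin (k + 2) → VectorField E M))))) := by
  rw [bracketPart_apply, Fin.sum_univ_succ]
  congr 2
  have : Finset.Ici (0 : Fin (k + 1)) = Finset.univ := by ext; simp
  rw [this]
  refine Finset.sum_congr rfl fun j _ => ?_
  simp

theorem bracketPart_funSMul (α : DiffForm E M (k + 1)) (f : C^∞⟮𝓘(ℝ, E), M; ℝ⟯)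
    (X : VectorField E M) (W : Fin (k + 1) → VectorField E M) :
    bracketPart α (Matrix.vecCons (funSMul f X) W) = f * bracketPart α (Matrix.vecCons X W)
      + ∑ j : Fin (k + 1), (-1 : ℤ) ^ (j : ℕ) •
        (dirDeriv (W j) f * evalFields α (Matrix.vecCons X (j.removeNth W))) := by
  rw [bracketPart_vecCons_aux, bracketPart_vecCons_aux]
  have h1 : ∑ j : Fin (k + 1), (-1 : ℤ) ^ (j : ℕ) •
        evalFields α (Matrix.vecCons (lieBracketField (funSMul f X) (W j)) (j.removeNth W))
      = f * (∑ j : Fin (k + 1), (-1 : ℤ) ^ (j : ℕ) •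
        evalFields α (Matrix.vecCons (lieBracketField X (W j)) (j.removeNth W)))
        - ∑ j : Fin (k + 1), (-1 : ℤ) ^ (j : ℕ) •
        (dirDeriv (W j) f * evalFields α (Matrix.vecCons X (j.removeNth W))) := by
    rw [Finset.mul_sum, ← Finset.sum_sub_distrib]
    refine Finset.sum_congr rfl fun j _ => ?_
    rw [lieBracketField_funSMul_left, AlternatingMap.map_vecCons_add, vecCons_funSMul,
      ← neg_one_smul ℝ (funSMul _ _), AlternatingMap.map_vecCons_smul, vecCons_funSMul,
      neg_one_smul, mul_smul_comm, ← smul_sub, neg_add_eq_sub]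
  have h2 : ∀ (i : Fin k), ∀ j ∈ Finset.Ici i.succ, ∀ Z : VectorField E M,
      evalFields α (Matrix.vecCons (lieBracketField (W i.castSucc) (W j))
        (j.removeNth (i.castSucc.succ.removeNth
          (Matrix.vecCons (funSMul f Z) W : Fin (k + 2) → VectorField E M))))
      = f * evalFields α (Matrix.vecCons (lieBracketField (W i.castSucc) (W j))
        (j.removeNth (i.castSucc.succ.removeNth
          (Matrix.vecCons Z W : Fin (k + 2) → VectorField E M)))) := by
    intro i j hj Z
    obtain ⟨m, rfl⟩ : ∃ m, k = m + 1 := ⟨k - 1, by have := i.pos; omega⟩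
    obtain ⟨j, rfl⟩ : ∃ j', j = Fin.succ j' := by
      refine Fin.cases (fun hj => ?_) (fun j _ => ⟨j, rfl⟩) j hj
      simp at hj
    rw [removeNth_succ_vecCons, removeNth_succ_vecCons, removeNth_succ_vecCons,
      removeNth_succ_vecCons, vecCons_vecCons_funSMul]
  have h3 : ∑ i : Fin k, ∑ j ≥ i.succ, (-1 : ℤ) ^ (i.succ + j : ℕ) •
        evalFields α (Matrix.vecCons (lieBracketField (W i.castSucc) (W j))
        (j.removeNth (i.castSucc.succ.removeNth
          (Matrix.vecCons (funSMul f X) W : Fin (k + 2) → VectorField E M))))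
      = f * ∑ i : Fin k, ∑ j ≥ i.succ, (-1 : ℤ) ^ (i.succ + j : ℕ) •
        evalFields α (Matrix.vecCons (lieBracketField (W i.castSucc) (W j))
        (j.removeNth (i.castSucc.succ.removeNth
          (Matrix.vecCons X W : Fin (k + 2) → VectorField E M)))) := by
    rw [Finset.mul_sum]
    refine Finset.sum_congr rfl fun i _ => ?_
    rw [Finset.mul_sum]
    refine Finset.sum_congr rfl fun j hj => ?_
    rw [h2 i j hj X, mul_smul_comm]
  rw [h1, h3]
  ring

theorem derivPart_funSMul (α : DiffForm E M (k + 1)) (f : C^∞⟮𝓘(ℝ, E), M; ℝ⟯)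
    (X : VectorField E M) (W : Fin (k + 1) → VectorField E M) :
    derivPart α (Matrix.vecCons (funSMul f X) W) = f * derivPart α (Matrix.vecCons X W)
      - ∑ j : Fin (k + 1), (-1 : ℤ) ^ (j : ℕ) •
        (dirDeriv (W j) f * evalFields α (Matrix.vecCons X (j.removeNth W))) := by
  rw [derivPart_vecCons, derivPart_vecCons, dirDeriv_funSMul, mul_sub, Finset.mul_sum, sub_sub,
    ← Finset.sum_add_distrib]
  refine congrArg₂ _ rfl (Finset.sum_congr rfl fun j _ => ?_)
  rw [vecCons_funSMul, dirDeriv_mul, smul_add, mul_smul_comm]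

/-- The values of the exterior derivative of a form on vector fields. -/
def extDerivTensor : {k : ℕ} → DiffForm E M k →
    VectorField E M [⋀^Fin (k + 1)]→ₗ[ℝ] C^∞⟮𝓘(ℝ, E), M; ℝ⟯
  | 0, α => derivPart α
  | _ + 1, α => derivPart α + bracketPart α

theorem extDerivTensor_funSMul : {k : ℕ} → (α : DiffForm E M k) →
    (f : C^∞⟮𝓘(ℝ, E), M; ℝ⟯) → (V : Fin (k + 1) → VectorField E M) → (i : Fin (k + 1)) →
    extDerivTensor α (update V i (funSMul f (V i))) = f * extDerivTensor α V
  | 0, α, f, V, i => by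
    refine funSMul_linear_of_zero _ (fun f X W => ?_) f V i
    rw [extDerivTensor, derivPart_apply, derivPart_apply]
    simp only [Fin.sum_univ_succ, Finset.univ_eq_empty, Finset.sum_empty, add_zero]
    simp only [Fin.val_zero, pow_zero, one_smul, Matrix.cons_val_zero, dirDeriv_funSMul]
    rfl
  | k + 1, α, f, V, i => by
    refine funSMul_linear_of_zero _ (fun f X W => ?_) f V i
    rw [extDerivTensor, AlternatingMap.add_apply, AlternatingMap.add_apply, derivPart_funSMul,
      bracketPart_funSMul]
    ring

theorem derivPart_add (α β : DiffForm E M k) (V : Fin (k + 1) → VectorField E M) :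
    derivPart (α + β) V = derivPart α V + derivPart β V := by
  rw [derivPart_apply, derivPart_apply, derivPart_apply, ← Finset.sum_add_distrib]
  refine Finset.sum_congr rfl fun i _ => ?_
  rw [← smul_add, evalFields_add, AlternatingMap.add_apply,
    show ∀ g h, dirDeriv (V i) (g + h) = dirDeriv (V i) g + dirDeriv (V i) h from
      fun g h => map_add (dirDerivLin (V i)) g h]

theorem derivPart_smul (c : ℝ) (α : DiffForm E M k) (V : Fin (k + 1) → VectorField E M) :
    derivPart (c • α) V = c • derivPart α V := by
  rw [derivPart_apply, derivPart_apply, Finset.smul_sum]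
  refine Finset.sum_congr rfl fun i _ => ?_
  rw [smul_comm c, evalFields_smul, AlternatingMap.smul_apply,
    show ∀ g, dirDeriv (V i) (c • g) = c • dirDeriv (V i) g from
      fun g => map_smul (dirDerivLin (V i)) c g]

theorem bracketPart_add (α β : DiffForm E M (k + 1)) (V : Fin (k + 2) → VectorField E M) :
    bracketPart (α + β) V = bracketPart α V + bracketPart β V := by
  simp only [bracketPart_apply, evalFields_add, AlternatingMap.add_apply, smul_add,
    Finset.sum_add_distrib, neg_add]

theorem bracketPart_smul (c : ℝ) (α : DiffForm E M (k + 1)) (V : Fin (k + 2) → VectorField E M) :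
    bracketPart (c • α) V = c • bracketPart α V := by
  simp only [bracketPart_apply, evalFields_smul, AlternatingMap.smul_apply, smul_neg,
    Finset.smul_sum, smul_comm c]

theorem extDerivTensor_add : {k : ℕ} → (α β : DiffForm E M k) →
    (V : Fin (k + 1) → VectorField E M) →
    extDerivTensor (α + β) V = extDerivTensor α V + extDerivTensor β V
  | 0, α, β, V => derivPart_add α β V
  | _ + 1, α, β, V => by
    simp only [extDerivTensor, AlternatingMap.add_apply, derivPart_add, bracketPart_add]
    ring

theorem extDerivTensor_smul : {k : ℕ} → (c : ℝ) → (α : DiffForm E M k) →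
    (V : Fin (k + 1) → VectorField E M) →
    extDerivTensor (c • α) V = c • extDerivTensor α V
  | 0, c, α, V => derivPart_smul c α V
  | _ + 1, c, α, V => by
    simp only [extDerivTensor, AlternatingMap.add_apply, derivPart_smul, bracketPart_smul, smul_add]

/-- The exterior derivative of forms,
`dα (V_0, …, V_k) = ∑ i, (-1) ^ i V_i (α (V_0, …, V_k without V_i))
  + ∑ i < j, (-1) ^ (i + j) α ([V_i, V_j], V_0, …, V_k without V_i, V_j)`. -/
def extDeriv : DiffForm E M k →ₗ[ℝ] DiffForm E M (k + 1) where
  toFun α := ofTensor (extDerivTensor α) (extDerivTensor_funSMul α)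
  map_add' α β := DiffForm.ext_fields fun V x => by
    rw [evalFields_add, evalFields_ofTensor, evalFields_ofTensor, evalFields_ofTensor,
      extDerivTensor_add, AlternatingMap.add_apply]
  map_smul' c α := DiffForm.ext_fields fun V x => by
    rw [RingHom.id_apply, evalFields_smul, evalFields_ofTensor, evalFields_ofTensor,
      extDerivTensor_smul, AlternatingMap.smul_apply]

end Operations
end Forms
section FormAlgebra

variable (E : Type*) [NormedAddCommGroup E] [NormedSpace ℝ E]
  (M : Type*) [TopologicalSpace M] [ChartedSpace E M]

/-- The space `Ω^•(M)` of all smooth differential forms, of mixed degree. -/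
abbrev Forms [IsManifold 𝓘(ℝ, E) ∞ M] : Type _ := DirectSum ℕ fun k => DiffForm E M k

variable [IsManifold 𝓘(ℝ, E) ∞ M]

instance : AddCommGroup (Forms E M) :=
  @DirectSum.instAddCommGroup ℕ (fun k => DiffForm E M k)
    fun k => Submodule.addCommGroup (DiffForm E M k)

variable {E M}

namespace Forms

/-- The linear map on forms of mixed degree given by linear maps `DiffForm E M k → Forms E M`. -/
def ofDegrees (f : ∀ k, DiffForm E M k →ₗ[ℝ] Forms E M) : Module.End ℝ (Forms E M) :=
  DirectSum.toModule ℝ ℕ (Forms E M) f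

/-- The inclusion of `Ω^k(M)` into `Ω^•(M)`. -/
def incl (k : ℕ) : DiffForm E M k →ₗ[ℝ] Forms E M :=
  DirectSum.lof ℝ ℕ (fun k => DiffForm E M k) k

/-- Multiplication by a smooth function. -/
def smulFun (f : C^∞⟮𝓘(ℝ, E), M; ℝ⟯) : Module.End ℝ (Forms E M) :=
  ofDegrees fun k => incl k ∘ₗ mulFun f

/-- Contraction with a vector field; it is zero on functions. -/
def contr (X : VectorField E M) : Module.End ℝ (Forms E M) :=
  ofDegrees fun
    | 0 => 0
    | k + 1 => incl k ∘ₗ contract X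

/-- Left multiplication `ρ ↦ α ∧ ρ` by a `p`-form. -/
def wedgeLeft {p : ℕ} (α : DiffForm E M p) : Module.End ℝ (Forms E M) :=
  ofDegrees fun k => incl (p + k) ∘ₗ wedge α

/-- Left multiplication `ρ ↦ e^{-B} ∧ ρ` for a `2`-form `B`. The `j`-th power of `B` is a
`2j`-form, so that it vanishes for `j > dim M` and the exponential series is a finite sum. -/
def expNeg (B : DiffForm E M 2) : Module.End ℝ (Forms E M) :=
  ∑ j ∈ Finset.range (Module.finrank ℝ E + 1),
    ((-1 : ℝ) ^ j / (j.factorial : ℝ)) • wedgeLeft B ^ j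

variable [FiniteDimensional ℝ E] [T2Space M]

/-- The exterior derivative. -/
def d : Module.End ℝ (Forms E M) :=
  ofDegrees fun k => incl (k + 1) ∘ₗ extDeriv

/-- The Lie derivative. -/
def lie (X : VectorField E M) : Module.End ℝ (Forms E M) :=
  ofDegrees fun k => incl k ∘ₗ lieDeriv X

end Forms

end FormAlgebra

section Courant

variable (E : Type*) [NormedAddCommGroup E] [NormedSpace ℝ E]
  (M : Type*) [TopologicalSpace M] [ChartedSpace E M] [IsManifold 𝓘(ℝ, E) ∞ M]
  (F : Type*) [NormedAddCommGroup F] [NormedSpace ℝ F]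
  (V : M → Type*) [TopologicalSpace (TotalSpace F V)] [∀ x, TopologicalSpace (V x)]
  [FiberBundle F V] [∀ x, AddCommGroup (V x)] [∀ x, Module ℝ (V x)] [VectorBundle ℝ F V]

/-- The structure of a Courant algebroid on the smooth vector bundle `V → M`: a Loday bracket on
the smooth sections, a nondegenerate symmetric pairing on `V` and an anchor map `V → TM`. The
pairing and the anchor are fibrewise linear, and they are smooth in the sense that they take
smooth sections to smooth functions and to smooth vector fields. -/
structure CourantAlgebroid where
  /-- the Loday bracket `X * Y` -/
  bracket : Cₛ^∞⟮𝓘(ℝ, E); F, V⟯ →ₗ[ℝ] Cₛ^∞⟮𝓘(ℝ, E); F, V⟯ →ₗ[ℝ] Cₛ^∞⟮𝓘(ℝ, E); F, V⟯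
  /-- the pairing `⟨v, w⟩` -/
  pairing : ∀ x : M, V x →ₗ[ℝ] V x →ₗ[ℝ] ℝ
  /-- the anchor map -/
  anchor : ∀ x : M, V x →ₗ[ℝ] TangentSpace 𝓘(ℝ, E) x
  contMDiff_pairing : ∀ X Y : Cₛ^∞⟮𝓘(ℝ, E); F, V⟯,
    ContMDiff 𝓘(ℝ, E) 𝓘(ℝ, ℝ) ∞ fun x => pairing x (X x) (Y x)
  contMDiff_anchor : ∀ X : Cₛ^∞⟮𝓘(ℝ, E); F, V⟯,
    ContMDiff 𝓘(ℝ, E) 𝓘(ℝ, E).tangent ∞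
      fun x => (⟨x, anchor x (X x)⟩ : TangentBundle 𝓘(ℝ, E) M)
  pairing_symm : ∀ x v w, pairing x v w = pairing x w v
  pairing_nondegenerate : ∀ x v, (∀ w, pairing x v w = 0) → v = 0
  jacobi : ∀ X Y Z, bracket X (bracket Y Z) = bracket (bracket X Y) Z + bracket Y (bracket X Z)
  anchor_pairing_symm : ∀ (X Y Z : Cₛ^∞⟮𝓘(ℝ, E); F, V⟯) (x : M),
    mvfderiv 𝓘(ℝ, E) (fun y => pairing y (Y y) (Z y)) x (anchor x (X x))
      = pairing x (X x) ((bracket Y Z + bracket Z Y) x)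
  anchor_pairing_leibniz : ∀ (X Y Z : Cₛ^∞⟮𝓘(ℝ, E); F, V⟯) (x : M),
    mvfderiv 𝓘(ℝ, E) (fun y => pairing y (Y y) (Z y)) x (anchor x (X x))
      = pairing x (bracket X Y x) (Z x) + pairing x (Y x) (bracket X Z x)

/-- The structure of an extended tangent bundle (an exact Courant algebroid) on the smooth vector
bundle `V → M`: the sequence `0 → T^*M → V → TM → 0` is exact, where the second map takes a
covector `ξ` at `x` to the element `v` of `V x` such that `2 ⟨v, w⟩ = ξ (a w)` for all `w`. -/
structure ExtendedTangentBundle extends CourantAlgebroid E M F V where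
  anchor_surjective : ∀ x, Surjective (anchor x)
  anchor_eq_zero_iff : ∀ x v, anchor x v = 0 ↔
    ∃ ξ : Module.Dual ℝ (TangentSpace 𝓘(ℝ, E) x), ∀ w, 2 * pairing x v w = ξ (anchor x w)

variable {E M F V}

namespace CourantAlgebroid

variable (C : CourantAlgebroid E M F V)

/-- The function `⟨X, Y⟩`. -/
def pairingFun (X Y : Cₛ^∞⟮𝓘(ℝ, E); F, V⟯) : C^∞⟮𝓘(ℝ, E), M; ℝ⟯ :=
  ⟨fun x => C.pairing x (X x) (Y x), C.contMDiff_pairing X Y⟩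

/-- The vector field `a(X)`. -/
def anchorField (X : Cₛ^∞⟮𝓘(ℝ, E); F, V⟯) : VectorField E M :=
  ⟨fun x => C.anchor x (X x), C.contMDiff_anchor X⟩

/-- Isotropic splittings `s : TM → V` of the anchor map. -/
structure IsotropicSplitting where
  /-- the splitting on the tangent space at `x` -/
  toFun : ∀ x : M, TangentSpace 𝓘(ℝ, E) x →ₗ[ℝ] V x
  contMDiff_toFun : ∀ X : VectorField E M,
    ContMDiff 𝓘(ℝ, E) (𝓘(ℝ, E).prod 𝓘(ℝ, F)) ∞
      fun x => (⟨x, toFun x (X x)⟩ : TotalSpace F V)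
  anchor_toFun : ∀ x v, C.anchor x (toFun x v) = v
  isotropic : ∀ x v w, C.pairing x (toFun x v) (toFun x w) = 0

namespace IsotropicSplitting

variable {C} (s : C.IsotropicSplitting)

/-- The section `s(X)`. -/
def lift (X : VectorField E M) : Cₛ^∞⟮𝓘(ℝ, E); F, V⟯ :=
  ⟨fun x => s.toFun x (X x), s.contMDiff_toFun X⟩

/-- `s' = B ∘ s`, where `(B ∘ s)(X) = s(X) + ι_X B` and the one-form `ι_X B` is regarded as an
element of `V`. -/
def IsShift (s s' : C.IsotropicSplitting) (B : DiffForm E M 2) : Prop :=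
  ∀ (x : M) (v : TangentSpace 𝓘(ℝ, E) x) (w : V x),
    2 * C.pairing x (s'.toFun x v - s.toFun x v) w = B.1 x ![v, C.anchor x w]

/-- The one-form `ξ = X - s(a(X))` of a section `X`; as an element of `V` it satisfies
`ξ(v) = 2 ⟨ξ, s(v)⟩`. -/
def oneForm (X : Cₛ^∞⟮𝓘(ℝ, E); F, V⟯) : DiffForm E M 1 :=
  ⟨fun x => AlternatingMap.ofSubsingleton ℝ (TangentSpace 𝓘(ℝ, E) x) ℝ (0 : Fin 1)
      ((2 : ℝ) • (C.pairing x (X x - s.toFun x (C.anchor x (X x)))).comp (s.toFun x)),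
    fun W => contMDiff_const.mul
      (C.contMDiff_pairing (X - s.lift (C.anchorField X)) (s.lift (W 0)))⟩

theorem pairingFun_lift (X Y : VectorField E M) : C.pairingFun (s.lift X) (s.lift Y) = 0 := by
  ext x
  exact s.isotropic x (X x) (Y x)

theorem lift_add (X Y : VectorField E M) : s.lift (X + Y) = s.lift X + s.lift Y := by
  ext x
  exact map_add (s.toFun x) (X x) (Y x)

theorem lift_smul (c : ℝ) (X : VectorField E M) : s.lift (c • X) = c • s.lift X := by
  ext x
  exact map_smul (s.toFun x) c (X x)

/-- The values `2 ⟨s(X), s(Y) * s(Z)⟩` of the twisting form. -/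
def twisting (X Y Z : VectorField E M) : C^∞⟮𝓘(ℝ, E), M; ℝ⟯ :=
  (2 : ℝ) • C.pairingFun (s.lift X) (C.bracket (s.lift Y) (s.lift Z))

theorem twisting_apply (X Y Z : VectorField E M) (x : M) : s.twisting X Y Z x
    = 2 * C.pairing x (s.lift X x) (C.bracket (s.lift Y) (s.lift Z) x) := rfl

theorem twisting_add_left (X X' Y Z : VectorField E M) :
    s.twisting (X + X') Y Z = s.twisting X Y Z + s.twisting X' Y Z := by
  ext x
  simp [twisting_apply, lift_add, mul_add]

theorem twisting_add_mid (X Y Y' Z : VectorField E M) :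
    s.twisting X (Y + Y') Z = s.twisting X Y Z + s.twisting X Y' Z := by
  ext x
  simp [twisting_apply, lift_add, mul_add]

theorem twisting_add_right (X Y Z Z' : VectorField E M) :
    s.twisting X Y (Z + Z') = s.twisting X Y Z + s.twisting X Y Z' := by
  ext x
  simp [twisting_apply, lift_add, mul_add]

theorem twisting_smul_left (c : ℝ) (X Y Z : VectorField E M) :
    s.twisting (c • X) Y Z = c • s.twisting X Y Z := by
  ext x
  simp [twisting_apply, lift_smul, mul_left_comm]

theorem twisting_smul_mid (c : ℝ) (X Y Z : VectorField E M) :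
    s.twisting X (c • Y) Z = c • s.twisting X Y Z := by
  ext x
  simp [twisting_apply, lift_smul, mul_left_comm]

theorem twisting_smul_right (c : ℝ) (X Y Z : VectorField E M) :
    s.twisting X Y (c • Z) = c • s.twisting X Y Z := by
  ext x
  simp [twisting_apply, lift_smul, mul_left_comm]

theorem twisting_funSMul_left (f : C^∞⟮𝓘(ℝ, E), M; ℝ⟯) (X Y Z : VectorField E M) :
    s.twisting (funSMul f X) Y Z = f * s.twisting X Y Z := by
  ext x
  have h : s.lift (funSMul f X) x = f x • s.lift X x := map_smul (s.toFun x) (f x) (X x)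
  rw [twisting_apply, h, ContMDiffMap.coe_mul, Pi.mul_apply, twisting_apply, map_smul,
    LinearMap.smul_apply, smul_eq_mul, mul_left_comm]

theorem mvfderiv_pairing_lift (Y Z : VectorField E M) (x : M) (v : TangentSpace 𝓘(ℝ, E) x) :
    mvfderiv 𝓘(ℝ, E) (fun y => C.pairing y (s.lift Y y) (s.lift Z y)) x v = 0 := by
  have h : (fun y => C.pairing y (s.lift Y y) (s.lift Z y)) = fun _ => (0 : ℝ) :=
    funext fun y => s.isotropic y (Y y) (Z y)
  rw [h]
  simp [mvfderiv_const]

theorem twisting_self_right (X Y : VectorField E M) : s.twisting X Y Y = 0 := by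
  ext x
  have h := C.anchor_pairing_symm (s.lift X) (s.lift Y) (s.lift Y) x
  rw [mvfderiv_pairing_lift] at h
  simp only [ContMDiffSection.coe_add, Pi.add_apply, map_add] at h
  rw [twisting_apply]
  change 2 * _ = (0 : ℝ)
  linarith

theorem twisting_self_outer (X Y : VectorField E M) : s.twisting X Y X = 0 := by
  ext x
  have h := C.anchor_pairing_leibniz (s.lift Y) (s.lift X) (s.lift X) x
  rw [mvfderiv_pairing_lift, C.pairing_symm x (C.bracket _ _ x)] at h
  rw [twisting_apply]
  change 2 * _ = (0 : ℝ)
  linarith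

theorem twisting_self_left (X Z : VectorField E M) : s.twisting X X Z = 0 := by
  ext x
  have h := C.anchor_pairing_symm (s.lift X) (s.lift X) (s.lift Z) x
  rw [mvfderiv_pairing_lift] at h
  simp only [ContMDiffSection.coe_add, Pi.add_apply, map_add] at h
  have h' := congrArg (fun f : C^∞⟮𝓘(ℝ, E), M; ℝ⟯ => f x) (s.twisting_self_outer X Z)
  change s.twisting X Z X x = 0 at h'
  rw [twisting_apply] at h'
  rw [twisting_apply]
  change 2 * _ = (0 : ℝ)
  linarith

/-- `twisting` as an alternating map. -/
def twistingTensor : VectorField E M [⋀^Fin 3]→ₗ[ℝ] C^∞⟮𝓘(ℝ, E), M; ℝ⟯ where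
  toFun W := s.twisting (W 0) (W 1) (W 2)
  map_update_add' := by
    have h01 : (0 : Fin 3) ≠ 1 := by decide
    have h02 : (0 : Fin 3) ≠ 2 := by decide
    have h12 : (1 : Fin 3) ≠ 2 := by decide
    intro inst W i X Y
    have h : ∀ j k : Fin 3, j ≠ k → ∀ Z, update W j Z k = W k :=
      fun j k hjk Z => update_of_ne hjk.symm Z W
    fin_cases i
    · change s.twisting (update W 0 _ 0) (update W 0 _ 1) (update W 0 _ 2) =
        s.twisting (update W 0 _ 0) (update W 0 _ 1) (update W 0 _ 2) +
        s.twisting (update W 0 _ 0) (update W 0 _ 1) (update W 0 _ 2)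
      simp only [update_self, h 0 1 h01, h 0 2 h02, twisting_add_left]
    · change s.twisting (update W 1 _ 0) (update W 1 _ 1) (update W 1 _ 2) =
        s.twisting (update W 1 _ 0) (update W 1 _ 1) (update W 1 _ 2) +
        s.twisting (update W 1 _ 0) (update W 1 _ 1) (update W 1 _ 2)
      simp only [update_self, h 1 0 h01.symm, h 1 2 h12, twisting_add_mid]
    · change s.twisting (update W 2 _ 0) (update W 2 _ 1) (update W 2 _ 2) =
        s.twisting (update W 2 _ 0) (update W 2 _ 1) (update W 2 _ 2) +
        s.twisting (update W 2 _ 0) (update W 2 _ 1) (update W 2 _ 2)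
      simp only [update_self, h 2 0 h02.symm, h 2 1 h12.symm, twisting_add_right]
  map_update_smul' := by
    have h01 : (0 : Fin 3) ≠ 1 := by decide
    have h02 : (0 : Fin 3) ≠ 2 := by decide
    have h12 : (1 : Fin 3) ≠ 2 := by decide
    intro inst W i c X
    have h : ∀ j k : Fin 3, j ≠ k → ∀ Z, update W j Z k = W k :=
      fun j k hjk Z => update_of_ne hjk.symm Z W
    fin_cases i
    · change s.twisting (update W 0 _ 0) (update W 0 _ 1) (update W 0 _ 2) =
        c • s.twisting (update W 0 _ 0) (update W 0 _ 1) (update W 0 _ 2)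
      simp only [update_self, h 0 1 h01, h 0 2 h02, twisting_smul_left]
    · change s.twisting (update W 1 _ 0) (update W 1 _ 1) (update W 1 _ 2) =
        c • s.twisting (update W 1 _ 0) (update W 1 _ 1) (update W 1 _ 2)
      simp only [update_self, h 1 0 h01.symm, h 1 2 h12, twisting_smul_mid]
    · change s.twisting (update W 2 _ 0) (update W 2 _ 1) (update W 2 _ 2) =
        c • s.twisting (update W 2 _ 0) (update W 2 _ 1) (update W 2 _ 2)
      simp only [update_self, h 2 0 h02.symm, h 2 1 h12.symm, twisting_smul_right]
  map_eq_zero_of_eq' := by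
    intro W i j hW hij
    have h01 : W 0 = W 1 → s.twisting (W 0) (W 1) (W 2) = 0 := fun h => by
      rw [h, twisting_self_left]
    have h02 : W 0 = W 2 → s.twisting (W 0) (W 1) (W 2) = 0 := fun h => by
      rw [h, twisting_self_outer]
    have h12 : W 1 = W 2 → s.twisting (W 0) (W 1) (W 2) = 0 := fun h => by
      rw [h, twisting_self_right]
    fin_cases i <;> fin_cases j
    exacts [absurd rfl hij, h01 hW, h02 hW, h01 hW.symm, absurd rfl hij, h12 hW, h02 hW.symm,
      h12 hW.symm, absurd rfl hij]

variable [FiniteDimensional ℝ E] [T2Space M]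

/-- The twisting form `H(X, Y, Z) = 2 ⟨s(X), s(Y) * s(Z)⟩` of a splitting. -/
def twistingForm : DiffForm E M 3 :=
  ofTensor s.twistingTensor fun f W i => funSMul_linear_of_zero s.twistingTensor
    (fun f X W => s.twisting_funSMul_left f X (W 0) (W 1)) f W i

/-- The operator `d_H ρ = dρ - H ∧ ρ`. -/
def twistedD : Module.End ℝ (Forms E M) :=
  Forms.d - Forms.wedgeLeft s.twistingForm

/-- The operator `ι_X ρ + ξ ∧ ρ` of a section `s(X) + ξ`. -/
def clifford (X : Cₛ^∞⟮𝓘(ℝ, E); F, V⟯) : Module.End ℝ (Forms E M) :=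
  Forms.contr (C.anchorField X) + Forms.wedgeLeft (s.oneForm X)

/-- The operator `L_X ρ + (dξ - ι_X H) ∧ ρ` of a section `s(X) + ξ`. -/
def twistedLie (X : Cₛ^∞⟮𝓘(ℝ, E); F, V⟯) : Module.End ℝ (Forms E M) :=
  Forms.lie (C.anchorField X) + Forms.wedgeLeft
    (extDeriv (s.oneForm X) - contract (C.anchorField X) s.twistingForm)

end IsotropicSplitting

end CourantAlgebroid

namespace ExtendedTangentBundle

variable (T : ExtendedTangentBundle E M F V)

/-- Families of differential forms, one for each isotropic splitting. -/
abbrev FormFamily : Type _ := T.IsotropicSplitting → Forms E M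

/-- The space `I(M) ×_{Ω²(M)} Ω^•(M)` of abstract spinors. It is the set of orbits of pairs
`(s, ρ)` under `(B ∘ s, ρ) ∼ (s, e^{-B} ∧ ρ)`. As the action of `Ω²(M)` on the isotropic
splittings is simply transitive, an orbit is the graph of a map `s ↦ ρ s` that satisfies
`ρ s = e^{-B} ∧ ρ (B ∘ s)`, and it is represented by this map. -/
def spinors : Submodule ℝ T.FormFamily where
  carrier := {ρ | ∀ (s s' : T.IsotropicSplitting) (B : DiffForm E M 2), s.IsShift s' B →
    ρ s = Forms.expNeg B (ρ s')}
  add_mem' h₁ h₂ s s' B hB := by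
    rw [Pi.add_apply, Pi.add_apply, map_add, ← h₁ s s' B hB, ← h₂ s s' B hB]
  zero_mem' s s' B _ := (map_zero (Forms.expNeg B)).symm
  smul_mem' c ρ h s s' B hB := by
    rw [Pi.smul_apply, Pi.smul_apply, map_smul, ← h s s' B hB]

/-- The operator on families of forms that acts by `f s` in the splitting `s`. -/
def splittingwise (f : T.IsotropicSplitting → Module.End ℝ (Forms E M)) :
    Module.End ℝ T.FormFamily :=
  LinearMap.pi fun s => f s ∘ₗ LinearMap.proj s

/-- Multiplication by a smooth function. -/
def mulSpinor (f : C^∞⟮𝓘(ℝ, E), M; ℝ⟯) : Module.End ℝ T.FormFamily :=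
  T.splittingwise fun _ => Forms.smulFun f

variable [FiniteDimensional ℝ E] [T2Space M]

/-- The operator `d_T`. -/
def dT : Module.End ℝ T.FormFamily := T.splittingwise fun s => s.twistedD

/-- The operator `ι_X`. -/
def iotaT (X : Cₛ^∞⟮𝓘(ℝ, E); F, V⟯) : Module.End ℝ T.FormFamily :=
  T.splittingwise fun s => s.clifford X

/-- The operator `L^T_X`. -/
def lieT (X : Cₛ^∞⟮𝓘(ℝ, E); F, V⟯) : Module.End ℝ T.FormFamily :=
  T.splittingwise fun s => s.twistedLie X

end ExtendedTangentBundle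
end Courant

end ExtendedManifold

end

/-! In a fixed isotropic splitting `s` the three operators are operators on Ω^•(M). The theorem
therefore consists of operator identities for a single splitting, together with the claim that
e^{-B}∧ intertwines the operators of B∘s with those of `s`.

The identities rest on the ordinary Cartan calculus. An operator on forms whose values have no
component of degree zero, and which commutes with every contraction up to one fixed scalar,
vanishes: this is `Forms.end_eq_zero`, an induction on the degree. So only the rules that involve
contractions are computed from the explicit formulas: `contr_wedgeLeft` by sums over permutations,
the Cartan formula `lie_eq`, and `lie_contr`. The commutation rules among d, L_X and α∧ follow by
contracting the difference of the two sides and applying induction or an earlier rule.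

On the Courant side, the Leibniz rule and the Jacobi identity make the anchor a bracket homomorphism
(`anchorField_bracket`). For sections s(X)+ξ and s(Y)+η, the one-form part of the bracket is L_Xη -
ι_Y dξ + ι_Y ι_X H (`oneForm_bracket`). Taking the one-form part of the Jacobi identity for three
lifts then gives dH = 0 (`extDeriv_twistingForm`).

Now the twisted relations are graded algebra. L^T_X is the anticommutator of d_T and ι_X because the
anticommutator of H∧ and ξ∧ vanishes. The square of d_T vanishes because dH = 0 and H has odd
degree. The commutator of L^T_X with ι_Y reproduces the formula for the one-form part of the
bracket. The two relations for commutators with L^T_X are formal consequences of these.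

For independence of s, passing from s to s' = B∘s gives ξ = ξ' + ι_X B and H' = H + dB. Conjugation
by e^{-B} changes ι_X into ι_X - (ι_X B)∧, changes d into d - dB∧, and leaves wedge multiplications
alone; the two effects match. The case of L^T_X follows by its Cartan formula. Any two splittings
differ by exactly one two-form, which identifies spinors with forms once a splitting is chosen. -/

noncomputable section

namespace ExtendedManifold

/-! ### Contraction of wedge products of alternating forms -/

section WedgeAt

variable {T : Type*} [AddCommGroup T] [Module ℝ T] {p q : ℕ}

/-- The wedge product as a sum over all permutations. -/
theorem factorial_mul_wedgeAt (a : T [⋀^Fin p]→ₗ[ℝ] ℝ) (b : T [⋀^Fin q]→ₗ[ℝ] ℝ)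
    (v : Fin (p + q) → T) :
    (p.factorial * q.factorial : ℝ) * wedgeAt a b v
      = ∑ σ : Equiv.Perm (Fin (p + q)), ((Equiv.Perm.sign σ : ℤ) : ℝ) *
        (a (fun i => v (σ (Fin.castAdd q i))) * b (fun j => v (σ (Fin.natAdd p j)))) := by
  have h := congrArg (fun f : T [⋀^Fin p ⊕ Fin q]→ₗ[ℝ] _ =>
    (LinearMap.mul' ℝ ℝ) (f fun i => v (finSumFinEquiv i)))
    (MultilinearMap.domCoprod_alternization_eq a b)
  simp only [Fintype.card_fin, MultilinearMap.alternatization_apply, AlternatingMap.smul_apply,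
    map_nsmul, map_sum] at h
  rw [← Equiv.sum_comp (Equiv.permCongr finSumFinEquiv)]
  refine Eq.trans ?_ (h.symm.trans (Finset.sum_congr rfl fun σ _ => ?_))
  · rw [nsmul_eq_mul, Nat.cast_mul]
    rfl
  · rw [Units.smul_def, map_zsmul, zsmul_eq_mul, Equiv.Perm.sign_permCongr]
    congr 1
    simp [MultilinearMap.domDomCongr_apply, MultilinearMap.domCoprod_apply]

/-- Sorts the permutations by the slot `i` in which `x` lands. The sum is first rewritten over
inverses, since `decomposeFin` records the image of 0 whereas the preimage of 0 is needed. The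
transposition of 0 and `i` accounts for the sign. -/
theorem sum_perm_succ {m : ℕ} (x : T) (w : Fin m → T) (G : (Fin (m + 1) → T) → ℝ) :
    ∑ σ : Equiv.Perm (Fin (m + 1)), ((Equiv.Perm.sign σ : ℤ) : ℝ) *
        G (fun k => (Fin.cons x w : Fin (m + 1) → T) (σ k))
      = ∑ i : Fin (m + 1), ∑ e : Equiv.Perm (Fin m), (if i = 0 then 1 else -1 : ℝ) *
        (((Equiv.Perm.sign e : ℤ) : ℝ) *
        G (fun k => (Fin.cons x (fun l => w (e l)) : Fin (m + 1) → T) (Equiv.swap 0 i k))) := by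
  rw [← Equiv.sum_comp (Equiv.inv (Equiv.Perm (Fin (m + 1)))),
    ← Equiv.sum_comp Equiv.Perm.decomposeFin.symm, Fintype.sum_prod_type]
  refine Finset.sum_congr rfl fun i _ => ?_
  rw [← Equiv.sum_comp (Equiv.inv (Equiv.Perm (Fin m)))]
  refine Finset.sum_congr rfl fun e _ => ?_
  simp only [Equiv.inv_apply, Equiv.Perm.sign_inv, Equiv.Perm.decomposeFin.symm_sign]
  have hfun : (fun k => (Fin.cons x w : Fin (m + 1) → T)
        ((Equiv.Perm.decomposeFin.symm (i, e⁻¹))⁻¹ k))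
      = fun k => (Fin.cons x (fun l => w (e l)) : Fin (m + 1) → T) (Equiv.swap 0 i k) := by
    funext k
    obtain ⟨k, rfl⟩ := (Equiv.swap 0 i).surjective k
    rw [Equiv.swap_apply_self]
    obtain ⟨k, rfl⟩ := (Equiv.Perm.decomposeFin.symm ((0 : Fin (m + 1)), e⁻¹)).surjective k
    have h1 : Equiv.swap 0 i (Equiv.Perm.decomposeFin.symm ((0 : Fin (m + 1)), e⁻¹) k)
        = Equiv.Perm.decomposeFin.symm (i, e⁻¹) k := by
      refine Fin.cases ?_ (fun k => ?_) k <;> simp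
    rw [h1, Equiv.Perm.inv_def, Equiv.symm_apply_apply]
    refine Fin.cases ?_ (fun k => ?_) k <;> simp
  rw [hfun, Units.val_mul, Int.cast_mul, mul_assoc]
  split_ifs <;> simp

theorem factorial_mul_wedgeAt_cast {n : ℕ} (h : p + q = n) (a : T [⋀^Fin p]→ₗ[ℝ] ℝ)
    (b : T [⋀^Fin q]→ₗ[ℝ] ℝ) (v : Fin n → T) :
    (p.factorial * q.factorial : ℝ) * wedgeAt a b (fun k => v (Fin.cast h k))
      = ∑ σ : Equiv.Perm (Fin n), ((Equiv.Perm.sign σ : ℤ) : ℝ) *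
        (a (fun i => v (σ (Fin.cast h (Fin.castAdd q i)))) *
          b (fun j => v (σ (Fin.cast h (Fin.natAdd p j))))) := by
  subst h
  exact factorial_mul_wedgeAt a b v

theorem alternating_cons_eq_snoc (a : T [⋀^Fin (p + 1)]→ₗ[ℝ] ℝ) (y : T) (u : Fin p → T) :
    a (Fin.cons y u) = (-1) ^ p * a (Fin.snoc u y) := by
  have h := a.map_insertNth (Fin.last p) y u
  rw [Fin.insertNth_last', Fin.val_last] at h
  have h' : a (Fin.cons y u) = a (Matrix.vecCons y u) := rfl
  rw [h, h', zsmul_eq_mul, ← mul_assoc]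
  push_cast
  rw [← mul_pow]
  simp

/-- Composing `e` with the transposition of the slots 0 and `j` of the second block changes its
sign, and so does exchanging these two arguments of `b`. Hence the slot of `b` that receives `x`
does not matter. -/
theorem sum_perm_right_block {m : ℕ} (h : p + (q + 1) = m) (a : T [⋀^Fin (p + 1)]→ₗ[ℝ] ℝ)
    (b : T [⋀^Fin (q + 1)]→ₗ[ℝ] ℝ) (x : T) (w : Fin m → T) (j : Fin (q + 1)) :
    ∑ e : Equiv.Perm (Fin m), ((Equiv.Perm.sign e : ℤ) : ℝ) *
      (a (Fin.cons (w (e (Fin.cast h (Fin.natAdd p j))))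
          fun i => w (e (Fin.cast h (Fin.castAdd (q + 1) i)))) *
        b (update (fun k => w (e (Fin.cast h (Fin.natAdd p k)))) j x))
    = ∑ e : Equiv.Perm (Fin m), ((Equiv.Perm.sign e : ℤ) : ℝ) *
      (a (Fin.cons (w (e (Fin.cast h (Fin.natAdd p 0))))
          fun i => w (e (Fin.cast h (Fin.castAdd (q + 1) i)))) *
        b (update (fun k => w (e (Fin.cast h (Fin.natAdd p k)))) 0 x)) := by
  subst h
  simp only [Fin.cast_refl, id]
  rcases eq_or_ne j 0 with rfl | hj
  · rfl
  have hne : Fin.natAdd p (0 : Fin (q + 1)) ≠ Fin.natAdd p j := fun h =>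
    hj (Fin.natAdd_injective _ _ h).symm
  rw [← Equiv.sum_comp (Equiv.mulRight (Equiv.swap (Fin.natAdd p 0) (Fin.natAdd p j)))]
  refine Finset.sum_congr rfl fun e _ => ?_
  simp only [Equiv.coe_mulRight, Equiv.Perm.sign_mul, Equiv.Perm.sign_swap hne,
    Equiv.Perm.mul_apply, Equiv.swap_apply_right]
  have h1 : ∀ i : Fin p, Equiv.swap (Fin.natAdd p 0) (Fin.natAdd p j) (Fin.castAdd (q + 1) i)
      = Fin.castAdd (q + 1) i := fun i => Equiv.swap_apply_of_ne_of_ne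
    (by rw [ne_eq, Fin.ext_iff]; have := i.2; simp; omega)
    (by rw [ne_eq, Fin.ext_iff]; have := i.2; simp; omega)
  have h2 : update (fun k => w (e (Equiv.swap (Fin.natAdd p 0) (Fin.natAdd p j)
      (Fin.natAdd p k)))) j x
      = update (fun k => w (e (Fin.natAdd p k))) 0 x ∘ Equiv.swap 0 j := by
    funext k
    rcases eq_or_ne k j with rfl | hkj
    · simp
    · rcases eq_or_ne k 0 with rfl | hk0
      · simp [hj, hj.symm]
      · rw [comp_apply, Equiv.swap_apply_of_ne_of_ne hk0 hkj, update_of_ne hkj, update_of_ne hk0,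
          Equiv.swap_apply_of_ne_of_ne]
        · exact fun h => hk0 (Fin.natAdd_injective _ _ h)
        · exact fun h => hkj (Fin.natAdd_injective _ _ h)
  simp only [h1, h2, b.map_swap _ hj.symm]
  push_cast
  ring

/-- The new vector `x` lands either among the arguments of `a` or among those of `b`. The first kind
assembles to the contraction of `a`; the second kind is left as a correction, to be evaluated when
`b` has positive degree and empty when it has degree zero. -/
theorem factorial_mul_wedgeAt_cons {m : ℕ} (h : p + 1 + q = m + 1) (h' : p + q = m)
    (a : T [⋀^Fin (p + 1)]→ₗ[ℝ] ℝ) (b : T [⋀^Fin q]→ₗ[ℝ] ℝ) (x : T) (w : Fin m → T) :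
    ((p + 1).factorial * q.factorial : ℝ) *
        wedgeAt a b (fun k => (Fin.cons x w : Fin (m + 1) → T) (Fin.cast h k))
      = ((p + 1).factorial * q.factorial : ℝ) *
          wedgeAt (a.curryLeft x) b (fun k => w (Fin.cast h' k))
        - ∑ j : Fin q, ∑ e : Equiv.Perm (Fin m), ((Equiv.Perm.sign e : ℤ) : ℝ) *
          (a (Fin.cons (w (e (Fin.cast h' (Fin.natAdd p j))))
            fun i => w (e (Fin.cast h' (Fin.castAdd q i)))) *
          b (update (fun k => w (e (Fin.cast h' (Fin.natAdd p k)))) j x)) := by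
  subst h'
  have hR : ∀ j : Fin q, Fin.cast h (Fin.natAdd (p + 1) j) = (Fin.natAdd p j).succ := fun j => by
    ext; simp; omega
  have hL : ∀ i : Fin p, Fin.cast h (Fin.castAdd q i.succ) = (Fin.castAdd q i).succ := fun i => by
    ext; simp
  have hL0 : Fin.cast h (Fin.castAdd q (0 : Fin (p + 1))) = 0 := by ext; simp
  rw [factorial_mul_wedgeAt_cast h, sum_perm_succ x w fun u =>
      a (fun i => u (Fin.cast h (Fin.castAdd q i))) *
        b (fun j => u (Fin.cast h (Fin.natAdd (p + 1) j))),
    ← (finCongr h).sum_comp, Fin.sum_univ_add, sub_eq_add_neg, ← Finset.sum_neg_distrib]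
  refine congrArg₂ _ ?_ (Finset.sum_congr rfl fun j _ => ?_)
  -- With `x` in slot `i` of `a`, moving it to slot 0 costs a sign that cancels the one in front.
  -- The p + 1 slots thus contribute equally, which turns p! into (p + 1)!.
  · have hterm : ∀ i : Fin (p + 1), ∑ e : Equiv.Perm (Fin (p + q)),
        (if finCongr h (Fin.castAdd q i) = 0 then 1 else -1 : ℝ) *
        (((Equiv.Perm.sign e : ℤ) : ℝ) *
          (a (fun k => (Fin.cons x (fun l => w (e l)) : Fin (p + q + 1) → T)
            (Equiv.swap 0 (finCongr h (Fin.castAdd q i)) (Fin.cast h (Fin.castAdd q k)))) *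
          b (fun k => (Fin.cons x (fun l => w (e l)) : Fin (p + q + 1) → T)
            (Equiv.swap 0 (finCongr h (Fin.castAdd q i)) (Fin.cast h (Fin.natAdd (p + 1) k))))))
        = (p.factorial * q.factorial : ℝ) * wedgeAt (a.curryLeft x) b w := by
      intro i
      rw [factorial_mul_wedgeAt]
      refine Finset.sum_congr rfl fun e _ => ?_
      rw [mul_left_comm]
      congr 1
      have hb : ∀ k : Fin q, Equiv.swap 0 (finCongr h (Fin.castAdd q i))
          (Fin.cast h (Fin.natAdd (p + 1) k)) = (Fin.natAdd p k).succ := fun k => by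
        rw [Equiv.swap_apply_of_ne_of_ne, hR]
        · rw [hR]; exact Fin.succ_ne_zero _
        · rw [ne_eq, Fin.ext_iff]; have := i.2; simp; omega
      have ha : ∀ k : Fin (p + 1), Equiv.swap 0 (finCongr h (Fin.castAdd q i))
          (Fin.cast h (Fin.castAdd q k)) = Fin.cast h (Fin.castAdd q (Equiv.swap 0 i k)) := by
        have hinj : Injective fun k : Fin (p + 1) => Fin.cast h (Fin.castAdd q k) := fun k l hkl =>
          by simpa [Fin.ext_iff] using hkl
        intro k
        rw [← hL0]
        exact (hinj.map_swap 0 i k).symm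
      have ha' : (fun k => (Fin.cons x (fun l => w (e l)) : Fin (p + q + 1) → T)
          (Fin.cast h (Fin.castAdd q k))) = Fin.cons x fun k => w (e (Fin.castAdd q k)) := by
        funext k
        refine Fin.cases ?_ (fun k => ?_) k
        · rw [hL0, Fin.cons_zero, Fin.cons_zero]
        · rw [hL, Fin.cons_succ, Fin.cons_succ]
      simp only [hb, ha, Fin.cons_succ]
      have hc : (a.curryLeft x) (fun k => w (e (Fin.castAdd q k)))
          = a (Fin.cons x fun k => w (e (Fin.castAdd q k))) := rfl
      rw [hc, ← ha']
      rcases eq_or_ne i 0 with rfl | hi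
      · rw [if_pos (show finCongr h (Fin.castAdd q 0) = 0 from hL0)]
        simp
      · rw [if_neg fun h0 : finCongr h (Fin.castAdd q i) = 0 => hi (Fin.ext (congrArg Fin.val h0 :))]
        have := a.map_swap (fun k => (Fin.cons x (fun l => w (e l)) : Fin (p + q + 1) → T)
          (Fin.cast h (Fin.castAdd q k))) hi.symm
        rw [show (fun k => (Fin.cons x (fun l => w (e l)) : Fin (p + q + 1) → T)
          (Fin.cast h (Fin.castAdd q (Equiv.swap 0 i k)))) = (fun k => (Fin.cons x
          (fun l => w (e l)) : Fin (p + q + 1) → T) (Fin.cast h (Fin.castAdd q k))) ∘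
          Equiv.swap 0 i from rfl, this]
        ring
    rw [Finset.sum_congr rfl fun i _ => hterm i, Finset.sum_const, Finset.card_univ,
      Fintype.card_fin, nsmul_eq_mul, Nat.factorial_succ]
    push_cast
    simp only [Fin.cast_refl, id]
    ring
  -- Here `x` lands in slot `j` of `b`, and the vector it displaces goes to slot 0 of `a`.
  · rw [← Finset.sum_neg_distrib]
    refine Finset.sum_congr rfl fun e _ => ?_
    have hj : finCongr h (Fin.natAdd (p + 1) j) = (Fin.natAdd p j).succ := hR j
    rw [hj, if_neg (Fin.succ_ne_zero _), neg_one_mul]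
    have ha : (fun k => (Fin.cons x (fun l => w (e l)) : Fin (p + q + 1) → T)
        (Equiv.swap 0 (Fin.natAdd p j).succ (Fin.cast h (Fin.castAdd q k))))
        = Fin.cons (w (e (Fin.natAdd p j))) fun k => w (e (Fin.castAdd q k)) := by
      funext k
      refine Fin.cases ?_ (fun k => ?_) k
      · rw [hL0, Equiv.swap_apply_left, Fin.cons_succ, Fin.cons_zero]
      · rw [hL, Equiv.swap_apply_of_ne_of_ne (Fin.succ_ne_zero _), Fin.cons_succ, Fin.cons_succ]
        rw [ne_eq, Fin.ext_iff]; have := k.2; simp; omega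
    have hb : (fun k => (Fin.cons x (fun l => w (e l)) : Fin (p + q + 1) → T)
        (Equiv.swap 0 (Fin.natAdd p j).succ (Fin.cast h (Fin.natAdd (p + 1) k))))
        = update (fun k => w (e (Fin.natAdd p k))) j x := by
      funext k
      rw [hR]
      rcases eq_or_ne k j with rfl | hk
      · simp
      · rw [Equiv.swap_apply_of_ne_of_ne (Fin.succ_ne_zero _), Fin.cons_succ, update_of_ne hk]
        simpa [Fin.ext_iff] using hk
    rw [ha, hb]
    rfl

/-- The contraction of a wedge product with a form of positive degree on both sides. -/
theorem wedgeAt_cons_succ_succ {m : ℕ} (h : p + 1 + (q + 1) = m + 1) (h₁ : p + (q + 1) = m)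
    (h₂ : p + 1 + q = m) (a : T [⋀^Fin (p + 1)]→ₗ[ℝ] ℝ) (b : T [⋀^Fin (q + 1)]→ₗ[ℝ] ℝ) (x : T)
    (w : Fin m → T) :
    wedgeAt a b (fun k => (Fin.cons x w : Fin (m + 1) → T) (Fin.cast h k))
      = wedgeAt (a.curryLeft x) b (fun k => w (Fin.cast h₁ k))
        + (-1) ^ (p + 1) * wedgeAt a (b.curryLeft x) (fun k => w (Fin.cast h₂ k)) := by
  have hfac : ((p + 1).factorial * (q + 1).factorial : ℝ) ≠ 0 := by positivity
  refine mul_left_cancel₀ hfac ?_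
  rw [factorial_mul_wedgeAt_cons h h₁, mul_add, sub_eq_add_neg]
  congr 1
  -- The q + 1 slots of `b` give equal terms; this factor completes q! to (q + 1)!.
  rw [Finset.sum_congr rfl fun j _ => sum_perm_right_block h₁ a b x w j, Finset.sum_const,
    Finset.card_univ, Fintype.card_fin, nsmul_eq_mul]
  have key := factorial_mul_wedgeAt_cast h₂ a (b.curryLeft x) w
  have hsum : ∑ e : Equiv.Perm (Fin m), ((Equiv.Perm.sign e : ℤ) : ℝ) *
      (a (Fin.cons (w (e (Fin.cast h₁ (Fin.natAdd p 0))))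
          fun i => w (e (Fin.cast h₁ (Fin.castAdd (q + 1) i)))) *
        b (update (fun k => w (e (Fin.cast h₁ (Fin.natAdd p k)))) 0 x))
      = (-1) ^ p * (((p + 1).factorial * q.factorial : ℝ) *
        wedgeAt a (b.curryLeft x) (fun k => w (Fin.cast h₂ k))) := by
    rw [key, Finset.mul_sum]
    refine Finset.sum_congr rfl fun e _ => ?_
    -- The displaced vector moves past the other p arguments of `a`, so that the first block is
    -- again read in order. The resulting (-1)^p and the minus sign of the correction term give
    -- (-1)^(p+1).
    rw [alternating_cons_eq_snoc]
    have ha : (Fin.snoc (fun i => w (e (Fin.cast h₁ (Fin.castAdd (q + 1) i))))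
        (w (e (Fin.cast h₁ (Fin.natAdd p 0)))) : Fin (p + 1) → T)
        = fun i => w (e (Fin.cast h₂ (Fin.castAdd q i))) := by
      funext i
      refine Fin.lastCases ?_ (fun i => ?_) i
      · rw [Fin.snoc_last]; rfl
      · rw [Fin.snoc_castSucc]; rfl
    have hb : update (fun k => w (e (Fin.cast h₁ (Fin.natAdd p k)))) 0 x
        = Fin.cons x fun k => w (e (Fin.cast h₂ (Fin.natAdd (p + 1) k))) := by
      funext k
      refine Fin.cases ?_ (fun k => ?_) k
      · simp
      · rw [update_of_ne (Fin.succ_ne_zero _), Fin.cons_succ]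
        congr 2
        ext; simp; omega
    have hc : (b.curryLeft x) (fun k => w (e (Fin.cast h₂ (Fin.natAdd (p + 1) k))))
      = b (Fin.cons x fun k => w (e (Fin.cast h₂ (Fin.natAdd (p + 1) k)))) := rfl
    rw [ha, hb, hc]
    ring
  rw [hsum, Nat.factorial_succ q]
  push_cast
  ring

/-- The contraction of a wedge product with a form of degree zero on the right. -/
theorem wedgeAt_cons_succ_zero {m : ℕ} (h : p + 1 + 0 = m + 1) (h₁ : p + 0 = m)
    (a : T [⋀^Fin (p + 1)]→ₗ[ℝ] ℝ) (b : T [⋀^Fin 0]→ₗ[ℝ] ℝ) (x : T) (w : Fin m → T) :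
    wedgeAt a b (fun k => (Fin.cons x w : Fin (m + 1) → T) (Fin.cast h k))
      = wedgeAt (a.curryLeft x) b (fun k => w (Fin.cast h₁ k)) := by
  have hfac : ((p + 1).factorial * (0).factorial : ℝ) ≠ 0 := by positivity
  refine mul_left_cancel₀ hfac ?_
  rw [factorial_mul_wedgeAt_cons h h₁]
  simp

/-- The wedge product with a form of degree zero on the left. -/
theorem wedgeAt_zero_left {n : ℕ} (h : 0 + q = n) (h' : q = n) (a : T [⋀^Fin 0]→ₗ[ℝ] ℝ)
    (b : T [⋀^Fin q]→ₗ[ℝ] ℝ) (v : Fin n → T) :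
    wedgeAt a b (fun k => v (Fin.cast h k)) = a ![] * b (fun k => v (Fin.cast h' k)) := by
  subst h'
  have hfac : ((0).factorial * q.factorial : ℝ) ≠ 0 := by positivity
  refine mul_left_cancel₀ hfac ?_
  rw [factorial_mul_wedgeAt_cast h]
  have hterm : ∀ σ : Equiv.Perm (Fin q), ((Equiv.Perm.sign σ : ℤ) : ℝ) *
      (a (fun i => v (σ (Fin.cast h (Fin.castAdd q i)))) *
          b (fun j => v (σ (Fin.cast h (Fin.natAdd 0 j))))) = a ![] * b v := by
    intro σ
    have h1 : (fun j => v (σ (Fin.cast h (Fin.natAdd 0 j)))) = v ∘ σ := by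
      funext j; simp
    rw [h1, b.map_perm, Subsingleton.elim (fun i => v (σ (Fin.cast h (Fin.castAdd q i)))) ![],
      Units.smul_def, zsmul_eq_mul, mul_left_comm, ← mul_assoc _ _ (b v)]
    have : ((Equiv.Perm.sign σ : ℤ) : ℝ) * ((Equiv.Perm.sign σ : ℤ) : ℝ) = 1 := by
      rw [← Int.cast_mul, ← Units.val_mul, Int.units_mul_self]; simp
    rw [this, one_mul]
  rw [Finset.sum_congr rfl fun σ _ => hterm σ]
  simp [Fintype.card_perm]

end WedgeAt

/-! ### Vector fields as derivations of the smooth functions -/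

section FieldCalculus

variable {E : Type*} [NormedAddCommGroup E] [NormedSpace ℝ E] [FiniteDimensional ℝ E]
  {M : Type*} [TopologicalSpace M] [T2Space M] [ChartedSpace E M] [IsManifold 𝓘(ℝ, E) ∞ M]

theorem isManifold_one : IsManifold 𝓘(ℝ, E) 1 M :=
  IsManifold.of_le (n := ∞) (WithTop.coe_le_coe.2 (le_top : (1 : ℕ∞) ≤ ⊤))

/-- The Jacobi identity for smooth vector fields. -/
theorem lieBracketField_jacobi (X Y Z : VectorField E M) :
    lieBracketField X (lieBracketField Y Z)
      = lieBracketField (lieBracketField X Y) Z + lieBracketField Y (lieBracketField X Z) := by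
  have : CompleteSpace E := FiniteDimensional.complete ℝ E
  have : IsManifold 𝓘(ℝ, E) (minSmoothness ℝ 3) M :=
    IsManifold.of_le (n := ∞) (by
      rw [minSmoothness_of_isRCLikeNormedField]
      exact WithTop.coe_le_coe.2 (le_top : (3 : ℕ∞) ≤ ⊤))
  have hle : minSmoothness ℝ 2 ≤ ∞ := by
    rw [minSmoothness_of_isRCLikeNormedField]
    exact WithTop.coe_le_coe.2 (le_top : (2 : ℕ∞) ≤ ⊤)
  ext x
  exact VectorField.leibniz_identity_mlieBracket_apply (X.contMDiff.of_le hle x)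
    (Y.contMDiff.of_le hle x) (Z.contMDiff.of_le hle x)

/-- A vector field is determined by its action on smooth functions. -/
theorem eq_of_mvfderiv_eq (x : M) (v w : TangentSpace 𝓘(ℝ, E) x)
    (h : ∀ f : C^∞⟮𝓘(ℝ, E), M; ℝ⟯, mvfderiv 𝓘(ℝ, E) f x v = mvfderiv 𝓘(ℝ, E) f x w) : v = w := by
  have : IsManifold 𝓘(ℝ, E) 1 M := isManifold_one
  have hinv := isInvertible_mfderiv_extChartAt (I := 𝓘(ℝ, E)) (mem_extChartAt_source (I := 𝓘(ℝ, E)) x)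
  refine hinv.injective ?_
  refine (SeparatingDual.eq_iff_forall_dual_eq (R := ℝ) (V := E)).2 fun ℓ => ?_
  obtain ⟨χ, -, hχ⟩ := (SmoothBumpFunction.nhds_basis_tsupport (I := 𝓘(ℝ, E)) x).mem_iff.1
    (extChartAt_source_mem_nhds (I := 𝓘(ℝ, E)) x)
  -- Cut-off linear functionals of the chart suffice as test functions, because the derivative of
  -- the chart at `x` is injective and functionals separate points of `E`.
  let f : C^∞⟮𝓘(ℝ, E), M; ℝ⟯ := ⟨fun y => χ y * ℓ (extChartAt 𝓘(ℝ, E) x y), by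
    refine contMDiff_of_tsupport fun y hy => ?_
    have hy' : y ∈ (extChartAt 𝓘(ℝ, E) x).source :=
      hχ (closure_mono (support_mul_subset_left _ _) hy)
    rw [extChartAt_source] at hy'
    exact χ.contMDiff.contMDiffAt.mul
      (ℓ.contMDiff.contMDiffAt.comp y (contMDiffAt_extChartAt' hy'))⟩
  have hf : (f : M → ℝ) =ᶠ[𝓝 x] fun y => ℓ (extChartAt 𝓘(ℝ, E) x y) := by
    filter_upwards [χ.eventuallyEq_one] with y hy
    change χ y * _ = _
    rw [hy, Pi.one_apply, one_mul]
  have hd : mfderiv 𝓘(ℝ, E) 𝓘(ℝ, ℝ) f x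
      = ℓ.comp (mfderiv 𝓘(ℝ, E) 𝓘(ℝ, E) (extChartAt 𝓘(ℝ, E) x) x) := by
    rw [hf.mfderiv_eq]
    have := mfderiv_comp (I := 𝓘(ℝ, E)) (I' := 𝓘(ℝ, E)) (I'' := 𝓘(ℝ, ℝ)) x
      (g := ℓ) (ℓ.contMDiff.mdifferentiableAt (n := 1) one_ne_zero)
      (mdifferentiableAt_extChartAt (mem_chart_source E x))
    refine this.trans ?_
    rw [ℓ.mfderiv_eq]
    rfl
  have h' : mfderiv 𝓘(ℝ, E) 𝓘(ℝ, ℝ) f x v = mfderiv 𝓘(ℝ, E) 𝓘(ℝ, ℝ) f x w := h f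
  rw [hd] at h'
  exact h'

/-- The chain rule for `f` composed with the inverse chart. It moves iterated derivatives along
vector fields to the model space, where the commutator formula is available. -/
theorem mvfderiv_eq_fderiv_chart (x₀ : M) (f : C^∞⟮𝓘(ℝ, E), M; ℝ⟯) (X : VectorField E M) (y : E)
    (hy : y ∈ (extChartAt 𝓘(ℝ, E) x₀).target) :
    dirDeriv X f ((extChartAt 𝓘(ℝ, E) x₀).symm y)
      = fderiv ℝ (f ∘ (extChartAt 𝓘(ℝ, E) x₀).symm) y
        (VectorField.mpullbackWithin 𝓘(ℝ, E) 𝓘(ℝ, E) (extChartAt 𝓘(ℝ, E) x₀).symm X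
          (range 𝓘(ℝ, E)) y) := by
  have : IsManifold 𝓘(ℝ, E) 1 M := isManifold_one
  have hinv := isInvertible_mfderivWithin_extChartAt_symm (I := 𝓘(ℝ, E)) hy
  rw [VectorField.mpullbackWithin_apply]
  have hs : MDifferentiableWithinAt 𝓘(ℝ, E) 𝓘(ℝ, E) (extChartAt 𝓘(ℝ, E) x₀).symm
      (range 𝓘(ℝ, E)) y :=
    (contMDiffWithinAt_extChartAt_symm_range (n := 1) x₀ hy).mdifferentiableWithinAt one_ne_zero
  have hcomp := mfderiv_comp_mfderivWithin (I := 𝓘(ℝ, E)) (I' := 𝓘(ℝ, E)) (I'' := 𝓘(ℝ, ℝ)) y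
    (mdifferentiableAt_fun f _) hs (by simp [uniqueMDiffWithinAt_univ])
  have hr : range 𝓘(ℝ, E) = univ := by simp
  have hcomp' : fderiv ℝ (f ∘ (extChartAt 𝓘(ℝ, E) x₀).symm) y
      = (mfderiv 𝓘(ℝ, E) 𝓘(ℝ, ℝ) f ((extChartAt 𝓘(ℝ, E) x₀).symm y)).comp
        (mfderivWithin 𝓘(ℝ, E) 𝓘(ℝ, E) (extChartAt 𝓘(ℝ, E) x₀).symm (range 𝓘(ℝ, E)) y) := by
    rw [← hcomp, hr, mfderivWithin_univ, mfderiv_eq_fderiv]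
  rw [hcomp']
  exact congrArg (mfderiv 𝓘(ℝ, E) 𝓘(ℝ, ℝ) f ((extChartAt 𝓘(ℝ, E) x₀).symm y))
    (hinv.self_apply_inverse _).symm

/-- Both sides are read in the chart at the given point. There the bracket is the one of vector
fields on `E`, and the identity is the symmetry of the second derivative. -/
theorem dirDeriv_lieBracketField (X Y : VectorField E M) (f : C^∞⟮𝓘(ℝ, E), M; ℝ⟯) :
    dirDeriv (lieBracketField X Y) f = dirDeriv X (dirDeriv Y f) - dirDeriv Y (dirDeriv X f) := by
  have : CompleteSpace E := FiniteDimensional.complete ℝ E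
  have : IsManifold 𝓘(ℝ, E) 1 M := isManifold_one
  ext x₀
  set φ := extChartAt 𝓘(ℝ, E) x₀ with hφ
  have hx : φ x₀ ∈ φ.target := mem_extChartAt_target x₀
  have hback : φ.symm (φ x₀) = x₀ := extChartAt_to_inv x₀
  have hr : range 𝓘(ℝ, E) = univ := by simp
  let X' : E → E := VectorField.mpullbackWithin 𝓘(ℝ, E) 𝓘(ℝ, E) φ.symm X (range 𝓘(ℝ, E))
  let Y' : E → E := VectorField.mpullbackWithin 𝓘(ℝ, E) 𝓘(ℝ, E) φ.symm Y (range 𝓘(ℝ, E))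
  have hd : ∀ Z : VectorField E M, DifferentiableAt ℝ
      (VectorField.mpullbackWithin 𝓘(ℝ, E) 𝓘(ℝ, E) φ.symm Z (range 𝓘(ℝ, E)) : E → E) (φ x₀) := by
    intro Z
    have h := (mdifferentiableAt_field Z x₀).mdifferentiableWithinAt
      (s := univ) |>.differentiableWithinAt_mpullbackWithin_vectorField
    have hset : (extChartAt 𝓘(ℝ, E) x₀).symm ⁻¹' univ ∩ range 𝓘(ℝ, E) = univ := by simp
    rw [hset] at h
    exact h.differentiableAt Filter.univ_mem
  have hderiv : ∀ (Z : VectorField E M) (g : C^∞⟮𝓘(ℝ, E), M; ℝ⟯),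
      (dirDeriv Z g ∘ φ.symm) =ᶠ[𝓝 (φ x₀)] fun y => fderiv ℝ (g ∘ φ.symm) y
        (VectorField.mpullbackWithin 𝓘(ℝ, E) 𝓘(ℝ, E) φ.symm Z (range 𝓘(ℝ, E)) y) := by
    intro Z g
    filter_upwards [extChartAt_target_mem_nhds (I := 𝓘(ℝ, E)) x₀] with y hy
    exact mvfderiv_eq_fderiv_chart x₀ g Z y hy
  have h2 : ∀ Z W : VectorField E M, dirDeriv Z (dirDeriv W f) x₀
      = fderiv ℝ (fun y => fderiv ℝ (f ∘ φ.symm) y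
        (VectorField.mpullbackWithin 𝓘(ℝ, E) 𝓘(ℝ, E) φ.symm W (range 𝓘(ℝ, E)) y)) (φ x₀)
        (VectorField.mpullbackWithin 𝓘(ℝ, E) 𝓘(ℝ, E) φ.symm Z (range 𝓘(ℝ, E)) (φ x₀)) := by
    intro Z W
    have h := mvfderiv_eq_fderiv_chart x₀ (dirDeriv W f) Z (φ x₀) hx
    rw [← hφ, hback] at h
    rw [h, (hderiv W f).fderiv_eq]
  have hcd : ContDiffAt ℝ ∞ (f ∘ φ.symm) (φ x₀) := by
    have h : ContMDiffAt 𝓘(ℝ, E) 𝓘(ℝ, ℝ) ∞ (f ∘ φ.symm) (φ x₀) := by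
      have h1 := contMDiffWithinAt_extChartAt_symm_range (n := ∞) (I := 𝓘(ℝ, E)) x₀ hx
      rw [hr, contMDiffWithinAt_univ] at h1
      exact (f.contMDiff _).comp _ h1
    exact h.contDiffAt
  have hmain := VectorField.fderiv_apply_lieBracket (𝕜 := ℝ) (V := X') (W := Y') hcd (by
    rw [minSmoothness_of_isRCLikeNormedField]
    exact WithTop.coe_le_coe.2 (le_top : (2 : ℕ∞) ≤ ⊤)) (hd Y) (hd X)
  let L : E := VectorField.lieBracket ℝ X' Y' (φ x₀)
  have hbr : (lieBracketField X Y x₀ : E) = L := by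
    have hset : (extChartAt 𝓘(ℝ, E) x₀).symm ⁻¹' univ ∩ range 𝓘(ℝ, E) = univ := by simp
    have hu := congrFun (VectorField.lieBracketWithin_univ (𝕜 := ℝ) (V := X') (W := Y')) (φ x₀)
    have h1 : (lieBracketField X Y x₀ : E) = (mfderiv 𝓘(ℝ, E) 𝓘(ℝ, E) φ x₀).inverse
        (VectorField.lieBracketWithin ℝ X' Y' univ (φ x₀) : E) := by
      rw [← hset]
      exact VectorField.mlieBracketWithin_apply
    -- The tangent space at `x₀` is identified with `E` by the chart at `x₀` itself, so the
    -- derivative of that chart at its centre is the identity.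
    have hid : (mfderiv 𝓘(ℝ, E) 𝓘(ℝ, E) φ x₀).inverse = ContinuousLinearMap.id ℝ E := by
      rw [hφ, mfderiv_extChartAt_self]
      exact ContinuousLinearMap.inverse_id
    rw [h1, hid, hu]
    rfl
  have hL : VectorField.mpullbackWithin 𝓘(ℝ, E) 𝓘(ℝ, E) φ.symm (lieBracketField X Y)
      (range 𝓘(ℝ, E)) (φ x₀) = L := by
    rw [← hbr, VectorField.mpullbackWithin_apply]
    have h1 : (lieBracketField X Y (φ.symm (φ x₀)) : E) = (lieBracketField X Y x₀ : E) :=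
      congrArg (fun y => (lieBracketField X Y y : E)) hback
    refine (congrArg (mfderivWithin 𝓘(ℝ, E) 𝓘(ℝ, E) φ.symm (range 𝓘(ℝ, E)) (φ x₀)).inverse h1).trans ?_
    exact mfderivWithin_extChartAt_symm_inverse_apply (I := 𝓘(ℝ, E)) (lieBracketField X Y x₀)
  have h1 := mvfderiv_eq_fderiv_chart x₀ f (lieBracketField X Y) (φ x₀) hx
  rw [← hφ, hback, hL] at h1
  rw [h1]
  refine hmain.trans ?_
  rw [ContMDiffMap.coe_sub, Pi.sub_apply, h2, h2]

end FieldCalculus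

/-! ### Cartan calculus in a fixed degree -/

section DegreewiseCalculus

variable {E : Type*} [NormedAddCommGroup E] [NormedSpace ℝ E]
  {M : Type*} [TopologicalSpace M] [ChartedSpace E M] [IsManifold 𝓘(ℝ, E) ∞ M] {k : ℕ}

theorem evalFields_contract (X : VectorField E M) (α : DiffForm E M (k + 1))
    (W : Fin k → VectorField E M) :
    evalFields (contract X α) W = evalFields α (Matrix.vecCons X W) := by
  ext x
  refine congrArg (α.1 x) (funext fun i => ?_)
  refine Fin.cases ?_ (fun i => ?_) i <;> simp

theorem contract_contract (X Y : VectorField E M) (α : DiffForm E M (k + 2)) :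
    contract X (contract Y α) = -contract Y (contract X α) := by
  refine Subtype.ext (funext fun x => AlternatingMap.ext fun v => ?_)
  have h := (α.1 x).map_swap (Fin.cons (Y x) (Fin.cons (X x) v))
    (show (0 : Fin (k + 2)) ≠ 1 from Fin.zero_ne_one)
  have hf : (Fin.cons (Y x) (Fin.cons (X x) v) : Fin (k + 2) → TangentSpace 𝓘(ℝ, E) x)
      ∘ Equiv.swap 0 1 = Fin.cons (X x) (Fin.cons (Y x) v) := by
    funext i
    refine Fin.cases ?_ (fun i => Fin.cases ?_ (fun i => ?_) i) i
    · simp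
    · change (Fin.cons (Y x) (Fin.cons (X x) v) : Fin (k + 2) → TangentSpace 𝓘(ℝ, E) x)
        (Equiv.swap 0 1 1) = _
      rw [Equiv.swap_apply_right]
      rfl
    · have hi : Equiv.swap (0 : Fin (k + 2)) 1 i.succ.succ = i.succ.succ :=
        Equiv.swap_apply_of_ne_of_ne (by simp [Fin.ext_iff]) (by simp [Fin.ext_iff])
      rw [comp_apply, hi]
      rfl
  rw [hf] at h
  refine Eq.trans ?_ ((neg_eq_iff_eq_neg.2 h).symm.trans ?_)
  · rfl
  · rfl

theorem contract_add_left (X Y : VectorField E M) (α : DiffForm E M (k + 1)) :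
    contract (X + Y) α = contract X α + contract Y α := by
  refine Subtype.ext (funext fun x => ?_)
  exact map_add (α.1 x).curryLeft (X x) (Y x)

variable [FiniteDimensional ℝ E] [T2Space M]

theorem DiffForm.ext_evalFields {α β : DiffForm E M k} (h : evalFields α = evalFields β) :
    α = β :=
  DiffForm.ext_fields fun V x => by rw [h]

theorem evalFields_lieDeriv (X : VectorField E M) (α : DiffForm E M k)
    (W : Fin k → VectorField E M) :
    evalFields (lieDeriv X α) W = dirDeriv X (evalFields α W) -
      ∑ i, evalFields α (update W i (lieBracketField X (W i))) := by
  have h : evalFields (lieDeriv X α) = lieDerivTensor X α :=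
    evalFields_ofTensor (lieDerivTensor X α) (lieDerivTensor_funSMul X α)
  rw [h, lieDerivTensor_apply]

theorem evalFields_extDeriv (α : DiffForm E M k) :
    evalFields (extDeriv α) = extDerivTensor α :=
  evalFields_ofTensor (extDerivTensor α) (extDerivTensor_funSMul α)

theorem evalFields_update (α : DiffForm E M (k + 1)) (W : Fin (k + 1) → VectorField E M)
    (j : Fin (k + 1)) (Z : VectorField E M) :
    evalFields α (update W j Z)
      = (-1 : ℤ) ^ (j : ℕ) • evalFields α (Matrix.vecCons Z (j.removeNth W)) := by
  have h := (evalFields α).map_insertNth j Z (j.removeNth W)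
  rwa [Fin.insertNth_removeNth] at h

/-- In the formula for `lieDeriv X α` evaluated on Y and W, the bracket term of the first argument
is the contraction with [X, Y]; all other terms belong to `lieDeriv X (contract Y α)`. -/
theorem lieDeriv_contract (X Y : VectorField E M) (α : DiffForm E M (k + 1)) :
    lieDeriv X (contract Y α) = contract Y (lieDeriv X α) + contract (lieBracketField X Y) α := by
  refine DiffForm.ext_evalFields (AlternatingMap.ext fun W => ?_)
  rw [evalFields_add, AlternatingMap.add_apply, evalFields_lieDeriv, evalFields_contract,
    evalFields_contract, evalFields_contract, evalFields_lieDeriv, Fin.sum_univ_succ]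
  have h0 : update (Matrix.vecCons Y W : Fin (k + 1) → VectorField E M) 0
      (lieBracketField X ((Matrix.vecCons Y W : Fin (k + 1) → VectorField E M) 0))
      = Matrix.vecCons (lieBracketField X Y) W := Fin.update_cons_zero _ _ _
  have hs : ∀ i : Fin k, update (Matrix.vecCons Y W : Fin (k + 1) → VectorField E M) i.succ
      (lieBracketField X ((Matrix.vecCons Y W : Fin (k + 1) → VectorField E M) i.succ))
      = Matrix.vecCons Y (update W i (lieBracketField X (W i))) := fun i =>
    (Fin.cons_update _ _ _ _).symm
  simp only [h0, hs, evalFields_contract]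
  abel

theorem contract_extDeriv_zero (X : VectorField E M) (α : DiffForm E M 0) :
    contract X (extDeriv α) = lieDeriv X α := by
  refine DiffForm.ext_evalFields (AlternatingMap.ext fun W => ?_)
  rw [evalFields_contract, evalFields_extDeriv, evalFields_lieDeriv, extDerivTensor,
    derivPart_apply]
  simp

/-- Pairs of arguments that contain `X` form the first sum. In the remaining pairs both indices are
shifted by one, which leaves the sign unchanged, and moving `X` in front of the bracket gives the
minus sign. -/
theorem bracketPart_vecCons (X : VectorField E M) (α : DiffForm E M (k + 2))
    (W : Fin (k + 2) → VectorField E M) :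
    bracketPart α (Matrix.vecCons X W) =
      -(∑ j : Fin (k + 2), (-1 : ℤ) ^ (j : ℕ) •
        evalFields α (Matrix.vecCons (lieBracketField X (W j)) (j.removeNth W)))
      - bracketPart (contract X α) W := by
  rw [bracketPart_vecCons_aux, neg_add, sub_eq_add_neg, bracketPart_apply, neg_neg,
    ← Finset.sum_neg_distrib (f := fun i : Fin (k + 1) => _)]
  congr 1
  refine Finset.sum_congr rfl fun i _ => ?_
  rw [← Finset.sum_neg_distrib]
  -- The second index is at least `i.succ`, hence itself a successor: neither bracketed vector is
  -- `X`.
  have hI : Finset.Ici i.succ = (Finset.Ici i).map (Fin.succEmb (k + 1)) :=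
    (Fin.map_succEmb_Ici i).symm
  rw [hI, Finset.sum_map]
  refine Finset.sum_congr rfl fun j _ => ?_
  have h1 : (Fin.succEmb (k + 1) j).removeNth (i.castSucc.succ.removeNth
      (Matrix.vecCons X W : Fin (k + 3) → VectorField E M))
      = (Matrix.vecCons X (j.removeNth (i.castSucc.removeNth W)) :
        Fin (k + 1) → VectorField E M) := by
    rw [removeNth_succ_vecCons]
    exact removeNth_succ_vecCons j X _
  rw [h1, evalFields_contract]
  have hswap : ∀ (Y Z : VectorField E M) (U : Fin k → VectorField E M),
      evalFields α (Matrix.vecCons Y (Matrix.vecCons Z U))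
        = -evalFields α (Matrix.vecCons Z (Matrix.vecCons Y U)) := by
    intro Y Z U
    rw [← evalFields_contract, ← evalFields_contract, ← evalFields_contract,
      ← evalFields_contract, contract_contract]
    rfl
  rw [hswap, Fin.coe_succEmb, Fin.val_succ, Fin.val_succ, smul_neg, neg_neg]
  congr 1
  ring

theorem derivPart_contract (X : VectorField E M) (α : DiffForm E M (k + 1))
    (W : Fin (k + 1) → VectorField E M) :
    derivPart α (Matrix.vecCons X W)
      = dirDeriv X (evalFields α W) - derivPart (contract X α) W := by
  rw [derivPart_vecCons, derivPart_apply]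
  simp only [evalFields_contract]

/-- The Cartan formula for the Lie derivative of forms of positive degree. -/
theorem contract_extDeriv_succ : {k : ℕ} → (X : VectorField E M) → (α : DiffForm E M (k + 1)) →
    contract X (extDeriv α) = lieDeriv X α - extDeriv (contract X α)
  | k, X, α => by
    refine DiffForm.ext_evalFields (AlternatingMap.ext fun W => ?_)
    have hsub : evalFields (lieDeriv X α - extDeriv (contract X α)) W
        = evalFields (lieDeriv X α) W - evalFields (extDeriv (contract X α)) W := rfl
    rw [hsub, evalFields_contract, evalFields_extDeriv, evalFields_extDeriv, evalFields_lieDeriv]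
    simp only [evalFields_update]
    -- For a one-form the contraction is a function, whose exterior derivative has no bracket part.
    match k, α, W with
    | 0, α, W =>
      rw [extDerivTensor, extDerivTensor, AlternatingMap.add_apply, derivPart_contract,
        bracketPart_vecCons_aux]
      simp
      abel
    | k + 1, α, W =>
      rw [extDerivTensor, extDerivTensor, AlternatingMap.add_apply, AlternatingMap.add_apply,
        derivPart_contract, bracketPart_vecCons]
      abel

end DegreewiseCalculus

/-! ### Operators on forms of mixed degree -/

namespace Forms

section Basic

variable {E : Type*} [NormedAddCommGroup E] [NormedSpace ℝ E]
  {M : Type*} [TopologicalSpace M] [ChartedSpace E M] [IsManifold 𝓘(ℝ, E) ∞ M] {p k : ℕ}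

theorem ofDegrees_incl (f : ∀ k, DiffForm E M k →ₗ[ℝ] Forms E M) (α : DiffForm E M k) :
    ofDegrees f (incl k α) = f k α := by
  unfold ofDegrees incl
  exact DirectSum.toModule_lof (M := fun k => DiffForm E M k) (R := ℝ) (φ := f) k α

theorem linearMap_ext {N : Type*} [AddCommMonoid N] [Module ℝ N] {D D' : Forms E M →ₗ[ℝ] N}
    (h : ∀ k (α : DiffForm E M k), D (incl k α) = D' (incl k α)) : D = D' :=
  DirectSum.linearMap_ext ℝ fun k => LinearMap.ext fun α => h k α

/-- The component of degree `k` of a form of mixed degree. -/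
def comp (k : ℕ) : Forms E M →ₗ[ℝ] DiffForm E M k :=
  DirectSum.component ℝ ℕ (fun k => DiffForm E M k) k

theorem comp_incl_self (α : DiffForm E M k) : comp k (incl k α) = α := by
  unfold comp incl
  exact DirectSum.component.lof_self (M := fun k => DiffForm E M k) ℝ k α

theorem comp_incl_of_ne {l : ℕ} (h : k ≠ l) (α : DiffForm E M k) : comp l (incl k α) = 0 := by
  unfold comp incl
  exact (DirectSum.component.of (M := fun k => DiffForm E M k) ℝ l k α).trans (dif_neg h)

theorem ext_comp {ρ ρ' : Forms E M} (h : ∀ k, comp k ρ = comp k ρ') : ρ = ρ' :=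
  DirectSum.ext_component (M := fun k => DiffForm E M k) ℝ h

/-- Degrees such as p + (k + 1) and p + 1 + k differ as expressions, so the forms have different
types. Comparison inside the direct sum avoids transporting them. -/
theorem incl_congr {m n : ℕ} (h : n = m) (α : DiffForm E M n) (β : DiffForm E M m)
    (hαβ : ∀ x v, α.1 x (fun i => v (Fin.cast h i)) = β.1 x v) : incl n α = incl m β := by
  subst h
  exact congrArg _ (Subtype.ext (funext fun x => AlternatingMap.ext fun v => hαβ x v))

theorem contr_incl_zero (X : VectorField E M) (α : DiffForm E M 0) :
    contr X (incl 0 α) = 0 := by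
  rw [contr, ofDegrees_incl]; rfl

theorem contr_incl_succ (X : VectorField E M) (α : DiffForm E M (k + 1)) :
    contr X (incl (k + 1) α) = incl k (contract X α) := by
  rw [contr, ofDegrees_incl]; rfl

theorem wedgeLeft_incl (α : DiffForm E M p) (β : DiffForm E M k) :
    wedgeLeft α (incl k β) = incl (p + k) (wedge α β) := by
  rw [wedgeLeft, ofDegrees_incl]; rfl

theorem smulFun_incl (f : C^∞⟮𝓘(ℝ, E), M; ℝ⟯) (α : DiffForm E M k) :
    smulFun f (incl k α) = incl k (mulFun f α) := by
  rw [smulFun, ofDegrees_incl]; rfl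

theorem comp_contr (X : VectorField E M) (ρ : Forms E M) (k : ℕ) :
    comp k (contr X ρ) = contract X (comp (k + 1) ρ) := by
  have h : comp k ∘ₗ contr X = contract X ∘ₗ comp (k + 1) := by
    refine linearMap_ext fun l α => ?_
    simp only [LinearMap.comp_apply]
    match l, α with
    | 0, α => rw [contr_incl_zero, comp_incl_of_ne (Nat.succ_ne_zero k).symm, map_zero, map_zero]
    | l + 1, α =>
      rw [contr_incl_succ]
      rcases eq_or_ne l k with rfl | hl
      · rw [comp_incl_self, comp_incl_self]
      · rw [comp_incl_of_ne hl, comp_incl_of_ne fun h => hl (Nat.succ_injective h), map_zero]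
  exact LinearMap.congr_fun h ρ

theorem comp_smulFun (f : C^∞⟮𝓘(ℝ, E), M; ℝ⟯) (ρ : Forms E M) (k : ℕ) :
    comp k (smulFun f ρ) = mulFun f (comp k ρ) := by
  have h : comp k ∘ₗ smulFun f = mulFun f ∘ₗ comp k := by
    refine linearMap_ext fun l α => ?_
    simp only [LinearMap.comp_apply, smulFun_incl]
    rcases eq_or_ne l k with rfl | hl
    · rw [comp_incl_self, comp_incl_self]
    · rw [comp_incl_of_ne hl, comp_incl_of_ne hl, map_zero]
  exact LinearMap.congr_fun h ρ

theorem comp_zero_wedgeLeft (α : DiffForm E M (p + 1)) (ρ : Forms E M) :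
    comp 0 (wedgeLeft α ρ) = 0 := by
  have h : comp 0 ∘ₗ wedgeLeft α = 0 := by
    refine linearMap_ext fun l β => ?_
    simp only [LinearMap.comp_apply, wedgeLeft_incl]
    rw [comp_incl_of_ne (by omega)]
    rfl
  exact LinearMap.congr_fun h ρ

/-- The smooth function that a form of degree zero is. -/
def toFunction (α : DiffForm E M 0) : C^∞⟮𝓘(ℝ, E), M; ℝ⟯ := evalFields α ![]

theorem wedgeLeft_zero_degree (α : DiffForm E M 0) : wedgeLeft α = smulFun (toFunction α) := by
  refine linearMap_ext fun k β => ?_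
  rw [wedgeLeft_incl, smulFun_incl]
  refine incl_congr (Nat.zero_add k) _ _ fun x v => ?_
  refine (wedgeAt_zero_left (Nat.zero_add k) rfl (α.1 x) (β.1 x) v).trans ?_
  refine congrArg₂ _ ?_ rfl
  exact congrArg (α.1 x) (Subsingleton.elim _ _)

theorem contr_contr (X Y : VectorField E M) : contr X * contr Y = -(contr Y * contr X) := by
  refine linearMap_ext fun k α => ?_
  rw [LinearMap.neg_apply, Module.End.mul_apply, Module.End.mul_apply]
  match k, α with
  | 0, α => simp only [contr_incl_zero, map_zero, neg_zero]
  | 1, α => simp only [contr_incl_zero, contr_incl_succ, neg_zero]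
  | k + 2, α =>
    rw [contr_incl_succ, contr_incl_succ, contr_incl_succ, contr_incl_succ,
      contract_contract X Y]
    exact map_neg (incl (E := E) (M := M) k) _

theorem contr_add_left (X Y : VectorField E M) : contr (X + Y) = contr X + contr Y := by
  refine linearMap_ext fun k α => ?_
  rw [LinearMap.add_apply]
  match k, α with
  | 0, α => simp only [contr_incl_zero, add_zero]
  | k + 1, α => simp only [contr_incl_succ, contract_add_left, map_add]

theorem wedgeLeft_add (α α' : DiffForm E M p) :
    wedgeLeft (α + α') = wedgeLeft α + wedgeLeft α' := by
  refine linearMap_ext fun k β => ?_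
  rw [LinearMap.add_apply, wedgeLeft_incl, wedgeLeft_incl, wedgeLeft_incl, ← map_add]
  refine incl_congr rfl _ _ fun x v => ?_
  change wedgeAt (α.1 x + α'.1 x) (β.1 x) v
    = wedgeAt (α.1 x) (β.1 x) v + wedgeAt (α'.1 x) (β.1 x) v
  simp only [wedgeAt_apply, ← Finset.sum_add_distrib, ← mul_add, AlternatingMap.add_apply, add_mul]

theorem wedgeLeft_sub (α α' : DiffForm E M p) :
    wedgeLeft (α - α') = wedgeLeft α - wedgeLeft α' := by
  have h := wedgeLeft_add (α - α') α'
  rw [show α - α' + α' = α from sub_add_cancel α α'] at h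
  exact eq_sub_of_add_eq h.symm

theorem wedgeLeft_zero : wedgeLeft (0 : DiffForm E M p) = 0 :=
  (congrArg wedgeLeft (sub_self (0 : DiffForm E M p)).symm).trans
    ((wedgeLeft_sub 0 0).trans (sub_self _))

/-- Left multiplication by the contraction of a form, zero for a form of degree zero. -/
def contrWedge (X : VectorField E M) : {p : ℕ} → DiffForm E M p → Module.End ℝ (Forms E M)
  | 0, _ => 0
  | _ + 1, α => wedgeLeft (contract X α)

/-- Contraction with a vector field is an antiderivation. -/
theorem contr_wedgeLeft (X : VectorField E M) : {p : ℕ} → (α : DiffForm E M p) →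
    contr X * wedgeLeft α = contrWedge X α + (-1 : ℝ) ^ p • (wedgeLeft α * contr X)
  | 0, α => by
    rw [wedgeLeft_zero_degree, contrWedge, zero_add, pow_zero, one_smul]
    refine LinearMap.ext fun ρ => ext_comp fun k => ?_
    simp only [Module.End.mul_apply, comp_contr, comp_smulFun]
    exact Subtype.ext (funext fun x => AlternatingMap.ext fun v => rfl)
  | p + 1, α => by
    refine linearMap_ext fun k β => ?_
    rw [LinearMap.add_apply, LinearMap.smul_apply, Module.End.mul_apply, Module.End.mul_apply,
      contrWedge, wedgeLeft_incl, wedgeLeft_incl]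
    match k, β with
    | 0, β =>
      rw [contr_incl_zero, map_zero, smul_zero]
      refine Eq.trans ?_ (add_zero _).symm
      refine (contr_incl_succ X (k := p) (wedge α β)).trans (incl_congr rfl _ _ fun x v => ?_)
      exact wedgeAt_cons_succ_zero rfl rfl (α.1 x) (β.1 x) (X x) v
    | k + 1, β =>
      rw [contr_incl_succ, wedgeLeft_incl]
      refine (contr_incl_succ X (k := p + 1 + k) (wedge α β)).trans ?_
      -- The first summand is re-indexed to degree p + 1 + k, so that the two summands can be added
      -- before being compared pointwise.
      have hsum : incl (p + (k + 1)) (wedge (contract X α) β)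
          = incl (p + 1 + k) ⟨fun x => ((wedge (contract X α) β).1 x).domDomCongr
            (finCongr (by omega)), fun V => (wedge (contract X α) β).2 fun i => 
              V (finCongr (by omega) i)⟩ :=
        incl_congr (by omega) _ _ fun x v => rfl
      rw [hsum, ← map_smul, ← map_add]
      refine incl_congr rfl _ _ fun x v => ?_
      exact wedgeAt_cons_succ_succ (p := p) (q := k) rfl (show p + (k + 1) = p + 1 + k by omega) rfl (α.1 x) (β.1 x) (X x) v

/-- A form of mixed degree without component of degree zero all of whose contractions vanish is
zero. -/
theorem eq_zero_of_contr [FiniteDimensional ℝ E] [T2Space M] {ρ : Forms E M}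
    (h0 : comp 0 ρ = 0) (h : ∀ X, contr X ρ = 0) : ρ = 0 := by
  refine ext_comp fun k => ?_
  rw [map_zero]
  match k with
  | 0 => exact h0
  | k + 1 =>
    refine DiffForm.ext_evalFields (AlternatingMap.ext fun W => ?_)
    have hW : W = Matrix.vecCons (W 0) fun i => W i.succ := (Fin.cons_self_tail W).symm
    rw [hW, ← evalFields_contract, ← comp_contr, h, map_zero]
    rfl

/-- An operator that commutes with all contractions up to a scalar and whose values have no
component of degree zero vanishes. -/
theorem end_eq_zero [FiniteDimensional ℝ E] [T2Space M] {D : Module.End ℝ (Forms E M)} (c : ℝ)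
    (h0 : ∀ ρ, comp 0 (D ρ) = 0) (h : ∀ X, contr X * D = c • (D * contr X)) : D = 0 := by
  refine linearMap_ext fun k => ?_
  -- The contraction of D α is c times D applied to the contraction of α. This is zero by induction,
  -- or because contractions kill functions, so D α has no contractions and no component of degree
  -- zero.
  induction k with
  | zero =>
    intro α
    refine eq_zero_of_contr (h0 _) fun X => ?_
    have := LinearMap.congr_fun (h X) (incl 0 α)
    rw [Module.End.mul_apply] at this
    rw [this, LinearMap.smul_apply, Module.End.mul_apply, contr_incl_zero, map_zero, smul_zero]
  | succ k ih =>
    intro α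
    refine eq_zero_of_contr (h0 _) fun X => ?_
    have := LinearMap.congr_fun (h X) (incl (k + 1) α)
    rw [Module.End.mul_apply] at this
    rw [this, LinearMap.smul_apply, Module.End.mul_apply, contr_incl_succ, ih,
      LinearMap.zero_apply, smul_zero]

end Basic

/-! ### Ring identities that put graded commutators in the form required by `end_eq_zero` -/

section SuperAlgebra

variable {R : Type*} [Ring R] [Algebra ℝ R] {a b s : ℝ}

/-- `A` and `B` are multiplications by forms of parities `a` and `b`, and `A'`, `B'` multiplications
by their contractions. The hypotheses `hA` and `hB` say that `A'`, `B` and `A`, `B'` already commute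
in the graded sense, as an induction provides. -/
theorem contr_graded_commutator {c A B A' B' : R} (ha : a = 1 ∨ a = -1) (hb : b = 1 ∨ b = -1)
    (hcA : c * A = A' + a • (A * c)) (hcB : c * B = B' + b • (B * c))
    (hA : A' * B = (s * b) • (B * A')) (hB : A * B' = (s * a) • (B' * A)) :
    c * (A * B - s • (B * A)) = (a * b) • ((A * B - s • (B * A)) * c) := by
  have e1 : c * (A * B) = A' * B + a • (A * B') + (a * b) • (A * B * c) := by
    rw [← mul_assoc, hcA, add_mul, smul_mul_assoc, mul_assoc A, hcB, mul_add, smul_add,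
      mul_smul_comm, smul_smul, mul_assoc, add_assoc]
  have e2 : c * (B * A) = B' * A + b • (B * A') + (b * a) • (B * A * c) := by
    rw [← mul_assoc, hcB, add_mul, smul_mul_assoc, mul_assoc B, hcA, mul_add, smul_add,
      mul_smul_comm, smul_smul, mul_assoc, add_assoc]
  rw [mul_sub, mul_smul_comm, e1, e2, hA, hB, sub_mul, smul_mul_assoc]
  rcases ha with rfl | rfl <;> rcases hb with rfl | rfl <;> module

/-- For L = L_X, c = ι_Y and c' the contraction with [X, Y]: `A` is multiplication by α, `N` by L_X
α, and primes denote contraction. The hypothesis `hA` is the derivation rule for ι_Y α, since L_X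
ι_Y α is the sum of the forms behind `N'` and `A''`. -/
theorem contr_lie_commutator {c c' L A A' A'' N N' : R} (ha : a = 1 ∨ a = -1)
    (hLc : L * c = c * L + c') (hcA : c * A = A' + a • (A * c)) (hcA' : c' * A = A'' + a • (A * c'))
    (hcN : c * N = N' + a • (N * c)) (hA : L * A' = A' * L + (N' + A'')) :
    c * (L * A - A * L - N) = a • ((L * A - A * L - N) * c) := by
  have h1 : c * L = L * c - c' := eq_sub_of_add_eq hLc.symm
  rw [mul_sub, mul_sub, ← mul_assoc, ← mul_assoc, h1, hcA, hcN, sub_mul, mul_assoc L, hcA, hcA',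
    add_mul, smul_mul_assoc, mul_assoc A, h1, mul_add, hA]
  rcases ha with rfl | rfl <;> simp only [one_smul, neg_smul] <;> noncomm_ring

/-- `A` is multiplication by α, `N` by dα, `W` by L_X α and `P` by d ι_X α. Then `hN` is the Cartan
formula for α and `hA` the antiderivation rule for ι_X α. -/
theorem contr_d_commutator {c d L A A' N N' W P : R} (ha : a = 1 ∨ a = -1)
    (hL : L = d * c + c * d) (hcA : c * A = A' + a • (A * c)) (hcN : c * N = N' + (-a) • (N * c))
    (hN : N' = W - P) (hLA : L * A = A * L + W) (hA : d * A' = P + (-a) • (A' * d)) :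
    c * (d * A - N - a • (A * d)) = (-a) • ((d * A - N - a • (A * d)) * c) := by
  have h1 : c * d = L - d * c := by rw [hL, add_sub_cancel_left]
  rw [mul_sub, mul_sub, mul_smul_comm, ← mul_assoc, ← mul_assoc, h1, hcN, hcA, sub_mul, hLA,
    add_mul, smul_mul_assoc, mul_assoc A, h1, mul_assoc d, hcA, mul_add, hA, hN]
  rcases ha with rfl | rfl <;> simp only [one_smul, neg_smul, neg_neg] <;> noncomm_ring

/-- With c = ι_Z, the hypothesis `hJ` is the Jacobi identity for X, Y, Z under contraction; the
double brackets are all that survives. -/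
theorem contr_lie_lie_commutator {c cX cY cXY cYX cb LX LY Lb : R}
    (hX : LX * c = c * LX + cX) (hY : LY * c = c * LY + cY) (hb : Lb * c = c * Lb + cb)
    (hXY : LX * cY = cY * LX + cXY) (hYX : LY * cX = cX * LY + cYX) (hJ : cXY = cb + cYX) :
    c * (LX * LY - LY * LX - Lb) = (LX * LY - LY * LX - Lb) * c := by
  have h1 : c * LX = LX * c - cX := eq_sub_of_add_eq hX.symm
  have h2 : c * LY = LY * c - cY := eq_sub_of_add_eq hY.symm
  have h3 : c * Lb = Lb * c - cb := eq_sub_of_add_eq hb.symm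
  have h4 : cY * LX = LX * cY - cXY := eq_sub_of_add_eq hXY.symm
  have h5 : cX * LY = LY * cX - cYX := eq_sub_of_add_eq hYX.symm
  rw [mul_sub, mul_sub, ← mul_assoc, ← mul_assoc, h1, h2, h3, sub_mul, sub_mul, mul_assoc LX,
    mul_assoc LY, h1, h2, h4, h5, hJ]
  noncomm_ring

/-- Here c = ι_Y and c' contracts with [X, Y]. Expressing c d and c' d by Cartan's formula reduces
the claim to the commutator of the Lie derivatives. -/
theorem contr_d_lie_commutator {c d c' LX LY L' : R} (hY : LY = d * c + c * d)
    (hX : LX * c = c * LX + c') (h' : L' = d * c' + c' * d) (hXY : LX * LY - LY * LX = L') :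
    c * (d * LX - LX * d) = -((d * LX - LX * d) * c) := by
  have h1 : c * d = LY - d * c := by rw [hY, add_sub_cancel_left]
  have h2 : c * LX = LX * c - c' := eq_sub_of_add_eq hX.symm
  have h3 : c' * d = LX * LY - LY * LX - d * c' := by rw [hXY, h', add_sub_cancel_left]
  rw [mul_sub, ← mul_assoc, ← mul_assoc, h1, h2, sub_mul, sub_mul, mul_assoc d, h2, mul_assoc LX,
    h1, h3]
  noncomm_ring

end SuperAlgebra

/-! ### Commutation rules of d, L_X and wedge multiplication -/

section Calculus

variable {E : Type*} [NormedAddCommGroup E] [NormedSpace ℝ E] [FiniteDimensional ℝ E]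
  {M : Type*} [TopologicalSpace M] [T2Space M] [ChartedSpace E M] [IsManifold 𝓘(ℝ, E) ∞ M]
  {p q k : ℕ}

/-- Contracting the graded commutator of α∧ and β∧ yields those of the pairs (ι_X α, β) and (α, ι_X
β), of total degree one less. At total degree zero two functions commute. -/
theorem wedgeLeft_wedgeLeft_aux : (n : ℕ) → {p q : ℕ} → p + q = n →
    (α : DiffForm E M p) → (β : DiffForm E M q) →
    wedgeLeft α * wedgeLeft β - (-1 : ℝ) ^ (p * q) • (wedgeLeft β * wedgeLeft α) = 0 := by
  intro n
  induction n with
  | zero =>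
    intro p q hpq α β
    obtain ⟨rfl, rfl⟩ : p = 0 ∧ q = 0 := by omega
    rw [wedgeLeft_zero_degree, wedgeLeft_zero_degree, mul_zero, pow_zero, one_smul, sub_eq_zero]
    refine LinearMap.ext fun ρ => ext_comp fun k => ?_
    simp only [Module.End.mul_apply, comp_smulFun]
    exact Subtype.ext (funext fun x => smul_comm _ _ _)
  | succ n ih =>
    intro p q hpq α β
    refine end_eq_zero ((-1) ^ p * (-1) ^ q) (fun ρ => ?_) fun X => ?_
    · rw [LinearMap.sub_apply, LinearMap.smul_apply, Module.End.mul_apply, Module.End.mul_apply,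
        map_sub, map_smul]
      match p, q, α, β with
      | 0, q + 1, α, β =>
        rw [comp_zero_wedgeLeft, wedgeLeft_zero_degree, comp_smulFun, comp_zero_wedgeLeft]
        simp
      | p + 1, 0, α, β =>
        rw [comp_zero_wedgeLeft, wedgeLeft_zero_degree, comp_smulFun, comp_zero_wedgeLeft]
        simp
      | p + 1, q + 1, α, β => rw [comp_zero_wedgeLeft, comp_zero_wedgeLeft]; simp
    · refine contr_graded_commutator (neg_one_pow_eq_or ℝ p) (neg_one_pow_eq_or ℝ q)
        (contr_wedgeLeft X α) (contr_wedgeLeft X β) ?_ ?_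
      · match p, α with
        | 0, α => simp [contrWedge]
        | p + 1, α =>
          have h := sub_eq_zero.1 (ih (p := p) (q := q) (by omega) (contract X α) β)
          rw [contrWedge, h, ← pow_add, show (p + 1) * q + q = p * q + 2 * q by ring, pow_add,
            pow_mul _ 2]
          simp
      · match q, β with
        | 0, β => simp [contrWedge]
        | q + 1, β =>
          have h := sub_eq_zero.1 (ih (p := p) (q := q) (by omega) α (contract X β))
          rw [contrWedge, h, ← pow_add, show p * (q + 1) + p = p * q + 2 * p by ring, pow_add,
            pow_mul _ 2]
          simp

/-- Wedge multiplication is graded commutative. -/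
theorem wedgeLeft_wedgeLeft (α : DiffForm E M p) (β : DiffForm E M q) :
    wedgeLeft α * wedgeLeft β = (-1 : ℝ) ^ (p * q) • (wedgeLeft β * wedgeLeft α) :=
  sub_eq_zero.1 (wedgeLeft_wedgeLeft_aux (p + q) rfl α β)

theorem d_incl (α : DiffForm E M k) : d (incl k α) = incl (k + 1) (extDeriv α) := by
  rw [d, ofDegrees_incl]; rfl

theorem lie_incl (X : VectorField E M) (α : DiffForm E M k) :
    lie X (incl k α) = incl k (lieDeriv X α) := by
  rw [lie, ofDegrees_incl]; rfl

theorem comp_lie (X : VectorField E M) (ρ : Forms E M) (k : ℕ) :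
    comp k (lie X ρ) = lieDeriv X (comp k ρ) := by
  have h : comp k ∘ₗ lie X = lieDeriv X ∘ₗ comp k := by
    refine linearMap_ext fun l α => ?_
    simp only [LinearMap.comp_apply, lie_incl]
    rcases eq_or_ne l k with rfl | hl
    · rw [comp_incl_self, comp_incl_self]
    · rw [comp_incl_of_ne hl, comp_incl_of_ne hl, map_zero]
  exact LinearMap.congr_fun h ρ

theorem comp_zero_d (ρ : Forms E M) : comp 0 (d ρ) = 0 := by
  have h : comp 0 ∘ₗ d (E := E) (M := M) = 0 := by
    refine linearMap_ext fun l β => ?_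
    simp only [LinearMap.comp_apply, d_incl]
    rw [comp_incl_of_ne (by omega)]
    rfl
  exact LinearMap.congr_fun h ρ

/-- The Cartan formula. -/
theorem lie_eq (X : VectorField E M) : lie X = d * contr X + contr X * d := by
  refine linearMap_ext fun k α => ?_
  rw [LinearMap.add_apply, Module.End.mul_apply, Module.End.mul_apply, lie_incl, d_incl]
  match k, α with
  | 0, α => rw [contr_incl_zero, contr_incl_succ, contract_extDeriv_zero, map_zero, zero_add]
  | k + 1, α =>
    rw [contr_incl_succ, contr_incl_succ, contract_extDeriv_succ, d_incl, ← map_add]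
    exact congrArg (incl (k + 1)) (add_sub_cancel (extDeriv (contract X α)) (lieDeriv X α)).symm

theorem lie_contr (X Y : VectorField E M) :
    lie X * contr Y = contr Y * lie X + contr (lieBracketField X Y) := by
  refine linearMap_ext fun k α => ?_
  rw [LinearMap.add_apply, Module.End.mul_apply, Module.End.mul_apply, lie_incl]
  match k, α with
  | 0, α => rw [contr_incl_zero, contr_incl_zero, contr_incl_zero, map_zero, add_zero]
  | k + 1, α =>
    rw [contr_incl_succ, contr_incl_succ, contr_incl_succ, lie_incl, lieDeriv_contract, map_add]

theorem toFunction_lieDeriv (X : VectorField E M) (α : DiffForm E M 0) :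
    toFunction (lieDeriv X α) = dirDeriv X (toFunction α) := by
  rw [toFunction, evalFields_lieDeriv]
  simp [toFunction]

theorem ext_toFunction {α β : DiffForm E M 0} (h : toFunction α = toFunction β) : α = β := by
  refine DiffForm.ext_evalFields (AlternatingMap.ext fun W => ?_)
  rw [Subsingleton.elim W ![]]
  exact h

theorem toFunction_mulFun (f : C^∞⟮𝓘(ℝ, E), M; ℝ⟯) (α : DiffForm E M 0) :
    toFunction (mulFun f α) = f * toFunction α := rfl

theorem toFunction_sub (α β : DiffForm E M 0) :
    toFunction (α - β) = toFunction α - toFunction β := rfl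

/-- On functions this is the commutator formula for derivations; contraction with Z reduces the rest
to the Jacobi identity of vector fields. -/
theorem lie_lie (X Y : VectorField E M) :
    lie X * lie Y - lie Y * lie X = lie (lieBracketField X Y) := by
  rw [← sub_eq_zero]
  refine end_eq_zero 1 (fun ρ => ?_) fun Z => ?_
  · simp only [LinearMap.sub_apply, Module.End.mul_apply, map_sub, comp_lie]
    refine ext_toFunction ?_
    simp only [toFunction_sub, toFunction_lieDeriv, dirDeriv_lieBracketField, sub_self]
    rfl
  · rw [one_smul]
    refine contr_lie_lie_commutator (lie_contr X Z) (lie_contr Y Z) (lie_contr _ Z)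
      (lie_contr X _) (lie_contr Y _) ?_
    rw [← contr_add_left, lieBracketField_jacobi]

theorem d_lie (X : VectorField E M) : d * lie X = lie X * d := by
  rw [← sub_eq_zero]
  refine end_eq_zero (-1) (fun ρ => ?_) fun Y => ?_
  · simp only [LinearMap.sub_apply, Module.End.mul_apply, map_sub, comp_lie, comp_zero_d, map_zero,
      sub_self]
  · exact (contr_d_lie_commutator (lie_eq Y) (lie_contr X Y) (lie_eq _) (lie_lie X Y)).trans
      (neg_one_smul ℝ _).symm

/-- Since ι_X d = L_X - d ι_X and d commutes with L_X, the operator d d commutes with all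
contractions. -/
theorem d_d : d * d = (0 : Module.End ℝ (Forms E M)) := by
  refine end_eq_zero 1 (fun ρ => comp_zero_d _) fun X => ?_
  have h1 : contr X * d = lie X - d * contr X := by rw [lie_eq, add_sub_cancel_left]
  rw [one_smul, ← mul_assoc, h1, sub_mul, mul_assoc d, h1, ← d_lie, mul_sub, sub_sub_cancel,
    mul_assoc]

/-- Induction on the degree of α: contraction with Y leads to the rule for ι_Y α. The component of
degree zero is the product rule when α is a function and vanishes otherwise. -/
theorem lie_wedgeLeft_aux (X : VectorField E M) : {p : ℕ} → (α : DiffForm E M p) →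
    lie X * wedgeLeft α - wedgeLeft α * lie X - wedgeLeft (lieDeriv X α) = 0 := by
  intro p
  induction p with
  | zero =>
    intro α
    refine end_eq_zero ((-1) ^ 0) (fun ρ => ?_) fun Y => ?_
    · rw [wedgeLeft_zero_degree, wedgeLeft_zero_degree]
      simp only [LinearMap.sub_apply, Module.End.mul_apply, map_sub, comp_lie, comp_smulFun]
      refine ext_toFunction ?_
      simp only [toFunction_sub, toFunction_lieDeriv, toFunction_mulFun, dirDeriv_mul]
      ring_nf
      rfl
    · refine contr_lie_commutator (neg_one_pow_eq_or ℝ 0) (lie_contr X Y) (contr_wedgeLeft Y α)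
        (contr_wedgeLeft _ α) (contr_wedgeLeft Y _) ?_
      simp [contrWedge]
  | succ p ih =>
    intro α
    refine end_eq_zero ((-1) ^ (p + 1)) (fun ρ => ?_) fun Y => ?_
    · simp only [LinearMap.sub_apply, Module.End.mul_apply, map_sub, comp_lie, comp_zero_wedgeLeft,
        map_zero, sub_self]
    · refine contr_lie_commutator (neg_one_pow_eq_or ℝ (p + 1)) (lie_contr X Y)
        (contr_wedgeLeft Y α) (contr_wedgeLeft _ α) (contr_wedgeLeft Y _) ?_
      have h := ih (contract Y α)
      rw [lieDeriv_contract, sub_sub, sub_eq_zero, wedgeLeft_add] at h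
      exact h

theorem lie_wedgeLeft (X : VectorField E M) (α : DiffForm E M p) :
    lie X * wedgeLeft α = wedgeLeft α * lie X + wedgeLeft (lieDeriv X α) := by
  have h := lie_wedgeLeft_aux X α
  rwa [sub_sub, sub_eq_zero] at h

/-- Induction on the degree of α. Contraction brings in the derivation rule of L_X, already known in
every degree, and the antiderivation rule for ι_X α. -/
theorem d_wedgeLeft_aux : {p : ℕ} → (α : DiffForm E M p) →
    d * wedgeLeft α - wedgeLeft (extDeriv α) - (-1 : ℝ) ^ p • (wedgeLeft α * d) = 0 := by
  intro p
  have hcN : ∀ (X : VectorField E M) {p : ℕ} (α : DiffForm E M p),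
      contr X * wedgeLeft (extDeriv α) = wedgeLeft (contract X (extDeriv α))
        + (-(-1 : ℝ) ^ p) • (wedgeLeft (extDeriv α) * contr X) := by
    intro X p α
    have h := contr_wedgeLeft X (extDeriv α)
    rwa [pow_succ, mul_neg_one] at h
  induction p with
  | zero =>
    intro α
    refine end_eq_zero (-(-1) ^ 0) (fun ρ => ?_) fun X => ?_
    · simp only [LinearMap.sub_apply, LinearMap.smul_apply, Module.End.mul_apply, map_sub, map_smul,
        comp_zero_d, comp_zero_wedgeLeft, wedgeLeft_zero_degree, comp_smulFun, map_zero, smul_zero,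
        sub_self]
    · refine contr_d_commutator (neg_one_pow_eq_or ℝ 0) (lie_eq X) (contr_wedgeLeft X α)
        (hcN X α) (W := wedgeLeft (lieDeriv X α)) (P := 0) ?_ (lie_wedgeLeft X α) ?_
      · rw [contract_extDeriv_zero, sub_zero]
      · simp [contrWedge]
  | succ p ih =>
    intro α
    refine end_eq_zero (-(-1) ^ (p + 1)) (fun ρ => ?_) fun X => ?_
    · simp only [LinearMap.sub_apply, LinearMap.smul_apply, Module.End.mul_apply, map_sub, map_smul,
        comp_zero_d, comp_zero_wedgeLeft, smul_zero, sub_self]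
    · refine contr_d_commutator (neg_one_pow_eq_or ℝ (p + 1)) (lie_eq X) (contr_wedgeLeft X α)
        (hcN X α) (W := wedgeLeft (lieDeriv X α)) (P := wedgeLeft (extDeriv (contract X α))) ?_
        (lie_wedgeLeft X α) ?_
      · rw [contract_extDeriv_succ, wedgeLeft_sub]
      · have h := ih (contract X α)
        rw [sub_sub, sub_eq_zero] at h
        simp only [contrWedge]
        rw [h, pow_succ, mul_neg_one, neg_neg]

/-- The exterior derivative is an antiderivation. -/
theorem d_wedgeLeft (α : DiffForm E M p) :
    d * wedgeLeft α = wedgeLeft (extDeriv α) + (-1 : ℝ) ^ p • (wedgeLeft α * d) := by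
  have h := d_wedgeLeft_aux α
  rwa [sub_sub, sub_eq_zero] at h

end Calculus
end Forms

/-! ### Consequences of the Courant algebroid axioms -/

section Courant

variable {E : Type*} [NormedAddCommGroup E] [NormedSpace ℝ E]
  {M : Type*} [TopologicalSpace M] [ChartedSpace E M] [IsManifold 𝓘(ℝ, E) ∞ M]
  {F : Type*} [NormedAddCommGroup F] [NormedSpace ℝ F]
  {V : M → Type*} [TopologicalSpace (TotalSpace F V)] [∀ x, TopologicalSpace (V x)]
  [FiberBundle F V] [∀ x, AddCommGroup (V x)] [∀ x, Module ℝ (V x)] [VectorBundle ℝ F V]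

namespace CourantAlgebroid

variable (C : CourantAlgebroid E M F V)

/-- The function `2 ⟨X, Y⟩`. -/
def pairTwo (X Y : Cₛ^∞⟮𝓘(ℝ, E); F, V⟯) : C^∞⟮𝓘(ℝ, E), M; ℝ⟯ := (2 : ℝ) • C.pairingFun X Y

theorem pairTwo_apply (X Y : Cₛ^∞⟮𝓘(ℝ, E); F, V⟯) (x : M) :
    C.pairTwo X Y x = 2 * C.pairing x (X x) (Y x) := rfl

theorem pairTwo_symm (X Y : Cₛ^∞⟮𝓘(ℝ, E); F, V⟯) : C.pairTwo X Y = C.pairTwo Y X := by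
  ext x
  rw [pairTwo_apply, pairTwo_apply, C.pairing_symm]

theorem pairTwo_add_left (X X' Y : Cₛ^∞⟮𝓘(ℝ, E); F, V⟯) :
    C.pairTwo (X + X') Y = C.pairTwo X Y + C.pairTwo X' Y := by
  ext x
  simp [pairTwo_apply, mul_add]

theorem pairTwo_add_right (X Y Y' : Cₛ^∞⟮𝓘(ℝ, E); F, V⟯) :
    C.pairTwo X (Y + Y') = C.pairTwo X Y + C.pairTwo X Y' := by
  ext x
  simp [pairTwo_apply, mul_add]

theorem IsotropicSplitting.anchorField_lift {C : CourantAlgebroid E M F V}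
    (s : C.IsotropicSplitting) (X : VectorField E M) : C.anchorField (s.lift X) = X := by
  ext x
  exact s.anchor_toFun x (X x)

variable [FiniteDimensional ℝ E] [T2Space M]

theorem dirDeriv_pairTwo (X Y Z : Cₛ^∞⟮𝓘(ℝ, E); F, V⟯) :
    dirDeriv (C.anchorField X) (C.pairTwo Y Z)
      = C.pairTwo (C.bracket X Y) Z + C.pairTwo Y (C.bracket X Z) := by
  have h : dirDeriv (C.anchorField X) (C.pairTwo Y Z)
      = (2 : ℝ) • dirDeriv (C.anchorField X) (C.pairingFun Y Z) :=
    map_smul (dirDerivLin (C.anchorField X)) _ _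
  rw [h]
  ext x
  have h' := congrArg (fun t => 2 * t) (C.anchor_pairing_leibniz X Y Z x)
  simp only [mul_add] at h'
  exact h'

theorem dirDeriv_pairTwo_symm (X Y Z : Cₛ^∞⟮𝓘(ℝ, E); F, V⟯) :
    dirDeriv (C.anchorField X) (C.pairTwo Y Z)
      = C.pairTwo X (C.bracket Y Z) + C.pairTwo X (C.bracket Z Y) := by
  have h : dirDeriv (C.anchorField X) (C.pairTwo Y Z)
      = (2 : ℝ) • dirDeriv (C.anchorField X) (C.pairingFun Y Z) :=
    map_smul (dirDerivLin (C.anchorField X)) _ _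
  rw [h, ← pairTwo_add_right]
  ext x
  exact congrArg (fun t => 2 * t) (C.anchor_pairing_symm X Y Z x)

variable [FiniteDimensional ℝ F] [ContMDiffVectorBundle ∞ F V 𝓘(ℝ, E)]

theorem eq_of_pairTwo_eq {X Y : Cₛ^∞⟮𝓘(ℝ, E); F, V⟯} (h : ∀ Z, C.pairTwo X Z = C.pairTwo Y Z) :
    X = Y := by
  ext x
  refine sub_eq_zero.1 (C.pairing_nondegenerate x _ fun w => ?_)
  obtain ⟨Z, rfl⟩ := exists_section_eq (E := E) (F := F) (V := V) x w
  have := congrArg (fun f : C^∞⟮𝓘(ℝ, E), M; ℝ⟯ => f x) (h Z)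
  simp only [pairTwo_apply] at this
  rw [map_sub, LinearMap.sub_apply]
  linarith

theorem pairTwo_funSMul_left (f : C^∞⟮𝓘(ℝ, E), M; ℝ⟯) (X Y : Cₛ^∞⟮𝓘(ℝ, E); F, V⟯) :
    C.pairTwo (funSMul f X) Y = f * C.pairTwo X Y := by
  ext x
  simp [pairTwo_apply, funSMul_apply, mul_left_comm]

/-- The Leibniz rule for the Loday bracket. -/
theorem bracket_funSMul (f : C^∞⟮𝓘(ℝ, E), M; ℝ⟯) (X Y : Cₛ^∞⟮𝓘(ℝ, E); F, V⟯) :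
    C.bracket X (funSMul f Y)
      = funSMul f (C.bracket X Y) + funSMul (dirDeriv (C.anchorField X) f) Y := by
  refine C.eq_of_pairTwo_eq fun Z => ?_
  have h1 := C.dirDeriv_pairTwo X (funSMul f Y) Z
  have h2 := C.dirDeriv_pairTwo X Y Z
  rw [pairTwo_funSMul_left, pairTwo_funSMul_left, dirDeriv_mul, h2] at h1
  rw [pairTwo_add_left, pairTwo_funSMul_left, pairTwo_funSMul_left]
  linear_combination -h1

/-- The Jacobi identity for X, Y, fZ is expanded by the Leibniz rule and compared with f times the
one for X, Y, Z. The mixed first derivatives cancel and only second-order terms remain. -/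
theorem funSMul_dirDeriv_bracket (f : C^∞⟮𝓘(ℝ, E), M; ℝ⟯) (X Y Z : Cₛ^∞⟮𝓘(ℝ, E); F, V⟯) (x : M) :
    dirDeriv (C.anchorField (C.bracket X Y)) f x • Z x
      = dirDeriv (lieBracketField (C.anchorField X) (C.anchorField Y)) f x • Z x := by
  have h := congrArg (fun σ : Cₛ^∞⟮𝓘(ℝ, E); F, V⟯ => σ x) (C.jacobi X Y (funSMul f Z))
  have h' := congrArg (fun σ : Cₛ^∞⟮𝓘(ℝ, E); F, V⟯ => σ x) (C.jacobi X Y Z)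
  simp only [bracket_funSMul, map_add] at h
  simp only [ContMDiffSection.coe_add, Pi.add_apply, funSMul_apply] at h h'
  rw [dirDeriv_lieBracketField, ContMDiffMap.coe_sub, Pi.sub_apply]
  rw [h'] at h
  simp only [smul_add, sub_smul] at h ⊢
  rw [← sub_eq_zero] at h ⊢
  rw [← neg_eq_zero, ← h]
  abel

end CourantAlgebroid

/-! ### Splittings, one-form parts of brackets and the twisting form -/

namespace ExtendedTangentBundle

variable [FiniteDimensional ℝ E] [T2Space M] [FiniteDimensional ℝ F]
  [ContMDiffVectorBundle ∞ F V 𝓘(ℝ, E)] (T : ExtendedTangentBundle E M F V)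

/-- The anchor map is a homomorphism for the brackets. -/
theorem anchorField_bracket (X Y : Cₛ^∞⟮𝓘(ℝ, E); F, V⟯) :
    T.anchorField (T.bracket X Y) = lieBracketField (T.anchorField X) (T.anchorField Y) := by
  ext x
  -- The section Z can be cancelled only where it is nonzero. If the fibre is zero, surjectivity of
  -- the anchor makes the tangent space zero too.
  by_cases hV : ∃ v : V x, v ≠ 0
  · obtain ⟨v, hv⟩ := hV
    obtain ⟨Z, rfl⟩ := exists_section_eq (E := E) (F := F) (V := V) x v
    refine eq_of_mvfderiv_eq x _ _ fun f => ?_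
    have h := T.funSMul_dirDeriv_bracket f X Y Z x
    exact smul_left_injective ℝ hv h
  · push Not at hV
    obtain ⟨v, hv⟩ := T.anchor_surjective x (lieBracketField (T.anchorField X) (T.anchorField Y) x)
    rw [← hv, hV v]
    change T.anchor x _ = _
    rw [hV (T.bracket X Y x)]

variable {T} (s s' : T.IsotropicSplitting)

/-- The vector v - s(a(v)) is in the kernel of the anchor, hence a covector by exactness. It pairs
with `w` only through a(w), and s'(a(w)) has the same anchor. -/
theorem pairing_sub_lift (x : M) (v w : V x) :
    T.pairing x (v - s.toFun x (T.anchor x v)) w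
      = T.pairing x (v - s.toFun x (T.anchor x v)) (s'.toFun x (T.anchor x w)) := by
  obtain ⟨ξ, hξ⟩ := (T.anchor_eq_zero_iff x (v - s.toFun x (T.anchor x v))).1 (by
    rw [map_sub, s.anchor_toFun, sub_self])
  have h1 := hξ w
  have h2 := hξ (s'.toFun x (T.anchor x w))
  rw [s'.anchor_toFun] at h2
  linarith

theorem evalFields_oneForm (X : Cₛ^∞⟮𝓘(ℝ, E); F, V⟯) (W : Fin 1 → VectorField E M) :
    evalFields (s.oneForm X) W = T.pairTwo X (s.lift (W 0)) := by
  ext x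
  change 2 * T.pairing x (X x - s.toFun x (T.anchor x (X x))) (s.toFun x (W 0 x)) = _
  rw [map_sub, LinearMap.sub_apply, s.isotropic, sub_zero]
  rfl

theorem pairTwo_sub_lift (X Z : Cₛ^∞⟮𝓘(ℝ, E); F, V⟯) :
    T.pairTwo (X - s.lift (T.anchorField X)) Z
      = evalFields (s.oneForm X) ![T.anchorField Z] := by
  ext x
  have h := pairing_sub_lift s s x (X x) (Z x)
  rw [CourantAlgebroid.pairTwo_apply]
  exact congrArg (fun t => 2 * t) h

theorem oneForm_lift (X : VectorField E M) : s.oneForm (s.lift X) = 0 := by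
  refine DiffForm.ext_evalFields (AlternatingMap.ext fun W => ?_)
  rw [evalFields_oneForm]
  ext x
  change 2 * T.pairing x (s.toFun x (X x)) (s.toFun x (W 0 x)) = 0
  rw [s.isotropic, mul_zero]

theorem oneForm_add (X Y : Cₛ^∞⟮𝓘(ℝ, E); F, V⟯) :
    s.oneForm (X + Y) = s.oneForm X + s.oneForm Y := by
  refine DiffForm.ext_evalFields (AlternatingMap.ext fun W => ?_)
  rw [evalFields_add, AlternatingMap.add_apply, evalFields_oneForm, evalFields_oneForm,
    evalFields_oneForm, CourantAlgebroid.pairTwo_add_left]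

theorem evalFields_twistingForm (W : Fin 3 → VectorField E M) :
    evalFields s.twistingForm W = T.pairTwo (s.lift (W 0))
      (T.bracket (s.lift (W 1)) (s.lift (W 2))) := by
  have h : evalFields s.twistingForm = s.twistingTensor := evalFields_ofTensor _ _
  rw [h]
  rfl

theorem evalFields_contract_twistingForm (X Y : VectorField E M) (W : Fin 1 → VectorField E M) :
    evalFields (contract Y (contract X s.twistingForm)) W
      = T.pairTwo (T.bracket (s.lift X) (s.lift Y)) (s.lift (W 0)) := by
  have hW : W = Matrix.vecCons (W 0) ![] := by
    ext1 i; fin_cases i; rfl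
  -- Two transpositions move the last argument of H to the first slot, where the definition of H
  -- pairs it with the bracket of the other two.
  have h : contract (W 0) (contract Y (contract X s.twistingForm))
      = contract Y (contract X (contract (W 0) s.twistingForm)) := by
    rw [contract_contract (W 0) Y, contract_contract (W 0) X]
    have : contract Y (-contract X (contract (W 0) s.twistingForm))
      = -contract Y (contract X (contract (W 0) s.twistingForm)) := by
      have := map_neg (contract Y) (contract X (contract (W 0) s.twistingForm))
      exact this
    rw [this]
    exact neg_neg (contract Y (contract X (contract (W 0) s.twistingForm)))
  rw [hW, ← evalFields_contract, h, evalFields_contract, evalFields_contract, evalFields_contract,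
    evalFields_twistingForm, CourantAlgebroid.pairTwo_symm]
  rfl

theorem evalFields_lieDeriv_one (X : VectorField E M) (α : DiffForm E M 1)
    (W : VectorField E M) : evalFields (lieDeriv X α) ![W]
      = dirDeriv X (evalFields α ![W]) - evalFields α ![lieBracketField X W] := by
  rw [evalFields_lieDeriv, Fin.sum_univ_one]
  congr 2
  ext1 i
  fin_cases i
  rfl

theorem evalFields_contract_extDeriv_one (X : VectorField E M) (α : DiffForm E M 1)
    (W : VectorField E M) : evalFields (contract X (extDeriv α)) ![W]
      = dirDeriv X (evalFields α ![W]) - evalFields α ![lieBracketField X W]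
        - dirDeriv W (evalFields α ![X]) := by
  have h : evalFields (contract X (extDeriv α)) ![W] = evalFields (lieDeriv X α) ![W]
      - evalFields (extDeriv (contract X α)) ![W] := by
    rw [contract_extDeriv_succ]; rfl
  rw [h, evalFields_lieDeriv_one, evalFields_extDeriv, extDerivTensor, derivPart_apply,
    Fin.sum_univ_one, evalFields_contract]
  simp only [Fin.val_zero, pow_zero, one_smul]
  congr 4

/-- The one-form part of the bracket of two sections. -/
theorem oneForm_bracket (X Y : Cₛ^∞⟮𝓘(ℝ, E); F, V⟯) :
    s.oneForm (T.bracket X Y) = lieDeriv (T.anchorField X) (s.oneForm Y)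
      - contract (T.anchorField Y) (extDeriv (s.oneForm X))
      + contract (T.anchorField Y) (contract (T.anchorField X) s.twistingForm) := by
  refine DiffForm.ext_evalFields (AlternatingMap.ext fun W => ?_)
  obtain ⟨w, rfl⟩ : ∃ w, W = ![w] := ⟨W 0, by ext1 i; fin_cases i; rfl⟩
  have hsub : ∀ α β γ : DiffForm E M 1, evalFields (α - β + γ) ![w]
      = evalFields α ![w] - evalFields β ![w] + evalFields γ ![w] := fun _ _ _ => rfl
  rw [hsub, evalFields_oneForm, evalFields_lieDeriv_one, evalFields_contract_extDeriv_one,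
    evalFields_contract_twistingForm]
  set S := s.lift w with hS
  have haS : T.anchorField S = w := s.anchorField_lift w
  set A := s.lift (T.anchorField X) with hA
  set B := s.lift (T.anchorField Y) with hB
  have haB : T.anchorField B = T.anchorField Y := s.anchorField_lift _
  -- The sections Y - B and X - A are the one-form parts η and ξ. The three brackets contribute L_X
  -- η, -ι_Y dξ and ι_Y ι_X H.
  have hsplit : T.bracket X Y = T.bracket X (Y - B) + (T.bracket (X - A) B + T.bracket A B) := by
    have h1 : T.bracket X Y = T.bracket X (Y - B) + T.bracket X B := by
      rw [← map_add, sub_add_cancel]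
    have h2 : T.bracket X B = T.bracket (X - A) B + T.bracket A B := by
      rw [← LinearMap.add_apply, ← map_add, sub_add_cancel]
    rw [h1, h2]
  -- Invariance of the pairing evaluates X * η. For ξ * B, the symmetric axiom `h3` exchanges the
  -- factors at the cost of a derivative along w, and `h2` evaluates B * ξ.
  have h1 := T.dirDeriv_pairTwo X (Y - B) S
  have h2 := T.dirDeriv_pairTwo B (X - A) S
  have h3 := T.dirDeriv_pairTwo_symm S (X - A) B
  rw [pairTwo_sub_lift s Y, pairTwo_sub_lift s Y, anchorField_bracket, haS] at h1
  rw [pairTwo_sub_lift s X, pairTwo_sub_lift s X, anchorField_bracket, haS, haB] at h2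
  rw [pairTwo_sub_lift s X, haS, haB, T.pairTwo_symm S, T.pairTwo_symm S] at h3
  change T.pairTwo (T.bracket X Y) S = _ + T.pairTwo (T.bracket A B) S
  rw [hsplit, T.pairTwo_add_left, T.pairTwo_add_left]
  linear_combination -h1 - h3 + h2

theorem oneForm_bracket_lift (X Y : VectorField E M) :
    s.oneForm (T.bracket (s.lift X) (s.lift Y)) = contract Y (contract X s.twistingForm) := by
  refine DiffForm.ext_evalFields (AlternatingMap.ext fun W => ?_)
  rw [evalFields_oneForm, evalFields_contract_twistingForm]

theorem eq_of_contract_eq {k : ℕ} {α β : DiffForm E M (k + 1)}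
    (h : ∀ X, contract X α = contract X β) : α = β := by
  refine DiffForm.ext_evalFields (AlternatingMap.ext fun W => ?_)
  have hW : W = Matrix.vecCons (W 0) fun i => W i.succ := (Fin.cons_self_tail W).symm
  rw [hW, ← evalFields_contract, ← evalFields_contract, h]

theorem oneForm_lift_bracket (X : VectorField E M) (U : Cₛ^∞⟮𝓘(ℝ, E); F, V⟯) :
    s.oneForm (T.bracket (s.lift X) U) = lieDeriv X (s.oneForm U)
      + contract (T.anchorField U) (contract X s.twistingForm) := by
  rw [oneForm_bracket, oneForm_lift, s.anchorField_lift, map_zero, map_zero]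
  exact congrArg (· + contract (T.anchorField U) (contract X s.twistingForm))
    (sub_zero (lieDeriv X (s.oneForm U)))

theorem oneForm_bracket_lift_right (U : Cₛ^∞⟮𝓘(ℝ, E); F, V⟯) (Z : VectorField E M) :
    s.oneForm (T.bracket U (s.lift Z)) + contract Z (extDeriv (s.oneForm U))
      = contract Z (contract (T.anchorField U) s.twistingForm) := by
  rw [oneForm_bracket, oneForm_lift, s.anchorField_lift, map_zero]
  have h : ∀ {G : Type _} [AddCommGroup G] (a b : G), 0 - a + b + a = b := fun a b => by abel
  exact h (contract Z (extDeriv (s.oneForm U)))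
    (contract Z (contract (T.anchorField U) s.twistingForm))

theorem contract_extDeriv_add {k : ℕ} (X : VectorField E M) (α : DiffForm E M (k + 1)) :
    contract X (extDeriv α) + extDeriv (contract X α) = lieDeriv X α := by
  rw [contract_extDeriv_succ]
  exact sub_add_cancel (lieDeriv X α) (extDeriv (contract X α))

/-- The twisting form is closed. -/
theorem extDeriv_twistingForm : extDeriv s.twistingForm = 0 := by
  refine eq_of_contract_eq fun X => eq_of_contract_eq fun Y => eq_of_contract_eq fun Z => ?_
  -- The one-form part of the Jacobi identity for three lifts. Once the Lie derivatives are expanded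
  -- by Cartan's formula, the exterior derivative of H appears, contracted with X, Y and Z.
  have h := congrArg s.oneForm (T.jacobi (s.lift X) (s.lift Y) (s.lift Z))
  have h' := oneForm_bracket_lift_right s (T.bracket (s.lift X) (s.lift Y)) Z
  rw [oneForm_bracket_lift, anchorField_bracket, s.anchorField_lift, s.anchorField_lift] at h'
  rw [oneForm_add, oneForm_lift_bracket s X (T.bracket (s.lift Y) (s.lift Z)),
    oneForm_lift_bracket s Y (T.bracket (s.lift X) (s.lift Z)),
    oneForm_bracket_lift, oneForm_bracket_lift, anchorField_bracket,
    anchorField_bracket, s.anchorField_lift, s.anchorField_lift, s.anchorField_lift,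
    lieDeriv_contract X Z, lieDeriv_contract X Y, lieDeriv_contract Y Z, ← contract_extDeriv_add X,
    ← contract_extDeriv_add Y, map_add, map_add, map_add, map_add] at h
  rw [map_zero, map_zero, map_zero]
  -- `D` stands for the triple contraction of dH, and `K` for the one-form part of (s(X) * s(Y)) *
  -- s(Z), which `h'` supplies.
  have key : ∀ {G : Type _} [AddCommGroup G] {D P Q R S U K : G}, K + U = Q →
      D + P + Q + R + S = K + (P + U + S + R) → D = 0 := by
    intro G _ D P Q R S U K h1 h2
    rw [← h1, ← sub_eq_zero] at h2
    rw [← h2]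
    abel
  exact key (G := DiffForm E M 1) h' h

variable {s s'}

/-- The one-form parts of a section with respect to two splittings. -/
theorem oneForm_eq_of_isShift {B : DiffForm E M 2} (hB : s.IsShift s' B)
    (X : Cₛ^∞⟮𝓘(ℝ, E); F, V⟯) :
    s.oneForm X = s'.oneForm X + contract (T.anchorField X) B := by
  refine DiffForm.ext_evalFields (AlternatingMap.ext fun W => ?_)
  rw [evalFields_add, AlternatingMap.add_apply, evalFields_oneForm, evalFields_oneForm,
    evalFields_contract]
  ext x
  have h := hB x (W 0 x) (X x)
  have hsymm : B.1 x ![W 0 x, T.anchor x (X x)] = -B.1 x ![T.anchor x (X x), W 0 x] := by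
    have := (B.1 x).map_swap ![T.anchor x (X x), W 0 x] (show (0 : Fin 2) ≠ 1 by decide)
    rw [← this]
    congr 1
    ext1 i
    fin_cases i <;> rfl
  have hval : evalFields B (Matrix.vecCons (T.anchorField X) W) x
      = B.1 x ![T.anchor x (X x), W 0 x] := by
    rw [evalFields_apply]
    congr 1
    ext1 i
    fin_cases i <;> rfl
  rw [ContMDiffMap.coe_add, Pi.add_apply, hval, CourantAlgebroid.pairTwo_apply,
    CourantAlgebroid.pairTwo_apply]
  rw [hsymm, map_sub, LinearMap.sub_apply, T.pairing_symm x _ (X x), T.pairing_symm x _ (X x)] at h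
  change 2 * T.pairing x (X x) (s.toFun x (W 0 x))
    = 2 * T.pairing x (X x) (s'.toFun x (W 0 x)) + _
  linarith

/-- The twisting forms of two splittings. -/
theorem twistingForm_eq_of_isShift {B : DiffForm E M 2} (hB : s.IsShift s' B) :
    s'.twistingForm = s.twistingForm + extDeriv B := by
  refine eq_of_contract_eq fun Y => eq_of_contract_eq fun Z => ?_
  have h1 : ∀ X : VectorField E M, s.oneForm (s'.lift X) = contract X B := fun X => by
    rw [oneForm_eq_of_isShift hB, oneForm_lift, s'.anchorField_lift, zero_add]
  -- The part of s'(Y) * s'(Z) relative to `s` is computed twice: from the bracket formula, where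
  -- s'(Y) has one-form ι_Y B, and by passing from its part relative to `s'`, which is ι_Z ι_Y H'.
  have h := oneForm_bracket s (s'.lift Y) (s'.lift Z)
  rw [oneForm_eq_of_isShift hB, oneForm_bracket_lift, anchorField_bracket, h1, h1,
    s'.anchorField_lift, s'.anchorField_lift, lieDeriv_contract] at h
  rw [← contract_extDeriv_add Y, map_add] at h
  rw [map_add, map_add]
  have key : ∀ {G : Type _} [AddCommGroup G] {A D P Q R : G},
      A + R = D + P + R - P + Q → A = Q + D := by
    intro G _ A D P Q R h
    rw [← sub_eq_zero] at h ⊢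
    rw [← h]
    abel
  exact key (G := DiffForm E M 1) h

variable (s s')

theorem two_mul_pairing_shift (x : M) (v : TangentSpace 𝓘(ℝ, E) x) (w : V x) :
    T.pairing x (s'.toFun x v - s.toFun x v) w
      = -T.pairing x (s.toFun x v) (s'.toFun x (T.anchor x w)) := by
  have h := pairing_sub_lift s s' x (s'.toFun x v) w
  rw [s'.anchor_toFun] at h
  rw [h, map_sub, LinearMap.sub_apply, s'.isotropic, zero_sub]

/-- This skew-symmetry, a consequence of the isotropy of both splittings, makes their difference a
two-form. -/
theorem pairing_toFun_swap (x : M) (v w : TangentSpace 𝓘(ℝ, E) x) :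
    T.pairing x (s.toFun x v) (s'.toFun x w) = -T.pairing x (s.toFun x w) (s'.toFun x v) := by
  have h := two_mul_pairing_shift s s' x v (s.toFun x w)
  rw [s.anchor_toFun, map_sub, LinearMap.sub_apply, s.isotropic, sub_zero,
    T.pairing_symm x (s'.toFun x v)] at h
  linarith

/-- Any two isotropic splittings differ by a two-form. -/
theorem exists_isShift : ∃ B : DiffForm E M 2, s.IsShift s' B := by
  -- Alternation of `b` doubles it, because it is already skew, so its value is -2⟨s(v), s'(w)⟩;
  -- this is the two-form sought.
  let b : ∀ x : M, TangentSpace 𝓘(ℝ, E) x →ₗ[ℝ] TangentSpace 𝓘(ℝ, E) x [⋀^Fin 1]→ₗ[ℝ] ℝ :=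
    fun x =>
      { toFun := fun v => AlternatingMap.ofSubsingleton ℝ (TangentSpace 𝓘(ℝ, E) x) ℝ (0 : Fin 1)
          (-(T.pairing x (s.toFun x v)).comp (s'.toFun x))
        map_add' := fun v w => by
          ext u
          simp [add_comm]
        map_smul' := fun c v => by
          ext u
          simp }
  have hb : ∀ x (v : Fin 2 → TangentSpace 𝓘(ℝ, E) x), AlternatingMap.alternatizeUncurryFin (b x) v
      = -2 * T.pairing x (s.toFun x (v 0)) (s'.toFun x (v 1)) := by
    intro x v
    have h := pairing_toFun_swap s s' x (v 1) (v 0)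
    rw [AlternatingMap.alternatizeUncurryFin_apply, Fin.sum_univ_two]
    change (-1 : ℤ) ^ 0 • -T.pairing x (s.toFun x (v 0)) (s'.toFun x (v 1))
      + (-1 : ℤ) ^ 1 • -T.pairing x (s.toFun x (v 1)) (s'.toFun x (v 0)) = _
    rw [h]
    simp
    ring
  refine ⟨⟨fun x => AlternatingMap.alternatizeUncurryFin (b x), fun W => ?_⟩, fun x v w => ?_⟩
  · simp only [hb]
    exact contMDiff_const.mul (T.contMDiff_pairing (s.lift (W 0)) (s'.lift (W 1)))
  · change _ = AlternatingMap.alternatizeUncurryFin (b x) _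
    rw [hb, two_mul_pairing_shift]
    simp

variable {s s'} {s'' : T.IsotropicSplitting}

/-- Every tangent vector is the anchor of some element, so the defining equation prescribes B on all
pairs. -/
theorem isShift_unique {B B' : DiffForm E M 2} (h : s.IsShift s' B) (h' : s.IsShift s' B') :
    B = B' := by
  refine Subtype.ext (funext fun x => AlternatingMap.ext fun v => ?_)
  obtain ⟨w, hw⟩ := T.anchor_surjective x (v 1)
  have hv : v = ![v 0, T.anchor x w] := by
    ext1 i
    fin_cases i
    · rfl
    · exact hw.symm
  rw [hv, ← h, ← h']

theorem isShift_refl : s.IsShift s 0 := fun x v w => by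
  rw [sub_self, map_zero, LinearMap.zero_apply, mul_zero]
  rfl

theorem isShift_trans {B B' : DiffForm E M 2} (h : s.IsShift s' B) (h' : s'.IsShift s'' B') :
    s.IsShift s'' (B + B') := fun x v w => by
  have h1 := h x v w
  have h2 := h' x v w
  have : (B + B').1 x ![v, T.anchor x w]
    = B.1 x ![v, T.anchor x w] + B'.1 x ![v, T.anchor x w] := rfl
  rw [this, ← h1, ← h2, ← mul_add, ← LinearMap.add_apply, ← map_add]
  congr 3
  abel

end ExtendedTangentBundle
end Courant

/-! ### Exponentials of nilpotent ring elements -/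

section Truncated

variable {R : Type*} [Ring R] [Algebra ℝ R]

theorem mul_pow_eq_of_commutator {D N K : R} (h : D * N = N * D + K) (hK : Commute N K) (j : ℕ) :
    D * N ^ (j + 1) = N ^ (j + 1) * D + ((j : ℝ) + 1) • (N ^ j * K) := by
  induction j with
  | zero => simp [h]
  | succ j ih =>
    have hKj : N ^ j * K * N = N ^ (j + 1) * K := by
      rw [mul_assoc, ← hK.eq, ← mul_assoc, pow_succ]
    rw [pow_succ N (j + 1), ← mul_assoc, ih, add_mul, mul_assoc _ D N, h, smul_mul_assoc, hKj,
      mul_add, mul_assoc (N ^ (j + 1)) N D]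
    push_cast
    module

/-- Conjugation with the exponential of a nilpotent element whose commutator with `D` is `K`. -/
theorem mul_exp_sum {D N K : R} (h : D * N = N * D + K) (hK : Commute N K) {n : ℕ}
    (hn : N ^ (n + 1) = 0) :
    D * ∑ j ∈ Finset.range (n + 1), ((j.factorial : ℝ)⁻¹) • N ^ j
      = (∑ j ∈ Finset.range (n + 1), ((j.factorial : ℝ)⁻¹) • N ^ j) * (D + K) := by
  -- The commutator formula for the vanishing power N^(n+1) kills this product, so cutting both
  -- series at the same n loses nothing.
  have hlast : N ^ n * K = 0 := by
    have h' := mul_pow_eq_of_commutator h hK n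
    rw [hn, mul_zero, zero_mul, zero_add] at h'
    exact (smul_eq_zero.1 h'.symm).resolve_left (by positivity)
  rw [mul_add, Finset.sum_mul _ _ K, Finset.sum_range_succ _ n]
  rw [Finset.sum_range_succ (fun i => ((i.factorial : ℝ)⁻¹ • N ^ i) * K) n, smul_mul_assoc _ _ K,
    hlast, smul_zero, add_zero, ← Finset.sum_range_succ]
  rw [Finset.sum_range_succ', mul_add, add_mul, Finset.mul_sum, Finset.sum_mul, add_right_comm,
    ← Finset.sum_add_distrib]
  congr 1
  · refine Finset.sum_congr rfl fun j _ => ?_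
    rw [mul_smul_comm, mul_pow_eq_of_commutator h hK j, smul_add, smul_smul, smul_mul_assoc,
      smul_mul_assoc]
    congr 2
    rw [Nat.factorial_succ]
    have : (j.factorial : ℝ) ≠ 0 := by positivity
    have : ((j : ℝ) + 1) ≠ 0 := by positivity
    push_cast
    field_simp
  · simp

/-- The exponential law for nilpotent elements, in terms of truncated series. -/
theorem exp_sum_add {N N' : R} (h : Commute N N') {n : ℕ} (hN : N ^ (n + 1) = 0)
    (hN' : N' ^ (n + 1) = 0) (hNN : (N + N') ^ (n + 1) = 0) :
    ∑ j ∈ Finset.range (n + 1), ((j.factorial : ℝ)⁻¹) • (N + N') ^ j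
      = (∑ j ∈ Finset.range (n + 1), ((j.factorial : ℝ)⁻¹) • N ^ j)
        * ∑ j ∈ Finset.range (n + 1), ((j.factorial : ℝ)⁻¹) • N' ^ j := by
  -- `IsNilpotent.exp` is defined with rational coefficients; they act here through ℝ.
  let : Module ℚ R := Module.compHom R (algebraMap ℚ ℝ)
  have key : ∀ {A : R}, A ^ (n + 1) = 0 →
      ∑ j ∈ Finset.range (n + 1), ((j.factorial : ℝ)⁻¹) • A ^ j = IsNilpotent.exp A := by
    intro A hA
    rw [IsNilpotent.exp_eq_sum hA]
    refine Finset.sum_congr rfl fun j _ => ?_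
    change _ = (algebraMap ℚ ℝ) _ • A ^ j
    simp
  rw [key hN, key hN', key hNN, IsNilpotent.exp_add_of_commute h ⟨_, hN⟩ ⟨_, hN'⟩]

end Truncated

/-! ### The exponential of a two-form -/

section FormAlgebra

variable {E : Type*} [NormedAddCommGroup E] [NormedSpace ℝ E]
  {M : Type*} [TopologicalSpace M] [ChartedSpace E M] [IsManifold 𝓘(ℝ, E) ∞ M]
  {k p q : ℕ}

namespace Forms

variable [FiniteDimensional ℝ E]

theorem diffForm_eq_zero (h : Module.finrank ℝ E < k) (α : DiffForm E M k) : α = 0 := by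
  refine Subtype.ext (funext fun x => AlternatingMap.ext fun v => ?_)
  refine (α.1 x).map_linearDependent v fun hv => ?_
  have := LinearIndependent.fintype_card_le_finrank (R := ℝ) (M := E) hv
  simp at this
  omega

/-- The crude bound j on the degree is enough: after dim M + 1 multiplications it exceeds the
dimension. -/
theorem exists_wedgeLeft_pow_incl (B : DiffForm E M 2) (α : DiffForm E M k) (j : ℕ) :
    ∃ m, j ≤ m ∧ ∃ β : DiffForm E M m, (wedgeLeft B ^ j) (incl k α) = incl m β := by
  induction j with
  | zero => exact ⟨k, Nat.zero_le k, α, by simp⟩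
  | succ j ih =>
    obtain ⟨m, hm, β, hβ⟩ := ih
    refine ⟨2 + m, by omega, wedge B β, ?_⟩
    rw [pow_succ', Module.End.mul_apply, hβ, wedgeLeft_incl]

theorem wedgeLeft_pow_eq_zero (B : DiffForm E M 2) :
    wedgeLeft B ^ (Module.finrank ℝ E + 1) = 0 := by
  refine linearMap_ext fun k α => ?_
  obtain ⟨m, hm, β, hβ⟩ := exists_wedgeLeft_pow_incl B α (Module.finrank ℝ E + 1)
  rw [hβ, diffForm_eq_zero hm β, map_zero, LinearMap.zero_apply]

theorem neg_wedgeLeft_pow_eq_zero (B : DiffForm E M 2) :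
    (-wedgeLeft B) ^ (Module.finrank ℝ E + 1) = 0 := by
  have key : ∀ {R : Type _} [Ring R] {a : R} {n : ℕ}, a ^ n = 0 → (-a) ^ n = 0 :=
    fun h => by rw [neg_pow, h, mul_zero]
  exact key (wedgeLeft_pow_eq_zero B)

theorem expNeg_eq_sum (B : DiffForm E M 2) : expNeg B =
    ∑ j ∈ Finset.range (Module.finrank ℝ E + 1),
      ((j.factorial : ℝ)⁻¹) • (-wedgeLeft B) ^ j := by
  refine Finset.sum_congr rfl fun j _ => ?_
  rw [← neg_one_smul ℝ (wedgeLeft B), smul_pow, smul_smul, div_eq_inv_mul]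

variable [T2Space M]

theorem wedgeLeft_two_commute (B : DiffForm E M 2) (α : DiffForm E M p) :
    Commute (wedgeLeft B) (wedgeLeft α) := by
  have h := wedgeLeft_wedgeLeft B α
  rw [pow_mul, neg_one_sq, one_pow, one_smul] at h
  exact h

theorem expNeg_add (B B' : DiffForm E M 2) : expNeg (B + B') = expNeg B * expNeg B' := by
  have h : -wedgeLeft (B + B') = -wedgeLeft B + -wedgeLeft B' := by
    rw [wedgeLeft_add, neg_add]
  have h0 := neg_wedgeLeft_pow_eq_zero (B + B')
  rw [expNeg_eq_sum, expNeg_eq_sum, expNeg_eq_sum, h]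
  rw [h] at h0
  exact exp_sum_add (wedgeLeft_two_commute B B').neg_left.neg_right (neg_wedgeLeft_pow_eq_zero B)
    (neg_wedgeLeft_pow_eq_zero B') h0

theorem expNeg_zero : expNeg (0 : DiffForm E M 2) = 1 := by
  rw [expNeg, wedgeLeft_zero, Finset.sum_range_succ', Finset.sum_eq_zero]
  · simp
  · intro j _
    rw [zero_pow (Nat.succ_ne_zero j), smul_zero]

/-- Conjugation by e^{-B} adds to D its commutator with -B∧, and the series stops there because this
commutator commutes with B∧. It is applied to D = α∧, ι_X and d. -/
theorem mul_expNeg {D K : Module.End ℝ (Forms E M)} {B : DiffForm E M 2}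
    (h : D * wedgeLeft B = wedgeLeft B * D + K) (hK : Commute (wedgeLeft B) K) :
    D * expNeg B = expNeg B * (D - K) := by
  rw [expNeg_eq_sum, sub_eq_add_neg]
  refine mul_exp_sum ?_ hK.neg_left.neg_right (neg_wedgeLeft_pow_eq_zero B)
  rw [mul_neg, h, neg_add, neg_mul]

theorem wedgeLeft_mul_expNeg (α : DiffForm E M p) (B : DiffForm E M 2) :
    wedgeLeft α * expNeg B = expNeg B * wedgeLeft α := by
  have h := mul_expNeg (D := wedgeLeft α) (K := 0) (B := B)
    (by rw [add_zero]; exact (wedgeLeft_two_commute B α).eq.symm) (Commute.zero_right _)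
  rwa [sub_zero] at h

theorem contr_mul_expNeg (X : VectorField E M) (B : DiffForm E M 2) :
    contr X * expNeg B = expNeg B * (contr X - wedgeLeft (contract X B)) := by
  refine mul_expNeg ?_ (wedgeLeft_two_commute B _)
  rw [contr_wedgeLeft, neg_one_sq, one_smul, add_comm]
  rfl

theorem d_mul_expNeg (B : DiffForm E M 2) :
    d * expNeg B = expNeg B * (d - wedgeLeft (extDeriv B)) := by
  refine mul_expNeg ?_ (wedgeLeft_two_commute B _)
  rw [d_wedgeLeft, neg_one_sq, one_smul, add_comm]

end Forms

end FormAlgebra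

/-! ### Graded algebra of the twisted operators -/

section Commutators

variable {R : Type*} [Ring R] [Algebra ℝ R]

/-- The cross terms of d with ξ∧ and of H∧ with ι_X give dξ - ι_X H; the operators H∧ and ξ∧, both
of odd degree, anticommute. -/
theorem twisted_cartan {l d c h x w w' : R} (hl : l = d * c + c * d)
    (hdx : d * x = w + (-1 : ℝ) ^ 1 • (x * d)) (hch : c * h = w' + (-1 : ℝ) ^ 3 • (h * c))
    (hhx : h * x = (-1 : ℝ) ^ (3 * 1) • (x * h)) :
    l + (w - w') = (d - h) * (c + x) + (c + x) * (d - h) := by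
  simp only [mul_add, add_mul, mul_sub, sub_mul, hdx, hch, hhx, hl]
  norm_num
  abel

theorem clifford_anticommutator {c c' x x' f f' : R} (hcc : c * c' = -(c' * c))
    (hcx : c * x' = f + (-1 : ℝ) ^ 1 • (x' * c)) (hcx' : c' * x = f' + (-1 : ℝ) ^ 1 • (x * c'))
    (hxx : x * x' = (-1 : ℝ) ^ (1 * 1) • (x' * x)) :
    (c + x) * (c' + x') + (c' + x') * (c + x) = f + f' := by
  simp only [mul_add, add_mul, hcc, hcx, hcx', hxx]
  norm_num
  abel

theorem twisted_lie_clifford {l u c x c' x' v : R} (hlc : l * c = c * l + c')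
    (hlx : l * x = x * l + x') (hcu : c * u = v + (-1 : ℝ) ^ 2 • (u * c))
    (hux : u * x = (-1 : ℝ) ^ (2 * 1) • (x * u)) :
    (l + u) * (c + x) - (c + x) * (l + u) = c' + (x' - v) := by
  simp only [mul_add, add_mul, hlc, hlx, hcu, hux]
  norm_num
  abel

/-- The operator `h` is of odd degree and so anticommutes with itself, which gives h² = 0 over ℝ;
the cross terms cancel by `hdh`, which encodes dH = 0. -/
theorem twisted_d_sq {d h : R} (hdd : d * d = 0) (hdh : d * h = (-1 : ℝ) ^ 3 • (h * d))
    (hhh : h * h = (-1 : ℝ) ^ (3 * 3) • (h * h)) : (d - h) * (d - h) = 0 := by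
  have h0 : h * h = 0 := by
    have h2 : (2 : ℝ) • (h * h) = 0 := by
      rw [two_smul]
      nth_rewrite 1 [hhh]
      norm_num
    exact (smul_eq_zero.1 h2).resolve_left two_ne_zero
  simp only [mul_sub, sub_mul, hdd, hdh, h0]
  norm_num

theorem commute_of_sq_eq_zero {D C L : R} (hL : L = D * C + C * D) (hD : D * D = 0) :
    D * L - L * D = 0 := by
  rw [hL, mul_add, add_mul, ← mul_assoc, hD, mul_assoc C D D, hD]
  simp [mul_assoc]

/-- The graded Jacobi identity: L' commutes with D, so its commutator with L = DC + CD acts on C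
alone and replaces it by C'. -/
theorem lie_commutator {D C L L' C' L'' : R} (hL : L = D * C + C * D)
    (hL'' : L'' = D * C' + C' * D) (hC : L' * C - C * L' = C') (hD : D * L' - L' * D = 0) :
    L' * L - L * L' = L'' := by
  have hD' : L' * D = D * L' := (sub_eq_zero.1 hD).symm
  have h1 : L' * (D * C) = D * (L' * C) := by rw [← mul_assoc, hD', mul_assoc]
  simp only [hL, hL'', ← hC, mul_add, add_mul, mul_sub, sub_mul, mul_assoc, h1, ← hD']
  abel

end Commutators

/-! ### Twisted Cartan relations and independence of the splitting -/

section Courant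

variable {E : Type*} [NormedAddCommGroup E] [NormedSpace ℝ E]
  {M : Type*} [TopologicalSpace M] [ChartedSpace E M] [IsManifold 𝓘(ℝ, E) ∞ M]
  {F : Type*} [NormedAddCommGroup F] [NormedSpace ℝ F]
  {V : M → Type*} [TopologicalSpace (TotalSpace F V)] [∀ x, TopologicalSpace (V x)]
  [FiberBundle F V] [∀ x, AddCommGroup (V x)] [∀ x, Module ℝ (V x)] [VectorBundle ℝ F V]
  [FiniteDimensional ℝ E] [FiniteDimensional ℝ F] [T2Space M]
  [ContMDiffVectorBundle ∞ F V 𝓘(ℝ, E)]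

namespace ExtendedTangentBundle

open Forms

variable {T : ExtendedTangentBundle E M F V} (s s' : T.IsotropicSplitting)

theorem twistedLie_eq (X : Cₛ^∞⟮𝓘(ℝ, E); F, V⟯) :
    s.twistedLie X = s.twistedD * s.clifford X + s.clifford X * s.twistedD := by
  refine Eq.trans (congrArg (lie (T.anchorField X) + ·) (wedgeLeft_sub _ _)) ?_
  exact twisted_cartan (R := Module.End ℝ (Forms E M)) (lie_eq _) (d_wedgeLeft _)
    (contr_wedgeLeft _ _) (wedgeLeft_wedgeLeft _ _)

/-- The pairing `2 ⟨X, Y⟩` in terms of a splitting. -/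
theorem pairTwo_eq (X Y : Cₛ^∞⟮𝓘(ℝ, E); F, V⟯) :
    T.pairTwo X Y = toFunction (contract (T.anchorField X) (s.oneForm Y))
      + toFunction (contract (T.anchorField Y) (s.oneForm X)) := by
  have h : ∀ X Y : Cₛ^∞⟮𝓘(ℝ, E); F, V⟯,
      toFunction (contract (T.anchorField X) (s.oneForm Y))
        = T.pairTwo (Y - s.lift (T.anchorField Y)) X := fun X Y => by
    rw [pairTwo_sub_lift, toFunction, evalFields_contract]
  rw [h, h]
  ext x
  have h1 := pairing_sub_lift s s x (X x) (Y x)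
  have h2 := s.isotropic x (T.anchor x (X x)) (T.anchor x (Y x))
  have h3 := T.pairing_symm x (X x) (Y x)
  have h4 := T.pairing_symm x (s.toFun x (T.anchor x (X x))) (Y x)
  have h5 := pairing_sub_lift s s x (Y x) (s.toFun x (T.anchor x (X x)))
  have h6 := T.pairing_symm x (s.toFun x (T.anchor x (X x))) (s.toFun x (T.anchor x (Y x)))
  change 2 * T.pairing x (X x) (Y x)
    = 2 * T.pairing x (Y x - s.toFun x (T.anchor x (Y x))) (X x)
      + 2 * T.pairing x (X x - s.toFun x (T.anchor x (X x))) (Y x)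
  have h7 := pairing_sub_lift s s x (Y x) (X x)
  simp only [map_sub, LinearMap.sub_apply, s.anchor_toFun] at *
  linarith

theorem clifford_anticomm (X Y : Cₛ^∞⟮𝓘(ℝ, E); F, V⟯) :
    s.clifford X * s.clifford Y + s.clifford Y * s.clifford X
      = (2 : ℝ) • smulFun (T.pairingFun X Y) := by
  refine (clifford_anticommutator (R := Module.End ℝ (Forms E M)) (contr_contr _ _)
    (contr_wedgeLeft _ _) (contr_wedgeLeft _ _) (wedgeLeft_wedgeLeft _ _)).trans ?_
  change wedgeLeft (contract (T.anchorField X) (s.oneForm Y))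
    + wedgeLeft (contract (T.anchorField Y) (s.oneForm X)) = _
  have h : ∀ f : C^∞⟮𝓘(ℝ, E), M; ℝ⟯, (2 : ℝ) • smulFun f = smulFun ((2 : ℝ) • f) := by
    intro f
    refine linearMap_ext fun k α => ?_
    rw [LinearMap.smul_apply, smulFun_incl, smulFun_incl, ← map_smul]
    exact congrArg (incl k) (Subtype.ext (funext fun x => (smul_assoc (2 : ℝ) (f x) (α.1 x)).symm))
  rw [h, ← wedgeLeft_add, wedgeLeft_zero_degree]
  exact congrArg smulFun (pairTwo_eq s X Y).symm

theorem twistedLie_clifford (X Y : Cₛ^∞⟮𝓘(ℝ, E); F, V⟯) :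
    s.twistedLie X * s.clifford Y - s.clifford Y * s.twistedLie X
      = s.clifford (T.bracket X Y) := by
  refine (twisted_lie_clifford (R := Module.End ℝ (Forms E M)) (lie_contr _ _)
    (lie_wedgeLeft _ _) (contr_wedgeLeft _ _) (wedgeLeft_wedgeLeft _ _)).trans ?_
  refine congrArg₂ (· + ·) (congrArg contr (anchorField_bracket T X Y).symm) ?_
  -- What remains is that the one-form part of the bracket equals L_X η - ι_Y(dξ - ι_X H).
  refine (wedgeLeft_sub _ _).symm.trans (congrArg wedgeLeft ?_)
  rw [oneForm_bracket]
  refine (congrArg (lieDeriv (T.anchorField X) (s.oneForm Y) - ·)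
    ((contract (T.anchorField Y)).map_sub (extDeriv (s.oneForm X))
      (contract (T.anchorField X) s.twistingForm))).trans ?_
  have key : ∀ {G : Type _} [AddCommGroup G] (a b c : G), a - (b - c) = a - b + c :=
    fun a b c => (sub_add a b c).symm
  exact key (G := DiffForm E M 1) _ _ _

theorem twistedD_sq : s.twistedD * s.twistedD = 0 := by
  refine twisted_d_sq (R := Module.End ℝ (Forms E M)) d_d ?_ (wedgeLeft_wedgeLeft _ _)
  refine (d_wedgeLeft _).trans ?_
  rw [extDeriv_twistingForm, wedgeLeft_zero, zero_add]

theorem twistedD_twistedLie (X : Cₛ^∞⟮𝓘(ℝ, E); F, V⟯) :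
    s.twistedD * s.twistedLie X - s.twistedLie X * s.twistedD = 0 :=
  commute_of_sq_eq_zero (twistedLie_eq s X) (twistedD_sq s)

theorem twistedLie_twistedLie (X Y : Cₛ^∞⟮𝓘(ℝ, E); F, V⟯) :
    s.twistedLie X * s.twistedLie Y - s.twistedLie Y * s.twistedLie X
      = s.twistedLie (T.bracket X Y) :=
  lie_commutator (twistedLie_eq s Y) (twistedLie_eq s _) (twistedLie_clifford s X Y)
    (twistedD_twistedLie s X)

variable {s s'} {B : DiffForm E M 2}

/-- The operator of a section does not depend on the splitting. -/
theorem clifford_mul_expNeg (hB : s.IsShift s' B) (X : Cₛ^∞⟮𝓘(ℝ, E); F, V⟯) :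
    s.clifford X * expNeg B = expNeg B * s'.clifford X := by
  have h : wedgeLeft (s.oneForm X)
      = wedgeLeft (s'.oneForm X) + wedgeLeft (contract (T.anchorField X) B) := by
    rw [← wedgeLeft_add, oneForm_eq_of_isShift hB X]
  refine (add_mul _ _ _).trans ?_
  rw [contr_mul_expNeg, wedgeLeft_mul_expNeg, ← mul_add, h]
  congr 1
  have key : ∀ {G : Type _} [AddCommGroup G] (a b c : G), a - b + (c + b) = a + c := by
    intros
    abel
  exact key _ _ _

/-- The twisted differential does not depend on the splitting. -/
theorem twistedD_mul_expNeg (hB : s.IsShift s' B) :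
    s.twistedD * expNeg B = expNeg B * s'.twistedD := by
  have h : wedgeLeft s'.twistingForm = wedgeLeft s.twistingForm + wedgeLeft (extDeriv B) := by
    rw [← wedgeLeft_add, twistingForm_eq_of_isShift hB]
  refine (sub_mul _ _ _).trans ?_
  rw [d_mul_expNeg, wedgeLeft_mul_expNeg, ← mul_sub, sub_sub, add_comm, ← h]
  rfl

/-- The twisted Lie derivative does not depend on the splitting. -/
theorem twistedLie_mul_expNeg (hB : s.IsShift s' B) (X : Cₛ^∞⟮𝓘(ℝ, E); F, V⟯) :
    s.twistedLie X * expNeg B = expNeg B * s'.twistedLie X := by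
  rw [twistedLie_eq, twistedLie_eq, add_mul, mul_assoc, mul_assoc, twistedD_mul_expNeg hB,
    clifford_mul_expNeg hB, ← mul_assoc, ← mul_assoc, twistedD_mul_expNeg hB,
    clifford_mul_expNeg hB, mul_assoc, mul_assoc, mul_add]

/-- Spinors are the families compatible with all transitions e^{-B}, so operators that intertwine
these transitions preserve them. -/
theorem splittingwise_mem_spinors {f : T.IsotropicSplitting → Module.End ℝ (Forms E M)}
    (hf : ∀ (s s' : T.IsotropicSplitting) (B : DiffForm E M 2), s.IsShift s' B →
      f s * expNeg B = expNeg B * f s') {ρ : T.FormFamily} (hρ : ρ ∈ T.spinors) :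
    T.splittingwise f ρ ∈ T.spinors := by
  intro s s' B hB
  change f s (ρ s) = expNeg B (f s' (ρ s'))
  rw [hρ s s' B hB]
  exact LinearMap.congr_fun (hf s s' B hB) (ρ s')

/-- A splitting identifies the abstract spinors with the forms of mixed degree. -/
theorem existsUnique_spinor (s : T.IsotropicSplitting) (α : Forms E M) :
    ∃! ρ : T.FormFamily, ρ ∈ T.spinors ∧ ρ s = α := by
  choose β hβ using fun s₁ s₂ : T.IsotropicSplitting => exists_isShift s₁ s₂
  -- The values in all splittings are transported from `s`. They are compatible because the
  -- two-forms between splittings are unique, hence additive, and the exponential turns sums into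
  -- products.
  refine ⟨fun s' => expNeg (β s' s) α, ⟨fun s₁ s₂ B hB => ?_, ?_⟩, fun ρ hρ => ?_⟩
  · change expNeg (β s₁ s) α = expNeg B (expNeg (β s₂ s) α)
    rw [isShift_unique (hβ s₁ s) (isShift_trans hB (hβ s₂ s)), expNeg_add]
    rfl
  · change expNeg (β s s) α = α
    rw [isShift_unique (hβ s s) isShift_refl, expNeg_zero]
    rfl
  · funext s'
    rw [hρ.1 s' s _ (hβ s' s), hρ.2]

end ExtendedTangentBundle
end Courant

end ExtendedManifold

end

theorem mainTheorem6
    {E : Type*} [NormedAddCommGroup E] [NormedSpace ℝ E] [FiniteDimensional ℝ E]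
    {M : Type*} [TopologicalSpace M] [T2Space M] [ChartedSpace E M] [IsManifold 𝓘(ℝ, E) ∞ M]
    {F : Type*} [NormedAddCommGroup F] [NormedSpace ℝ F] [FiniteDimensional ℝ F]
    {V : M → Type*} [TopologicalSpace (TotalSpace F V)] [∀ x, TopologicalSpace (V x)]
    [FiberBundle F V] [∀ x, AddCommGroup (V x)] [∀ x, Module ℝ (V x)] [VectorBundle ℝ F V]
    [ContMDiffVectorBundle ∞ F V 𝓘(ℝ, E)]
    (T : ExtendedManifold.ExtendedTangentBundle E M F V) :
    -- a splitting identifies the abstract spinors with the differential forms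
    (∀ (s : T.IsotropicSplitting) (α : ExtendedManifold.Forms E M),
      ∃! ρ : T.FormFamily, ρ ∈ T.spinors ∧ ρ s = α) ∧
    -- the operators are independent of the splitting
    (∀ ρ ∈ T.spinors, T.dT ρ ∈ T.spinors) ∧
    (∀ X : Cₛ^∞⟮𝓘(ℝ, E); F, V⟯, ∀ ρ ∈ T.spinors, T.iotaT X ρ ∈ T.spinors) ∧
    (∀ X : Cₛ^∞⟮𝓘(ℝ, E); F, V⟯, ∀ ρ ∈ T.spinors, T.lieT X ρ ∈ T.spinors) ∧
    -- the twisted Cartan relations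
    ∀ X Y : Cₛ^∞⟮𝓘(ℝ, E); F, V⟯, ∀ ρ ∈ T.spinors,
      T.lieT X ρ = T.dT (T.iotaT X ρ) + T.iotaT X (T.dT ρ) ∧
      T.lieT X (T.lieT Y ρ) - T.lieT Y (T.lieT X ρ) = T.lieT (T.bracket X Y) ρ ∧
      T.iotaT X (T.iotaT Y ρ) + T.iotaT Y (T.iotaT X ρ)
        = (2 : ℝ) • T.mulSpinor (T.pairingFun X Y) ρ ∧
      T.lieT X (T.iotaT Y ρ) - T.iotaT Y (T.lieT X ρ) = T.iotaT (T.bracket X Y) ρ ∧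
      T.dT (T.lieT X ρ) - T.lieT X (T.dT ρ) = 0 ∧
      T.dT (T.dT ρ) = 0 := by
  refine ⟨fun s α => ExtendedManifold.ExtendedTangentBundle.existsUnique_spinor s α,
    fun ρ hρ => ExtendedManifold.ExtendedTangentBundle.splittingwise_mem_spinors
      (fun s s' B hB => ExtendedManifold.ExtendedTangentBundle.twistedD_mul_expNeg hB) hρ,
    fun X ρ hρ => ExtendedManifold.ExtendedTangentBundle.splittingwise_mem_spinors
      (fun s s' B hB => ExtendedManifold.ExtendedTangentBundle.clifford_mul_expNeg hB X) hρ,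
    fun X ρ hρ => ExtendedManifold.ExtendedTangentBundle.splittingwise_mem_spinors
      (fun s s' B hB => ExtendedManifold.ExtendedTangentBundle.twistedLie_mul_expNeg hB X) hρ,
    fun X Y ρ _ => ⟨?_, ?_, ?_, ?_, ?_, ?_⟩⟩ <;> funext s
  · exact LinearMap.congr_fun (ExtendedManifold.ExtendedTangentBundle.twistedLie_eq s X) (ρ s)
  · exact LinearMap.congr_fun
      (ExtendedManifold.ExtendedTangentBundle.twistedLie_twistedLie s X Y) (ρ s)
  · exact LinearMap.congr_fun
      (ExtendedManifold.ExtendedTangentBundle.clifford_anticomm s X Y) (ρ s)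
  · exact LinearMap.congr_fun
      (ExtendedManifold.ExtendedTangentBundle.twistedLie_clifford s X Y) (ρ s)
  · exact LinearMap.congr_fun
      (ExtendedManifold.ExtendedTangentBundle.twistedD_twistedLie s X) (ρ s)
  · exact LinearMap.congr_fun (ExtendedManifold.ExtendedTangentBundle.twistedD_sq s) (ρ s)
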